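/- **Setting.** Let $M\ge 2$, $\Lambda\ge 0$, $j_{max}\ge 0$ be integers (for instance $j_{max}=\lfloor\log_M\Lambda\rfloor$) and $\lambda\in\mathbb C$ with $|\arg\lambda|<\pi$ (with $\arg 0=0$); $\sqrt{2\lambda}$ is the principal square root. Matrix indices run over $0,\dots,\Lambda$. Put $S=\{0,\dots,j_{max}\}$, $I_j=[M^j,M^{j+1}-1]\cap\mathbb N$, $I_J=\bigcup_{j\in J}I_j$ for $J\subseteq S$, and $I=I_S$. For $\omega\in I$ let $C^\omega$ be the diagonal operator on $\mathbb C^{\Lambda+1}\otimes\mathbb C^{\Lambda+1}$ with entries $C^\omega_{mn}=\frac1{m+n+1}$ if $m+n=\omega$ and $0$ otherwise, and $T^\omega_m=\sum_n C^\omega_{mn}$. For $t=(t^\omega)_{\omega\in I}\in[0,1]^I$ put $C(t)=\sum_\omega t^\omega C^\omega$ and $T(t)=\sum_\omega t^\omega T^\omega$. Let $\nu$ be the Gaussian measure on Hermitian $(\Lambda+1)\times(\Lambda+1)$ matrices $\sigma$ with covariance $\langle\sigma_{mn}\sigma_{kl}\rangle=\delta_{ml}\delta_{nk}$, let $\hat\sigma=I\otimes\sigma+\sigma^t\otimes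 I$ and $R=(1+i\frac{\sqrt{2\lambda}}2C(t)\hat\sigma)^{-1}$, and $$V(t,\sigma)=-\tfrac12\mathrm{Tr}\log_2\!\big[1+i\tfrac{\sqrt{2\lambda}}2C(t)\hat\sigma\big]+i\tfrac{\sqrt{2\lambda}}2\sum_mT(t)_m\sigma_{mm}+\tfrac{\lambda}2\sum_mT(t)_m^2,\qquad \log_2(1+x)=\log(1+x)-x .$$ The interpolated cutoff partition function is $Z^{j_{max}}(\lambda,t)=\int d\nu(\sigma)\,e^{V(t,\sigma)}$, and $Z^{j_{max}}(\lambda)=Z^{j_{max}}(\lambda,t)|_{t\equiv1}$. **Graphs.** A resolvent graph $G$ is a ribbon graph consisting of finitely many cyclic loop vertices carrying $\sigma$ half-edges (each loop vertex at least one), each half-edge being hooked to the outer border ($\sigma^t\otimes I$) or the inner border ($I\otimes\sigma$), and of a pairing of all the half-edges into $\sigma$ propagators; the number $n(G)$ of $\sigma$ propagators is the order of $G$. Between consecutive half-edges of a loop vertex there is one c-propagator, which may bear a mark $\omega$. A c-propagator is a tadpole if one of its two borders forms a closed face by itself. For a finite set $\Omega$ of marks, $G$ is a minimal $\Omega$-resolvent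 graph if each $\omega\in\Omega$ marks exactly one c-propagator and there are no other marks, each connected component of $G$ bears a mark, and $n(G)\le|\Omega|$. Let $\mathcal G(\Omega)$ be the finite set of isomorphism classes of these graphs. The renormalized amplitude is $$A^R_G(t,\sigma)=(-\lambda)^{n(G)}\prod_{G^c}\mathrm{Tr}^{G^c}\Big\{\prod_{\ell\ \mathrm{tadpole}}[(R-1)\tilde C(\ell)]\prod_{\ell\ \mathrm{not\ tadpole}}[R\,\tilde C(\ell)]\Big\},$$ where $G^c$ runs over the connected components, $\ell$ over the c-propagators, $\tilde C(\ell)=C^\omega$ if $\ell$ bears the mark $\omega$ and $\tilde C(\ell)=C(t)$ if it bears none, and the traces are sums over all the double indices, contracted along the graph (each $\sigma$ propagator contracting its two ends by $\langle\sigma_{ab}\sigma_{cd}\rangle=\delta_{ad}\delta_{bc}$). **Theorem.** There are numbers $c(G)\in[0,1]$, depending only on the isomorphism class of the marked graph $G$ (not on $M,\Lambda,j_{max},\lambda$), with $c(G)=\prod_{G^c}c(G^c)$ over connected components, such that for all $M,\Lambda,j_{max},\lambda$ as above all the resolvents exist, all the integrals below converge absolutely, and $$Z^{j_{max}}(\lambda)=\sum_{J\subseteq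 S}\ \sum_{\Omega_J}\ \sum_{G\in\mathcal G(\Omega_J)}c(G)\int d\nu(\sigma)\prod_{\omega\in\Omega_J}\int_0^1dt^\omega\,\big[e^{V(t,\sigma)}A^R_G(t,\sigma)\big]\Big|_{t^\omega=0\text{ for }\omega\notin\Omega_J},$$ where $\Omega_J=\bigcup_{j\in J}\Omega_j$ runs over the sets with $\emptyset\neq\Omega_j\subseteq I_j$ for all $j\in J$. All tadpoles cancel exactly against the Wick counter-terms, one derivation at a time: the functions $Z_\Omega(t)=\sum_{G\in\mathcal G(\Omega)}c(G)\int d\nu(\sigma)\,e^{V(t,\sigma)}A^R_G(t,\sigma)$ satisfy $Z_\emptyset(t)=Z^{j_{max}}(\lambda,t)$ and $\partial Z_\Omega/\partial t^\omega=Z_{\Omega\cup\{\omega\}}$ for $\Omega\subseteq I$, $\omega\in I\setminus\Omega$, $t\in[0,1]^I$ with $0<t^\omega<1$. -/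

import Mathlib

open scoped Kronecker

noncomputable section

namespace GW2

/-! ### Intermediate field, sliced propagators, interaction -/

/-- Real coordinates of a Hermitian matrix with rows and columns indexed by `0, …, Λ`. -/
abbrev Coord (Λ : ℕ) : Type := Fin (Λ + 1) × Fin (Λ + 1) → ℝ

/-- Double indices `(m, n)`, `0 ≤ m, n ≤ Λ`: the two borders of a ribbon. The first component
belongs to the outer border, the second one to the inner border. -/
abbrev Ix (Λ : ℕ) : Type := Fin (Λ + 1) × Fin (Λ + 1)

/-- Operators on `ℂ^(Λ+1) ⊗ ℂ^(Λ+1)`. -/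
abbrev Op (Λ : ℕ) : Type := Matrix (Ix Λ) (Ix Λ) ℂ

/-- The Hermitian matrix with coordinates `x`: `σ_mm = x_mm` and
`σ_mn = (x_mn + i x_nm) / √2` for `m < n`, so that `Tr σ² = ∑ x_mn²`. -/
def sigma {Λ : ℕ} (x : Coord Λ) : Matrix (Fin (Λ + 1)) (Fin (Λ + 1)) ℂ :=
  Matrix.of fun m n =>
    if m = n then (x (m, m) : ℂ)
    else if m < n then ((x (m, n) : ℂ) + (x (n, m) : ℂ) * Complex.I) / (Real.sqrt 2 : ℂ)
    else ((x (n, m) : ℂ) - (x (m, n) : ℂ) * Complex.I) / (Real.sqrt 2 : ℂ)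

/-- The normalized Gaussian measure with density proportional to `exp (-Tr σ² / 2)`,
written in the coordinates of `sigma`; its covariance is `⟨σ_mn σ_kl⟩ = δ_ml δ_nk`. -/
def nu (Λ : ℕ) : MeasureTheory.Measure (Coord Λ) :=
  MeasureTheory.Measure.pi fun _ => ProbabilityTheory.gaussianReal 0 1

/-- `σ̂ = I ⊗ σ + σᵗ ⊗ I`. -/
def sigmaHat {Λ : ℕ} (x : Coord Λ) : Op Λ :=
  (1 : Matrix (Fin (Λ + 1)) (Fin (Λ + 1)) ℂ) ⊗ₖ sigma x
    + (sigma x).transpose ⊗ₖ (1 : Matrix (Fin (Λ + 1)) (Fin (Λ + 1)) ℂ)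

/-- The slice `I_j = [M^j, M^(j+1) - 1]` of refined scaling indices. -/
def slice (M j : ℕ) : Finset ℕ := Finset.Ico (M ^ j) (M ^ (j + 1))

/-- `I_J`, the union of the slices `I_j`, `j ∈ J`. -/
def indexSet (M : ℕ) (J : Finset ℕ) : Finset ℕ := J.biUnion (slice M)

/-- All refined scaling indices `I_0 ∪ … ∪ I_jmax`. -/
def allIndices (M jmax : ℕ) : Finset ℕ := indexSet M (Finset.range (jmax + 1))

/-- The refined index sets `Ω_J = ⋃_{j ∈ J} Ω_j` with `∅ ≠ Ω_j ⊆ I_j` for all `j ∈ J`. -/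
def refinedSets (M : ℕ) (J : Finset ℕ) : Finset (Finset ℕ) :=
  (indexSet M J).powerset.filter fun Ω => ∀ j ∈ J, (Ω ∩ slice M j).Nonempty

/-- The number `C^ω_mn`: `1 / (m + n + 1)` if `m + n = ω`, and `0` otherwise. -/
def sliceCoeff {Λ : ℕ} (ω : ℕ) (p : Ix Λ) : ℂ :=
  if (p.1 : ℕ) + (p.2 : ℕ) = ω then 1 / ((p.1 : ℂ) + (p.2 : ℂ) + 1) else 0

/-- The sliced propagator `C^ω`, a diagonal operator. -/
def sliceProp (Λ ω : ℕ) : Op Λ := Matrix.diagonal (sliceCoeff ω)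

/-- The interpolated propagator `C(t) = ∑_{ω ∈ I} t^ω C^ω`. -/
def prop (Λ : ℕ) (I : Finset ℕ) (t : ℕ → ℝ) : Op Λ :=
  ∑ ω ∈ I, (t ω : ℂ) • sliceProp Λ ω

/-- The sliced tadpole `T^ω_m = ∑_n C^ω_mn`. -/
def sliceTadpole {Λ : ℕ} (ω : ℕ) (m : Fin (Λ + 1)) : ℂ :=
  ∑ n : Fin (Λ + 1), sliceCoeff ω (m, n)

/-- The interpolated counter-term `T(t) = ∑_{ω ∈ I} t^ω T^ω`. -/
def tadpole {Λ : ℕ} (I : Finset ℕ) (t : ℕ → ℝ) (m : Fin (Λ + 1)) : ℂ :=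
  ∑ ω ∈ I, (t ω : ℂ) * sliceTadpole ω m

/-- The principal square root `√(2λ)`. -/
def sqrtTwo (lam : ℂ) : ℂ := (2 * lam) ^ (1 / 2 : ℂ)

/-- `i (√(2λ) / 2) C(t) σ̂`. -/
def vertexOp {Λ : ℕ} (lam : ℂ) (I : Finset ℕ) (t : ℕ → ℝ) (x : Coord Λ) : Op Λ :=
  (Complex.I * sqrtTwo lam / 2) • (prop Λ I t * sigmaHat x)

/-- The resolvent `R = (1 + i (√(2λ) / 2) C(t) σ̂)⁻¹`. -/
def resolvent {Λ : ℕ} (lam : ℂ) (I : Finset ℕ) (t : ℕ → ℝ) (x : Coord Λ) : Op Λ :=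
  (1 + vertexOp lam I t x)⁻¹

/-- `Tr log₂ (1 + X)`, where `log₂ (1 + X) = log (1 + X) - X` and the principal logarithm is
`log (1 + X) = ∫₀¹ X (1 + u X)⁻¹ du` (`1 + u X` is invertible for all `u ∈ [0, 1]` in the
cases at hand). -/
def trLogTwo {Λ : ℕ} (X : Op Λ) : ℂ :=
  ∫ u in (0 : ℝ)..1, Matrix.trace (X * ((1 + (u : ℂ) • X)⁻¹ - 1))

/-- The interaction
`V(t, σ) = -½ Tr log₂ (1 + i (√(2λ)/2) C(t) σ̂) + i (√(2λ)/4) Tr [T(t) σ̂] + ½ λ Tr T(t)²`,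
where `Tr [T σ̂] = 2 ∑ T_m σ_mm`. -/
def interaction {Λ : ℕ} (lam : ℂ) (I : Finset ℕ) (t : ℕ → ℝ) (x : Coord Λ) : ℂ :=
  -(1 / 2) * trLogTwo (vertexOp lam I t x)
    + Complex.I * sqrtTwo lam / 4 * (2 * ∑ m, tadpole I t m * sigma x m m)
    + 1 / 2 * lam * ∑ m : Fin (Λ + 1), tadpole I t m ^ 2

/-- The interpolated partition function `Z(λ, t) = ∫ dν(σ) exp V(t, σ)`. -/
def partitionFn (Λ : ℕ) (lam : ℂ) (I : Finset ℕ) (t : ℕ → ℝ) : ℂ :=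
  ∫ x, Complex.exp (interaction lam I t x) ∂(nu Λ)

/-! ### Resolvent graphs -/

/-- A border of a ribbon. -/
inductive Border : Type
  | outer
  | inner

instance : Finite Border :=
  Finite.of_injective (fun b : Border => match b with | Border.outer => true | Border.inner => false)
    (by intro a b h; cases a <;> cases b <;> simp_all)

/-- A resolvent ribbon graph with set `H` of `σ` half-edges. The cycles of `next` are the loop
vertices: a cycle `(h₁ h₂ … h_k)` stands for
`Tr [(RC)_{h₁} σ_{h₁} (RC)_{h₂} σ_{h₂} ⋯ (RC)_{h_k} σ_{h_k}]`, so there is one c-propagator for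
each half-edge `h`, namely the one which ends at `h`; `pair` joins the half-edges to
`σ` propagators; `side h` is the border of the ribbon to which `h` is hooked; `mark h` is the mark
of the c-propagator ending at `h`, if it has one. -/
structure ResolventGraph (H : Type) where
  next : Equiv.Perm H
  pair : Equiv.Perm H
  pair_pair : ∀ h, pair (pair h) = h
  pair_ne : ∀ h, pair h ≠ h
  side : H → Border
  mark : H → Option ℕ

namespace ResolventGraph

variable {H H' : Type}

/-- The perturbation order, i.e. the number of `σ` propagators. -/
def order (_G : ResolventGraph H) : ℕ := Nat.card H / 2

/-- Isomorphism of marked ribbon graphs. -/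
def Iso (G : ResolventGraph H) (G' : ResolventGraph H') : Prop :=
  ∃ e : H ≃ H', (∀ h, e (G.next h) = G'.next (e h)) ∧ (∀ h, e (G.pair h) = G'.pair (e h)) ∧
    (∀ h, G'.side (e h) = G.side h) ∧ ∀ h, G'.mark (e h) = G.mark h

theorem Iso.refl (G : ResolventGraph H) : G.Iso G :=
  ⟨Equiv.refl H, fun _ => rfl, fun _ => rfl, fun _ => rfl, fun _ => rfl⟩

theorem Iso.symm {G : ResolventGraph H} {G' : ResolventGraph H'} (h : G.Iso G') : G'.Iso G := by
  obtain ⟨e, h1, h2, h3, h4⟩ := h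
  refine ⟨e.symm, fun k => ?_, fun k => ?_, fun k => ?_, fun k => ?_⟩
  · rw [Equiv.symm_apply_eq, h1, Equiv.apply_symm_apply]
  · rw [Equiv.symm_apply_eq, h2, Equiv.apply_symm_apply]
  · rw [← h3, Equiv.apply_symm_apply]
  · rw [← h4, Equiv.apply_symm_apply]

theorem Iso.trans {H'' : Type} {G : ResolventGraph H} {G' : ResolventGraph H'}
    {G'' : ResolventGraph H''} (h : G.Iso G') (h' : G'.Iso G'') : G.Iso G'' := by
  obtain ⟨e, h1, h2, h3, h4⟩ := h
  obtain ⟨f, k1, k2, k3, k4⟩ := h'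
  exact ⟨e.trans f, fun k => by simp [h1, k1], fun k => by simp [h2, k2],
    fun k => by simp [h3, k3], fun k => by simp [h4, k4]⟩

/-- Two half-edges are equivalent if they lie in the same connected component: components are
connected through loop vertices and `σ` propagators. -/
def componentSetoid (G : ResolventGraph H) : Setoid H :=
  Relation.EqvGen.setoid fun h h' => G.next h = h' ∨ G.pair h = h'

/-- The connected components of `G`. -/
def Component (G : ResolventGraph H) : Type := Quotient G.componentSetoid

/-- The component of a half-edge. -/
def toComponent (G : ResolventGraph H) (h : H) : G.Component := Quotient.mk G.componentSetoid h

theorem toComponent_next (G : ResolventGraph H) (h : H) :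
    G.toComponent (G.next h) = G.toComponent h :=
  (Quotient.sound (s := G.componentSetoid)
    (Relation.EqvGen.rel h (G.next h) (Or.inl rfl) : Relation.EqvGen _ h (G.next h))).symm

theorem toComponent_pair (G : ResolventGraph H) (h : H) :
    G.toComponent (G.pair h) = G.toComponent h :=
  (Quotient.sound (s := G.componentSetoid)
    (Relation.EqvGen.rel h (G.pair h) (Or.inr rfl) : Relation.EqvGen _ h (G.pair h))).symm

instance [Finite H] (G : ResolventGraph H) : Finite G.Component :=
  inferInstanceAs (Finite (Quotient G.componentSetoid))

instance [Finite H] (G : ResolventGraph H) : Fintype G.Component := Fintype.ofFinite _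

/-- A connected component of `G`, as a graph. -/
def restrict (G : ResolventGraph H) (K : G.Component) :
    ResolventGraph {h : H // G.toComponent h = K} where
  next := G.next.subtypePerm fun h => by rw [toComponent_next]
  pair := G.pair.subtypePerm fun h => by rw [toComponent_pair]
  pair_pair h := Subtype.ext (G.pair_pair h.1)
  pair_ne h hh := G.pair_ne h.1 (congrArg Subtype.val hh)
  side h := G.side h.1
  mark h := G.mark h.1

/-- The c-propagator ending at `h` is a tadpole: one of its two borders forms a closed face by
itself. This is so if it is the only one of its loop vertex, or if its two ends are hooked by
one `σ` propagator on the same border. -/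
def IsTadpole (G : ResolventGraph H) (h : H) : Prop :=
  G.next h = h ∨ (G.next (G.pair h) = h ∧ G.side (G.pair h) = G.side h)

/-- `G` bears each of the marks in `Ω` exactly once, and no other marks. -/
def MarkedBy (G : ResolventGraph H) (Ω : Finset ℕ) : Prop :=
  (∀ h ω, G.mark h = some ω → ω ∈ Ω) ∧ ∀ ω ∈ Ω, ∃! h, G.mark h = some ω

/-- Minimal `Ω`-resolvent graphs: each connected component bears at least one mark, and the
order is at most `|Ω|`. -/
def IsMinimal (G : ResolventGraph H) (Ω : Finset ℕ) : Prop :=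
  G.MarkedBy Ω ∧ (∀ K : G.Component, ∃ h, G.toComponent h = K ∧ (G.mark h).isSome) ∧
    G.order ≤ Ω.card

/-- The c-propagator ending at `h`: `C^ω` if it bears the mark `ω`, and `C(t)` without mark. -/
def cprop (Λ : ℕ) (I : Finset ℕ) (t : ℕ → ℝ) (G : ResolventGraph H) (h : H) : Op Λ :=
  match G.mark h with
  | none => prop Λ I t
  | some ω => sliceProp Λ ω

open Classical in
/-- The resolvent propagator ending at `h`: `(R - 1) C̃` for a tadpole, and `R C̃` otherwise. -/
def resolventProp {Λ : ℕ} (lam : ℂ) (I : Finset ℕ) (t : ℕ → ℝ) (x : Coord Λ)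
    (G : ResolventGraph H) (h : H) : Op Λ :=
  (if G.IsTadpole h then resolvent lam I t x - 1 else resolvent lam I t x) * G.cprop Λ I t h

/-- Let the resolvent propagator ending at `h` carry the double row index `i h` and the double
column index `j h`. The field hooked to `h` on the inner border is the entry
`(I ⊗ σ)_{j h, i (next h)}`, and the one on the outer border is `(σᵗ ⊗ I)_{j h, i (next h)}`;
this is the pair of indices of its factor `σ`. -/
def fieldIndex {Λ : ℕ} (G : ResolventGraph H) (i j : H → Ix Λ) (h : H) : Ix Λ :=
  match G.side h with
  | Border.inner => ((j h).2, (i (G.next h)).2)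
  | Border.outer => ((i (G.next h)).1, (j h).1)

/-- The index of the border that passes `h` without being hooked is conserved at `h`. -/
def SpectatorMatch {Λ : ℕ} (G : ResolventGraph H) (i j : H → Ix Λ) (h : H) : Prop :=
  match G.side h with
  | Border.inner => (j h).1 = (i (G.next h)).1
  | Border.outer => (j h).2 = (i (G.next h)).2

/-- The indices are compatible with the graph: spectator borders are conserved, and the fields
at the ends of each `σ` propagator are contracted by `⟨σ_ab σ_cd⟩ = δ_ad δ_bc`. -/
def Compatible {Λ : ℕ} (G : ResolventGraph H) (i j : H → Ix Λ) : Prop :=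
  (∀ h, G.SpectatorMatch i j h) ∧
    ∀ h, (G.fieldIndex i j h).1 = (G.fieldIndex i j (G.pair h)).2

open Classical in
/-- The renormalized amplitude: `(-λ)` to the number of `σ` propagators, times the sum over all
double indices of the product of the resolvent propagators, contracted along the graph. As
indices in different components are independent, the sum is the product of the traces
over the connected components. -/
def amplitude [Fintype H] {Λ : ℕ} (lam : ℂ) (I : Finset ℕ) (t : ℕ → ℝ) (x : Coord Λ)
    (G : ResolventGraph H) : ℂ :=
  (-lam) ^ G.order *
    ∑ i : H → Ix Λ, ∑ j : H → Ix Λ,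
      if G.Compatible i j then ∏ h, G.resolventProp lam I t x h (i h) (j h) else 0

end ResolventGraph

/-- Minimal `Ω`-resolvent graphs of order `n`, with labelled half-edges. -/
def LabelledMinimal (Ω : Finset ℕ) (n : ℕ) : Type :=
  {G : ResolventGraph (Fin (2 * n)) // G.IsMinimal Ω}

instance (Ω : Finset ℕ) (n : ℕ) : Finite (LabelledMinimal Ω n) := by
  classical
  let f : LabelledMinimal Ω n → Equiv.Perm (Fin (2 * n)) × Equiv.Perm (Fin (2 * n)) ×
      (Fin (2 * n) → Border) × (Fin (2 * n) → Option Ω) := fun G =>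
    (G.1.next, G.1.pair, G.1.side, fun h => (G.1.mark h).pmap (fun ω hω => ⟨ω, hω⟩)
      (fun ω hω => G.2.1.1 h ω hω))
  refine Finite.of_injective f ?_
  rintro ⟨⟨n1, p1, a1, b1, s1, m1⟩, h1⟩ ⟨⟨n2, p2, a2, b2, s2, m2⟩, h2⟩ h
  simp only [f, Prod.mk.injEq] at h
  obtain ⟨rfl, rfl, rfl, hm⟩ := h
  have : m1 = m2 := by
    funext k
    have hk := congrArg (Option.map Subtype.val) (congrFun hm k)
    simpa [Option.map_pmap] using hk
  subst this
  rfl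

/-- Isomorphism of labelled minimal graphs. -/
def labelledSetoid (Ω : Finset ℕ) (n : ℕ) : Setoid (LabelledMinimal Ω n) where
  r G G' := G.1.Iso G'.1
  iseqv := ⟨fun G => ResolventGraph.Iso.refl G.1, fun h => h.symm, fun h h' => h.trans h'⟩

/-- The set `𝒢(Ω)` of minimal `Ω`-resolvent graphs, up to isomorphism. -/
def MinimalGraphs (Ω : Finset ℕ) : Type :=
  Σ n : Fin (Ω.card + 1), Quotient (labelledSetoid Ω n)

instance (Ω : Finset ℕ) : Finite (MinimalGraphs Ω) :=
  inferInstanceAs (Finite (Σ n : Fin (Ω.card + 1), Quotient (labelledSetoid Ω n)))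

instance (Ω : Finset ℕ) : Fintype (MinimalGraphs Ω) := Fintype.ofFinite _

/-- A graph representing an isomorphism class (the choice is immaterial, since amplitudes are
invariant under isomorphism). -/
def MinimalGraphs.graph {Ω : Finset ℕ} (G : MinimalGraphs Ω) :
    ResolventGraph (Fin (2 * (G.1 : ℕ))) :=
  (Quotient.out G.2).1

/-! ### The expansion -/

/-- The integrand `exp V(t, σ) · A^R_G(t, σ)`. -/
def integrand {Λ : ℕ} (lam : ℂ) (I : Finset ℕ) {Ω : Finset ℕ} (G : MinimalGraphs Ω)
    (t : ℕ → ℝ) (x : Coord Λ) : ℂ :=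
  Complex.exp (interaction lam I t x) * G.graph.amplitude lam I t x

/-- Lebesgue measure on the cube `[0, 1]^Ω`. -/
def cube (Ω : Finset ℕ) : MeasureTheory.Measure (Ω → ℝ) :=
  MeasureTheory.Measure.pi fun _ => MeasureTheory.volume.restrict (Set.Icc 0 1)

/-- The interpolation parameters outside `Ω` are put to zero. -/
def extendZero {Ω : Finset ℕ} (t : Ω → ℝ) (ω : ℕ) : ℝ :=
  if h : ω ∈ Ω then t ⟨ω, h⟩ else 0

/-- The sum over `G ∈ 𝒢(Ω)` of `c(G) ∫ dν(σ) exp V(t, σ) A^R_G(t, σ)`, at fixed `t`. -/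
def graphSum (c : (H : Type) → ResolventGraph H → ℝ) (Λ : ℕ) (lam : ℂ) (I Ω : Finset ℕ)
    (t : ℕ → ℝ) : ℂ :=
  ∑ G : MinimalGraphs Ω, (c _ G.graph : ℂ) * ∫ x, integrand lam I G t x ∂(nu Λ)

end GW2

end

/-!
The theorem holds with `c(G) = 2 ^ (-v) * 2 ^ (-n)` if `G` is *covered*, and `c(G) = 0` otherwise
(`ResolventGraph.weight`). Here `v` is the number of loop vertices, `n` the number of propagators,
and `G` is covered if every `σ` propagator has an end at which a marked c-propagator ends.
Isomorphism invariance and factorization over connected components are immediate.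

**One derivation.** Let `a = i √(2λ) / 2`, so that `a² = -λ / 2`. The derivative of `exp V` times
an amplitude with respect to `t^ω` either hits a bare propagator `C(t)`, which gets the mark `ω`,
or it hits a resolvent or `exp V`. In the latter case it inserts a field `σ` together with the
marked propagator `C^ω`, either into an existing c-propagator or on a new loop vertex
(`hasDerivAt_exp_mul_loopTrace`), apart from counter-terms. Gaussian integration by parts
(`integral_sigma_mul_expTrace`) contracts this field with a second half-edge, inserted in the same
way with the propagator `C(t)`. The two ends of the new propagator carry the factor
`a² = (-λ) / 2`, and each new loop vertex carries a factor `1 / 2`; this is how `c` changes under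
the insertion. If the two new half-edges are consecutive on a loop vertex and are hooked on the
same border, their contraction is a bare tadpole, which has to be replaced by a subtracted one,
`R - 1` in place of `R`. The difference is compensated exactly by the terms with `T(t)` and `T^ω`
in the derivative of `V`: this is the identity `tadpole_cancellation` for families of matrices.
Altogether, the derivative of the integrated amplitude of `G` is the sum over the markings and over
the insertions of a marked propagator (`hasDerivAt_graphIntegral`).

**Counting graphs.** Marking and insertion preserve the covered graphs. Conversely, let `ω` be a
mark of a covered graph: if the partner of the half-edge with the mark `ω` is marked too, then
erasing `ω` leaves a covered graph, and otherwise removing the propagator does. Covered graphs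
whose marks are distinct have no automorphisms, because an automorphism fixes the marked half-edges
and their partners, so that each isomorphism class of order `n` consists of `(2n)!` labelled
graphs. They are moreover minimal. Hence the sum over the minimal graphs with weights `c` is a sum
over labelled covered graphs (`graphSum_eq_sum_labelledSum`), on which the two operations act
bijectively (`sum_labelledSum_insert`), and `∂ Z_Ω / ∂ t^ω = Z_{Ω ∪ {ω}}` follows
(`hasDerivAt_graphSum`). Without marks only the empty graph is left, and `Z_∅ = Z`. The fundamental
theorem of calculus, applied to one parameter after the other, gives the expansion over the sets
`Ω` of marks (`graphSum_expansion`), and these are grouped according to the slices which they meet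
(`sum_refinedSets`).

**Analysis.** For `|arg λ| < π` the number `√(2λ)` vanishes or has positive real part, so that
`|1 + a β|` is bounded below for real `β`. As `C(t) = D²` with `D` diagonal and nonnegative, and
`D σ̂ D` is Hermitian, the resolvents exist, their entries grow at most linearly with the field,
and so does `Tr log₂` (`exists_resolvent_bound`). All the functions which occur are then *tame*,
that is continuous in the parameters and the field, and exponentially bounded in the field
uniformly in the parameters (`Tame`). This yields absolute convergence, differentiation under the
integral sign, integration by parts and the use of Fubini's theorem.
-/

noncomputable section

namespace GW2

/-! ### The weight of a marked graph -/

/-- `2` to the power minus the number of cycles of `τ`. The number `2 ^ (number of cycles)` is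
encoded as the number of two-colourings that are constant along the cycles, which makes it easy to
follow through insertions and to factorize over connected components. For an infinite type the value
is irrelevant. -/
def cycleWeight {H : Type} (τ : Equiv.Perm H) : ℝ :=
  ((Nat.card {f : H → Bool // ∀ h, f (τ h) = f h} : ℕ) : ℝ)⁻¹

theorem cycleWeight_nonneg {H : Type} (τ : Equiv.Perm H) : 0 ≤ cycleWeight τ :=
  inv_nonneg.2 (Nat.cast_nonneg _)

theorem cycleWeight_le_one {H : Type} (τ : Equiv.Perm H) : cycleWeight τ ≤ 1 :=
  Nat.cast_inv_le_one _

theorem cycleWeight_congr {H H' : Type} (e : H ≃ H') {τ : Equiv.Perm H} {τ' : Equiv.Perm H'}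
    (he : ∀ h, e (τ h) = τ' (e h)) : cycleWeight τ = cycleWeight τ' := by
  unfold cycleWeight
  congr 2
  refine Nat.card_congr ((Equiv.arrowCongr e (Equiv.refl Bool)).subtypeEquiv fun f => ?_)
  constructor
  · intro hf h
    obtain ⟨k, rfl⟩ := e.surjective h
    simp [← he, hf]
  · intro hf h
    simpa [← he] using hf (e h)

/-- Inserting a new point into a permutation creates a new cycle if and only if the new point is
fixed. -/
theorem cycleWeight_decomposeOption {H : Type} [DecidableEq H] (o : Option H)
    (τ : Equiv.Perm H) :
    cycleWeight (Equiv.Perm.decomposeOption.symm (o, τ))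
      = (if o = none then 1 / 2 else 1) * cycleWeight τ := by
  unfold cycleWeight
  cases o with
  | none =>
    have e : {f : Option H → Bool //
        ∀ h, f (Equiv.Perm.decomposeOption.symm (none, τ) h) = f h} ≃
        Bool × {f : H → Bool // ∀ h, f (τ h) = f h} :=
      { toFun := fun f => (f.1 none, ⟨fun h => f.1 (some h), fun h => by simpa using f.2 (some h)⟩)
        invFun := fun p => ⟨fun o => o.elim p.1 p.2.1, fun h => by cases h <;> simp [p.2.2]⟩
        left_inv := fun f => by
          ext h; cases h <;> rfl
        right_inv := fun p => rfl }
    rw [Nat.card_congr e]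
    simp [Nat.card_prod]
    ring
  | some k =>
    have e : {f : Option H → Bool //
        ∀ h, f (Equiv.Perm.decomposeOption.symm (some k, τ) h) = f h} ≃
        {f : H → Bool // ∀ h, f (τ h) = f h} :=
      { toFun := fun f => ⟨fun h => f.1 (some h), fun h => by
          have h1 := f.2 (some h)
          have h2 := f.2 none
          by_cases hk : τ h = k <;> simp_all [Equiv.swap_apply_def]⟩
        invFun := fun p => ⟨fun o => o.elim (p.1 k) p.1, fun h => by
          cases h with
          | none => simp
          | some h =>
            have := p.2 h
            by_cases hk : τ h = k <;> simp_all [Equiv.swap_apply_def]⟩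
        left_inv := fun f => by
          ext h
          cases h with
          | none => have h2 := f.2 none; simpa using h2
          | some h => rfl
        right_inv := fun p => rfl }
    rw [Nat.card_congr e]
    simp

namespace ResolventGraph

variable {H H' : Type}

/-- Every `σ` propagator has an end at which a marked c-propagator ends. -/
def Covered (G : ResolventGraph H) : Prop :=
  ∀ h, (G.mark h).isSome ∨ (G.mark (G.pair h)).isSome

open Classical in
/-- The numbers `c(G)`: they vanish unless `G` is covered, and a covered graph with `v` loop
vertices and `n` propagators has `c(G) = 2 ^ (-v) * 2 ^ (-n)`. The factors `1 / 2` come from the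
coefficient of `-½ Tr log₂` for the loop vertices, and from `(i √(2λ) / 2)² = (-λ) / 2` for the
propagators. -/
def weight (H : Type) (G : ResolventGraph H) : ℝ :=
  if G.Covered then cycleWeight G.next * cycleWeight G.pair else 0

theorem weight_nonneg (G : ResolventGraph H) : 0 ≤ weight H G := by
  unfold weight
  split_ifs
  · exact mul_nonneg (cycleWeight_nonneg _) (cycleWeight_nonneg _)
  · exact le_rfl

theorem weight_le_one (G : ResolventGraph H) : weight H G ≤ 1 := by
  unfold weight
  split_ifs
  · exact mul_le_one₀ (cycleWeight_le_one _) (cycleWeight_nonneg _) (cycleWeight_le_one _)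
  · exact zero_le_one

theorem Iso.covered_iff {G : ResolventGraph H} {G' : ResolventGraph H'} (h : G.Iso G') :
    G.Covered ↔ G'.Covered := by
  obtain ⟨e, h1, h2, h3, h4⟩ := h
  unfold Covered
  rw [← e.forall_congr_right (q := fun h => (G'.mark h).isSome ∨ (G'.mark (G'.pair h)).isSome)]
  simp [← h2, h4]

theorem Iso.weight_eq {G : ResolventGraph H} {G' : ResolventGraph H'} (h : G.Iso G') :
    weight H G = weight H' G' := by
  have hc := h.covered_iff
  obtain ⟨e, h1, h2, h3, h4⟩ := h
  unfold weight
  simp only [cycleWeight_congr e h1, cycleWeight_congr e h2]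
  congr 1
  exact propext hc

/-- A colouring which is constant along the cycles of a permutation preserving the components is
a family of such colourings of the components. -/
theorem cycleWeight_eq_prod [Finite H] (G : ResolventGraph H) (τ : Equiv.Perm H)
    (hτ : ∀ h, G.toComponent (τ h) = G.toComponent h)
    (τ' : ∀ K : G.Component, Equiv.Perm {h : H // G.toComponent h = K})
    (hτ' : ∀ K h, ((τ' K h : {h : H // G.toComponent h = K}) : H) = τ h) :
    cycleWeight τ = ∏ K : G.Component, cycleWeight (τ' K) := by
  have e : {f : H → Bool // ∀ h, f (τ h) = f h} ≃
      ∀ K : G.Component, {f : {h : H // G.toComponent h = K} → Bool // ∀ h, f (τ' K h) = f h} :=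
    { toFun := fun f K => ⟨fun h => f.1 h.1, fun h => by
        simp only [hτ', f.2]⟩
      invFun := fun f => ⟨fun h => (f (G.toComponent h)).1 ⟨h, rfl⟩, fun h => by
        have key : ∀ K (hK : G.toComponent h = K),
            (f K).1 ⟨τ h, (hτ h).trans hK⟩ = (f (G.toComponent h)).1 ⟨h, rfl⟩ := by
          rintro _ rfl
          rw [← (f _).2 ⟨h, rfl⟩]
          exact congrArg (f _).1 (Subtype.ext (hτ' _ ⟨h, rfl⟩).symm)
        have key2 : ∀ K (hK : G.toComponent (τ h) = K),
            (f (G.toComponent (τ h))).1 ⟨τ h, rfl⟩ = (f K).1 ⟨τ h, hK⟩ := by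
          rintro _ rfl; rfl
        exact (key2 _ (hτ h)).trans (key _ rfl)⟩
      left_inv := fun f => rfl
      right_inv := fun f => by
        funext K
        ext ⟨h, rfl⟩
        rfl }
  unfold cycleWeight
  rw [Nat.card_congr e, Nat.card_pi]
  push_cast
  rw [Finset.prod_inv_distrib]

theorem covered_restrict_iff (G : ResolventGraph H) :
    G.Covered ↔ ∀ K, (G.restrict K).Covered :=
  ⟨fun h _ k => h k.1, fun h k => h _ ⟨k, rfl⟩⟩

theorem weight_eq_prod [Finite H] (G : ResolventGraph H) :
    weight H G = ∏ K : G.Component, weight _ (G.restrict K) := by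
  unfold weight
  by_cases hc : G.Covered
  · have hc' := G.covered_restrict_iff.1 hc
    simp only [hc, hc', if_true, Finset.prod_mul_distrib]
    rw [cycleWeight_eq_prod G G.next G.toComponent_next (fun K => (G.restrict K).next)
        (fun K h => rfl),
      cycleWeight_eq_prod G G.pair G.toComponent_pair (fun K => (G.restrict K).pair)
        (fun K h => rfl)]
  · have hc' := mt G.covered_restrict_iff.2 hc
    push Not at hc'
    obtain ⟨K, hK⟩ := hc'
    rw [if_neg hc, Finset.prod_eq_zero (Finset.mem_univ K) (if_neg hK)]

end ResolventGraph

/-! ### Traces along the loop vertices -/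

/-- The product over the cycles `(h₁ h₂ … h_k)` of `τ` of `Tr (M h₁ * M h₂ * ⋯ * M h_k)`. -/
def loopTrace {K : Type} [Fintype K] [DecidableEq K] {n : Type} [Fintype n] (τ : Equiv.Perm K)
    (M : K → Matrix n n ℂ) : ℂ :=
  ∑ i : K → n, ∏ h, M h (i h) (i (τ h))

section LoopTrace

variable {K : Type} [Fintype K] [DecidableEq K] {n : Type} [Fintype n]

theorem loopTrace_congr {K' : Type} [Fintype K'] [DecidableEq K'] (e : K ≃ K') {τ : Equiv.Perm K}
    {τ' : Equiv.Perm K'} (he : ∀ h, e (τ h) = τ' (e h)) (M : K' → Matrix n n ℂ) :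
    loopTrace τ (fun h => M (e h)) = loopTrace τ' M := by
  unfold loopTrace
  refine Fintype.sum_equiv (e.arrowCongr (Equiv.refl n)) _ _ fun i => ?_
  refine Fintype.prod_equiv e _ _ fun h => ?_
  simp [← he]

/-- `loopTrace` as a linear form in the matrix at the half-edge `h`. -/
def loopForm (τ : Equiv.Perm K) (M : K → Matrix n n ℂ) (h : K) : Matrix n n ℂ →ₗ[ℂ] ℂ where
  toFun X := ∑ i : K → n, X (i h) (i (τ h)) * ∏ k ∈ Finset.univ.erase h, M k (i k) (i (τ k))
  map_add' X Y := by simp [add_mul, Finset.sum_add_distrib]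
  map_smul' c X := by simp [mul_assoc, Finset.mul_sum]

theorem loopTrace_update (τ : Equiv.Perm K) (M : K → Matrix n n ℂ) (h : K) (X : Matrix n n ℂ) :
    loopTrace τ (Function.update M h X) = loopForm τ M h X := by
  simp only [loopTrace, loopForm, LinearMap.coe_mk, AddHom.coe_mk]
  refine Finset.sum_congr rfl fun i _ => ?_
  rw [← Finset.mul_prod_erase _ _ (Finset.mem_univ h), Function.update_self]
  congr 1
  refine Finset.prod_congr rfl fun k hk => ?_
  rw [Function.update_of_ne (Finset.ne_of_mem_erase hk)]

theorem loopForm_congr (τ : Equiv.Perm K) {M M' : K → Matrix n n ℂ} {h : K}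
    (hM : ∀ k, k ≠ h → M k = M' k) : loopForm τ M h = loopForm τ M' h := by
  ext1 X
  rw [← loopTrace_update, ← loopTrace_update]
  congr 1
  funext k
  by_cases hk : k = h
  · subst hk; simp
  · simp [hk, hM]

/-- Removing a half-edge which is alone on its loop vertex. -/
theorem loopTrace_insert_none (τ : Equiv.Perm K) (M : Option K → Matrix n n ℂ) :
    loopTrace (Equiv.Perm.decomposeOption.symm (none, τ)) M
      = Matrix.trace (M none) * loopTrace τ (fun h => M (some h)) := by
  unfold loopTrace Matrix.trace
  rw [Finset.sum_mul_sum, ← Fintype.sum_prod_type']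
  refine Fintype.sum_equiv (Equiv.piOptionEquivProd (β := fun _ => n)) _ _ fun i => ?_
  simp [Fintype.prod_option, Equiv.piOptionEquivProd]

/-- Removing a half-edge which precedes another one on its loop vertex. -/
theorem loopTrace_insert_some (τ : Equiv.Perm K) (k : K) (M : Option K → Matrix n n ℂ) :
    loopTrace (Equiv.Perm.decomposeOption.symm (some k, τ)) M
      = loopForm τ (fun h => M (some h)) k (M none * M (some k)) := by
  rw [← loopTrace_update]
  unfold loopTrace
  have e1 : ∀ i : K → n,
      ∏ h, Function.update (fun h => M (some h)) k (M none * M (some k)) h (i h) (i (τ h))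
        = ∑ q, M none (i k) q * M (some k) q (i (τ k)) *
            ∏ h ∈ Finset.univ.erase k, M (some h) (i h) (i (τ h)) := by
    intro i
    rw [← Finset.mul_prod_erase _ _ (Finset.mem_univ k), Function.update_self, Matrix.mul_apply,
      Finset.sum_mul]
    refine Finset.sum_congr rfl fun q _ => ?_
    congr 1
    refine Finset.prod_congr rfl fun h hk => ?_
    rw [Function.update_of_ne (Finset.ne_of_mem_erase hk)]
  simp only [e1]
  rw [Finset.sum_comm, ← Fintype.sum_prod_type']
  -- The index at `none` and the index at `some k` are exchanged.
  let E : (Option K → n) ≃ n × (K → n) :=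
    ((Equiv.swap none (some k)).arrowCongr (Equiv.refl n)).trans
      (Equiv.piOptionEquivProd (β := fun _ => n))
  refine Fintype.sum_equiv E _ _ fun i => ?_
  obtain ⟨⟨q, j⟩, rfl⟩ := E.symm.surjective i
  rw [Equiv.apply_symm_apply]
  have hE : ∀ o, E.symm (q, j) o = (Equiv.swap none (some k) o).elim q j := by
    intro o
    simp only [E, Equiv.symm_trans_apply, Equiv.arrowCongr_symm, Equiv.arrowCongr_apply]
    simp [Equiv.piOptionEquivProd]
    cases Equiv.swap none (some k) o <;> rfl
  rw [Fintype.prod_option, ← Finset.mul_prod_erase _ _ (Finset.mem_univ k), ← mul_assoc]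
  simp only [hE, Equiv.Perm.decomposeOption_symm_apply, Equiv.Perm.mul_apply,
    Equiv.swap_apply_self, Equiv.optionCongr_apply, Option.map_none, Option.map_some,
    Equiv.swap_apply_left, Equiv.swap_apply_right, Option.elim]
  congr 1
  refine Finset.prod_congr rfl fun h hk => ?_
  rw [Equiv.swap_apply_of_ne_of_ne (by simp)
    (by simpa using Finset.ne_of_mem_erase hk)]

end LoopTrace

/-! ### Insertion of a half-edge, and cancellation of the tadpoles -/

section Insertion

variable {K : Type} [Fintype K] [DecidableEq K] {n : Type} [Fintype n] [DecidableEq n]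

/-- The resolvent propagators `(R - ε) Q`, where `ε h = 1` if the c-propagator ending at `h` is a
tadpole, and `ε h = 0` otherwise. -/
def dressed (R : Matrix n n ℂ) (ε : K → ℂ) (Q : K → Matrix n n ℂ) (h : K) : Matrix n n ℂ :=
  (R - ε h • 1) * Q h

/-- The tadpole indicator after a new half-edge `none`, not yet joined to another one, has been
inserted before `o`, or on a new loop vertex if `o = none`: the
c-propagator ending at `none` is a tadpole if it is alone on its loop vertex, and the c-propagator
which has been cut is not a tadpole any more. -/
def extendTadpole (o : Option K) (ε : K → ℂ) : Option K → ℂ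
  | none => if o = none then 1 else 0
  | some h => if o = some h then 0 else ε h

/-- The family `Q` with the matrix `Y` at a new half-edge. -/
def extendMatrix (Y : Matrix n n ℂ) (Q : K → Matrix n n ℂ) : Option K → Matrix n n ℂ
  | none => Y
  | some h => Q h

/-- The factor created by the insertion of a half-edge: `-a / 2` for a new loop vertex, and `-a` for
an insertion into an existing c-propagator. -/
def insertFactor (a : ℂ) (o : Option K) : ℂ := if o = none then -a / 2 else -a

/-- The sum over all the ways to insert a half-edge, with the matrix `Y`. This is the value of a
derivation acting on the resolvents and on `-½ Tr log₂`. -/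
def insertSum (a : ℂ) (R : Matrix n n ℂ) (τ : Equiv.Perm K) (ε : K → ℂ) (Q : K → Matrix n n ℂ)
    (Y : Matrix n n ℂ) : ℂ :=
  ∑ o : Option K, insertFactor a o *
    loopTrace (Equiv.Perm.decomposeOption.symm (o, τ))
      (dressed R (extendTadpole o ε) (extendMatrix Y Q))

theorem loopTrace_dressed_none (R : Matrix n n ℂ) (τ : Equiv.Perm K) (ε : K → ℂ)
    (Q : K → Matrix n n ℂ) (Y : Matrix n n ℂ) :
    loopTrace (Equiv.Perm.decomposeOption.symm (none, τ))
      (dressed R (extendTadpole none ε) (extendMatrix Y Q))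
      = Matrix.trace ((R - 1) * Y) * loopTrace τ (dressed R ε Q) := by
  rw [loopTrace_insert_none]
  simp only [dressed, extendTadpole, extendMatrix, if_true, one_smul, reduceCtorEq, if_false]
  rfl

theorem loopTrace_dressed_some (R : Matrix n n ℂ) (τ : Equiv.Perm K) (ε : K → ℂ)
    (Q : K → Matrix n n ℂ) (Y : Matrix n n ℂ) (k : K) :
    loopTrace (Equiv.Perm.decomposeOption.symm (some k, τ))
      (dressed R (extendTadpole (some k) ε) (extendMatrix Y Q))
      = loopForm τ (dressed R ε Q) k (R * Y * (R * Q k)) := by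
  rw [loopTrace_insert_some, loopForm_congr (M' := dressed R ε Q)]
  · simp [dressed, extendTadpole, extendMatrix]
  · intro h hh
    simp [dressed, extendTadpole, extendMatrix, hh.symm]

theorem insertSum_eq (a : ℂ) (R : Matrix n n ℂ) (τ : Equiv.Perm K) (ε : K → ℂ)
    (Q : K → Matrix n n ℂ) (Y : Matrix n n ℂ) :
    insertSum a R τ ε Q Y
      = -a / 2 * (Matrix.trace ((R - 1) * Y) * loopTrace τ (dressed R ε Q))
        + ∑ k, -a * loopForm τ (dressed R ε Q) k (R * Y * (R * Q k)) := by
  simp only [insertSum, Fintype.sum_option, loopTrace_dressed_none, loopTrace_dressed_some,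
    insertFactor, if_true, reduceCtorEq, if_false]

theorem insertSum_sum {ι : Type} (s : Finset ι) (a : ℂ) (R : Matrix n n ℂ) (τ : Equiv.Perm K)
    (ε : K → ℂ) (Q : K → Matrix n n ℂ) (Y : ι → Matrix n n ℂ) :
    insertSum a R τ ε Q (∑ i ∈ s, Y i) = ∑ i ∈ s, insertSum a R τ ε Q (Y i) := by
  simp only [insertSum_eq, Finset.sum_add_distrib, Finset.mul_sum, Finset.sum_mul,
    Matrix.trace_sum, map_sum]
  congr 1
  rw [Finset.sum_comm]

theorem insertSum_smul (c a : ℂ) (R : Matrix n n ℂ) (τ : Equiv.Perm K)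
    (ε : K → ℂ) (Q : K → Matrix n n ℂ) (Y : Matrix n n ℂ) :
    insertSum a R τ ε Q (c • Y) = c * insertSum a R τ ε Q Y := by
  simp only [insertSum_eq, Matrix.mul_smul, Matrix.smul_mul, Matrix.trace_smul, map_smul,
    smul_eq_mul, mul_add, Finset.mul_sum]
  congr 1
  · ring
  · exact Finset.sum_congr rfl fun k _ => by ring

/-- The tadpole indicator of the ribbon graph obtained by inserting the half-edge `some none` before
`o₁` and then the half-edge `none` before `o₂`, the two being joined by a `σ` propagator; `b` says
whether they are hooked on the same border. A c-propagator is a tadpole if it is alone on its loop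
vertex, or if the half-edges at its ends are hooked on the same border and joined to each other. -/
def pairTadpole (o₁ : Option K) (o₂ : Option (Option K)) (b : Prop) [Decidable b] (ε : K → ℂ) :
    Option (Option K) → ℂ
  | none => if o₂ = none ∨ (o₂ = some o₁ ∧ b) then 1 else 0
  | some none => if (o₁ = none ∧ o₂ ≠ some none) ∨ (o₂ = some none ∧ b) then 1 else 0
  | some (some h) => if o₂ = some (some h) then 0 else if o₁ = some h then 0 else ε h

/-- The terms by which the amplitude obtained from two successive insertions differs from the
renormalized one: bare tadpoles created by the contraction of two consecutive half-edges. -/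
def tadpoleDefect (R : Matrix n n ℂ) (τ : Equiv.Perm K) (ε : K → ℂ) (Q : K → Matrix n n ℂ)
    (C C' E E' : Matrix n n ℂ) : Option K → ℂ
  | none => (Matrix.trace (R * (C' * (E * C * E'))) + Matrix.trace (R * (C * (E' * C' * E)))
      - Matrix.trace (C * (E' * C' * E))) * loopTrace τ (dressed R ε Q)
  | some k => loopForm τ (dressed R ε Q) k (R * (C' * (E * C * E')) * (R * Q k))
      + loopForm τ (dressed R ε Q) k (R * (C * (E' * C' * E)) * (R * Q k))

/-- The value of a double insertion before the same half-edge, `none` first. -/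
theorem loopTrace_insert_insert_some (R : Matrix n n ℂ) (τ : Equiv.Perm K) (ε : K → ℂ)
    (Q : K → Matrix n n ℂ) (Y Y' : Matrix n n ℂ) (k : K) (o₂ : Option K)
    (η : Option (Option K) → ℂ) (hη : ∀ h, η (some (some h)) = if h = k then 0 else ε h)
    (ho : o₂ = none ∨ o₂ = some k) :
    loopTrace (Equiv.Perm.decomposeOption.symm (some o₂,
        Equiv.Perm.decomposeOption.symm (some k, τ)))
      (dressed R η (extendMatrix Y (extendMatrix Y' Q)))
    = loopForm τ (dressed R ε Q) k (if o₂ = none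
        then (R - η none • 1) * Y * ((R - η (some none) • 1) * Y') * (R * Q k)
        else (R - η (some none) • 1) * Y' * ((R - η none • 1) * Y * (R * Q k))) := by
  have h1 : ∀ X : Option K → Matrix n n ℂ, (∀ h, h ≠ k → X (some h) = dressed R ε Q h) →
      loopTrace (Equiv.Perm.decomposeOption.symm (some k, τ)) X
        = loopForm τ (dressed R ε Q) k (X none * X (some k)) := by
    intro X hX
    rw [loopTrace_insert_some, loopForm_congr _ hX]
  rw [loopTrace_insert_some, ← loopTrace_update, h1]
  · rcases ho with rfl | rfl
    · simp [dressed, extendMatrix, hη]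
    · simp [dressed, extendMatrix, hη]
  · intro h hh
    rcases ho with rfl | rfl <;> simp [dressed, extendMatrix, hη, hh]

/-- Two successive insertions produce the renormalized amplitudes, up to the defect. -/
theorem sum_insert_eq_pairTadpole (a : ℂ) (R : Matrix n n ℂ) (τ : Equiv.Perm K) (ε : K → ℂ)
    (Q : K → Matrix n n ℂ) (C C' E E' : Matrix n n ℂ) (o₁ : Option K) (b : Prop) [Decidable b] :
    insertSum a R (Equiv.Perm.decomposeOption.symm (o₁, τ)) (extendTadpole o₁ ε)
        (extendMatrix (C' * E) Q) (C * E')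
      = ∑ o₂, insertFactor a o₂ *
          loopTrace (Equiv.Perm.decomposeOption.symm (o₂, Equiv.Perm.decomposeOption.symm (o₁, τ)))
            (dressed R (pairTadpole o₁ o₂ b ε) (extendMatrix (C * E') (extendMatrix (C' * E) Q)))
        + if b then -a * tadpoleDefect R τ ε Q C C' E E' o₁ else 0 := by
  -- The two tadpole indicators agree unless the two new half-edges are consecutive.
  have hsame : ∀ o₂, (¬ b ∨ (o₂ ≠ some none ∧ o₂ ≠ some o₁)) →
      extendTadpole o₂ (extendTadpole o₁ ε) = pairTadpole o₁ o₂ b ε := by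
    intro o₂ ho
    funext h
    rcases h with _ | _ | h
    · by_cases hb : b <;> simp_all [extendTadpole, pairTadpole]
    · by_cases h2 : o₂ = some none <;> by_cases hb : b <;>
        simp_all [extendTadpole, pairTadpole]
    · simp [extendTadpole, pairTadpole]
  rw [← sub_eq_iff_eq_add']
  unfold insertSum
  rw [← Finset.sum_sub_distrib]
  by_cases hb : b
  swap
  · rw [if_neg hb]
    exact Finset.sum_eq_zero fun o₂ _ => by rw [hsame o₂ (Or.inl hb), sub_self]
  rw [if_pos hb]
  cases o₁ with
  | none =>
    rw [Fintype.sum_eq_single (some none)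
      fun o₂ ho => by rw [hsame o₂ (Or.inr ⟨ho, ho⟩), sub_self]]
    rw [loopTrace_insert_some, loopTrace_insert_some, ← loopTrace_update, ← loopTrace_update,
      loopTrace_insert_none, loopTrace_insert_none]
    simp only [insertFactor, reduceCtorEq, if_false, Function.update_self, ne_eq,
      not_false_iff, Function.update_of_ne, tadpoleDefect]
    have e1 : (fun h : K => dressed R (extendTadpole (some none) (extendTadpole none ε))
        (extendMatrix (C * E') (extendMatrix (C' * E) Q)) (some (some h))) = dressed R ε Q := by
      funext h
      simp [dressed, extendTadpole, extendMatrix]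
    have e2 : (fun h : K => dressed R (pairTadpole none (some none) b ε)
        (extendMatrix (C * E') (extendMatrix (C' * E) Q)) (some (some h))) = dressed R ε Q := by
      funext h
      simp [dressed, pairTadpole, extendMatrix]
    simp only [e1, e2]
    have c1 : Matrix.trace (R * (C' * (E * C * E')))
        = Matrix.trace (C * E' * (R * (C' * E))) := by
      rw [Matrix.trace_mul_comm (C * E')]
      congr 1
      noncomm_ring
    rw [c1, ← mul_sub, ← sub_mul]
    congr 2
    rw [← Matrix.trace_add, ← Matrix.trace_sub, ← Matrix.trace_sub]
    congr 1
    simp [dressed, extendTadpole, extendMatrix, pairTadpole, hb]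
    noncomm_ring
  | some k =>
    rw [Fintype.sum_eq_add (some none) (some (some k)) (by simp)
      fun o₂ ho => by rw [hsame o₂ (Or.inr ho), sub_self]]
    rw [loopTrace_insert_insert_some R τ ε Q _ _ k none _ _ (Or.inl rfl),
      loopTrace_insert_insert_some R τ ε Q _ _ k none _ _ (Or.inl rfl),
      loopTrace_insert_insert_some R τ ε Q _ _ k (some k) _ _ (Or.inr rfl),
      loopTrace_insert_insert_some R τ ε Q _ _ k (some k) _ _ (Or.inr rfl)]
    · simp only [insertFactor, reduceCtorEq, if_false, tadpoleDefect, ← mul_sub, ← mul_add,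
        ← map_sub, ← map_add, if_true]
      congr 2
      simp [extendTadpole, pairTadpole, hb]
      noncomm_ring
    all_goals
      intro h
      rcases eq_or_ne h k with rfl | hk
      · simp [extendTadpole, pairTadpole]
      · simp [extendTadpole, pairTadpole, hk, hk.symm]

/-- The defects add up to simple insertions of bare tadpoles, and a vacuum term. -/
theorem sum_insertFactor_mul_tadpoleDefect (a : ℂ) (R : Matrix n n ℂ) (τ : Equiv.Perm K)
    (ε : K → ℂ) (Q : K → Matrix n n ℂ) (C C' E E' : Matrix n n ℂ) :
    ∑ o₁, insertFactor a o₁ * tadpoleDefect R τ ε Q C C' E E' o₁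
      = insertSum a R τ ε Q (C' * (E * C * E')) + insertSum a R τ ε Q (C * (E' * C' * E))
        - a / 2 * (Matrix.trace (C' * (E * C * E')) * loopTrace τ (dressed R ε Q)) := by
  have hc : Matrix.trace (C' * (E * C * E')) = Matrix.trace (C * (E' * C' * E)) := by
    rw [show C' * (E * C * E') = (C' * E) * (C * E') by noncomm_ring, Matrix.trace_mul_comm]
    congr 1
    noncomm_ring
  simp only [insertSum_eq, Fintype.sum_option, tadpoleDefect, insertFactor, if_true, reduceCtorEq,
    if_false, mul_add, Finset.sum_add_distrib, sub_mul, one_mul, Matrix.trace_sub, hc]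
  ring

end Insertion

instance : DecidableEq Border := fun a b => by
  cases a <;> cases b <;> first | exact isTrue rfl | exact isFalse (by simp)

instance : Fintype Border where
  elems := {Border.outer, Border.inner}
  complete b := by cases b <;> simp

theorem sum_border {A : Type} [AddCommMonoid A] (f : Border → A) :
    ∑ s, f s = f Border.outer + f Border.inner := by
  have : (Finset.univ : Finset Border) = {Border.outer, Border.inner} := rfl
  rw [this, Finset.sum_pair (by simp)]

/-- The matrix hooked to a half-edge on the border `s`, for the matrix unit `e_p` in place of the
field `σ`. -/
def unitField {Λ : ℕ} (s : Border) (p : Ix Λ) : Op Λ :=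
  match s with
  | Border.inner => (1 : Matrix (Fin (Λ + 1)) (Fin (Λ + 1)) ℂ) ⊗ₖ Matrix.single p.1 p.2 (1 : ℂ)
  | Border.outer => (Matrix.single p.1 p.2 (1 : ℂ)).transpose ⊗ₖ
      (1 : Matrix (Fin (Λ + 1)) (Fin (Λ + 1)) ℂ)

/-- The operator `T ⊗ 1 + 1 ⊗ T` for a diagonal matrix `T`. -/
def tadpoleOp {Λ : ℕ} (T : Fin (Λ + 1) → ℂ) : Op Λ := ∑ s, ∑ m, T m • unitField s (m, m)

section Cancellation

variable {K : Type} [Fintype K] [DecidableEq K] {Λ : ℕ}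

theorem insertSum_sum_unitField (a : ℂ) (R : Op Λ) (τ : Equiv.Perm K) (ε : K → ℂ) (Q : K → Op Λ)
    (C C' : Op Λ) (s : Border) (p : Ix Λ) (o₁ : Option K) :
    insertFactor a o₁ * insertSum a R (Equiv.Perm.decomposeOption.symm (o₁, τ))
        (extendTadpole o₁ ε) (extendMatrix (C' * unitField s p) Q) (C * ∑ s', unitField s' p.swap)
      = ∑ s', ∑ o₂, insertFactor a o₁ * insertFactor a o₂ *
          loopTrace (Equiv.Perm.decomposeOption.symm (o₂, Equiv.Perm.decomposeOption.symm (o₁, τ)))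
            (dressed R (pairTadpole o₁ o₂ (s = s') ε)
              (extendMatrix (C * unitField s' p.swap) (extendMatrix (C' * unitField s p) Q)))
        - a * (insertFactor a o₁ *
            tadpoleDefect R τ ε Q C C' (unitField s p) (unitField s p.swap) o₁) := by
  have h1 : ∀ s' : Border,
      (if s = s' then -a * tadpoleDefect R τ ε Q C C' (unitField s p) (unitField s' p.swap) o₁
        else 0)
      = if s = s' then -a * tadpoleDefect R τ ε Q C C' (unitField s p) (unitField s p.swap) o₁
        else 0 := by
    intro s'
    split_ifs with h
    · rw [h]
    · rfl
  have h2 : ∑ s' : Border, (if s = s' then -a *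
        tadpoleDefect R τ ε Q C C' (unitField s p) (unitField s p.swap) o₁ else 0)
      = -a * tadpoleDefect R τ ε Q C C' (unitField s p) (unitField s p.swap) o₁ := by
    rw [Finset.sum_ite_eq, if_pos (Finset.mem_univ s)]
  rw [Finset.mul_sum, insertSum_sum, Finset.sum_congr rfl fun s' _ =>
    (sum_insert_eq_pairTadpole a R τ ε Q C C' _ _ o₁ (s = s')).trans (congrArg _ (h1 s')),
    Finset.sum_add_distrib, h2, mul_add, Finset.mul_sum]
  simp only [Finset.mul_sum]
  rw [sub_eq_add_neg]
  congr 1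
  · simp only [mul_assoc]
  · ring

/-- The exact cancellation of the tadpoles: after two successive insertions, contracted along a new
`σ` propagator, the counter-terms (with `T`, `T'`) turn all the bare tadpoles created by the
insertions into subtracted ones. -/
theorem tadpole_cancellation {a lam : ℂ} (ha : a ^ 2 = -lam / 2) (R C C' : Op Λ)
    (T T' : Fin (Λ + 1) → ℂ)
    (hT : ∑ s, ∑ p : Ix Λ, unitField s p * C * unitField s p.swap = tadpoleOp T)
    (hT' : ∑ s, ∑ p : Ix Λ, unitField s p.swap * C' * unitField s p = tadpoleOp T')
    (htr : ∀ p : Ix Λ, ∑ s, Matrix.trace (C' * unitField s p) = if p.1 = p.2 then 2 * T' p.1 else 0)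
    (τ : Equiv.Perm K) (ε : K → ℂ) (Q : K → Op Λ) :
    (∑ s, ∑ p : Ix Λ,
      ((∑ o₁ : Option K, insertFactor a o₁ *
        ((if p.1 = p.2 then a * T p.1 else 0) *
            loopTrace (Equiv.Perm.decomposeOption.symm (o₁, τ))
              (dressed R (extendTadpole o₁ ε) (extendMatrix (C' * unitField s p) Q))
          + insertSum a R (Equiv.Perm.decomposeOption.symm (o₁, τ)) (extendTadpole o₁ ε)
              (extendMatrix (C' * unitField s p) Q) (C * ∑ s', unitField s' p.swap)))
        + a / 2 * Matrix.trace (C' * unitField s p) *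
          ((if p.1 = p.2 then a * T p.1 else 0) * loopTrace τ (dressed R ε Q)
            + insertSum a R τ ε Q (C * ∑ s', unitField s' p.swap))))
      + lam * (∑ m, T m * T' m) * loopTrace τ (dressed R ε Q)
    = ∑ s, ∑ s', ∑ p : Ix Λ, ∑ o₁, ∑ o₂, insertFactor a o₁ * insertFactor a o₂ *
        loopTrace (Equiv.Perm.decomposeOption.symm (o₂, Equiv.Perm.decomposeOption.symm (o₁, τ)))
          (dressed R (pairTadpole o₁ o₂ (s = s') ε)
            (extendMatrix (C * unitField s' p.swap) (extendMatrix (C' * unitField s p) Q))) := by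
  set Φ := loopTrace τ (dressed R ε Q) with hΦ
  -- The contraction with the counter-term in the exponent.
  have X1 : ∑ s, ∑ p : Ix Λ, ∑ o₁ : Option K, insertFactor a o₁ *
        ((if p.1 = p.2 then a * T p.1 else 0) *
            loopTrace (Equiv.Perm.decomposeOption.symm (o₁, τ))
              (dressed R (extendTadpole o₁ ε) (extendMatrix (C' * unitField s p) Q)))
      = a * insertSum a R τ ε Q (C' * tadpoleOp T) := by
    simp only [tadpoleOp, Finset.mul_sum, insertSum_sum, Matrix.mul_smul, insertSum_smul]
    refine Finset.sum_congr rfl fun s _ => ?_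
    rw [Fintype.sum_prod_type]
    refine Finset.sum_congr rfl fun m _ => ?_
    rw [Finset.sum_eq_single m (fun m' _ hm => by simp [hm.symm]) (by simp), insertSum,
      Finset.mul_sum, Finset.mul_sum]
    refine Finset.sum_congr rfl fun o _ => ?_
    rw [if_pos rfl]
    ring
  -- The contraction with the resolvents.
  have X2 : ∑ s, ∑ p : Ix Λ, ∑ o₁ : Option K, insertFactor a o₁ *
        insertSum a R (Equiv.Perm.decomposeOption.symm (o₁, τ)) (extendTadpole o₁ ε)
              (extendMatrix (C' * unitField s p) Q) (C * ∑ s', unitField s' p.swap)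
      = (∑ s, ∑ s', ∑ p : Ix Λ, ∑ o₁, ∑ o₂, insertFactor a o₁ * insertFactor a o₂ *
        loopTrace (Equiv.Perm.decomposeOption.symm (o₂, Equiv.Perm.decomposeOption.symm (o₁, τ)))
          (dressed R (pairTadpole o₁ o₂ (s = s') ε)
            (extendMatrix (C * unitField s' p.swap) (extendMatrix (C' * unitField s p) Q))))
        - a * (insertSum a R τ ε Q (C' * tadpoleOp T) + insertSum a R τ ε Q (C * tadpoleOp T')
          - a / 2 * (Matrix.trace (C' * tadpoleOp T) * Φ)) := by
    have hd : insertSum a R τ ε Q (C' * tadpoleOp T) + insertSum a R τ ε Q (C * tadpoleOp T')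
          - a / 2 * (Matrix.trace (C' * tadpoleOp T) * Φ)
        = ∑ s, ∑ p : Ix Λ, ∑ o₁, insertFactor a o₁ *
          tadpoleDefect R τ ε Q C C' (unitField s p) (unitField s p.swap) o₁ := by
      simp only [← hT, ← hT', Finset.mul_sum, Matrix.trace_sum, Finset.sum_mul, insertSum_sum,
        ← Finset.sum_add_distrib, ← Finset.sum_sub_distrib, sum_insertFactor_mul_tadpoleDefect, hΦ]
    rw [hd, Finset.mul_sum, ← Finset.sum_sub_distrib]
    refine Finset.sum_congr rfl fun s _ => ?_
    rw [Finset.sum_comm (s := (Finset.univ : Finset Border)), Finset.mul_sum _ _ a,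
      ← Finset.sum_sub_distrib]
    refine Finset.sum_congr rfl fun p _ => ?_
    rw [Finset.sum_comm, Finset.mul_sum _ _ a, ← Finset.sum_sub_distrib]
    refine Finset.sum_congr rfl fun o₁ _ => ?_
    exact insertSum_sum_unitField a R τ ε Q C C' s p o₁
  -- The contraction of the term of `V` which is linear in the field.
  have X3 : ∑ s, ∑ p : Ix Λ, a / 2 * Matrix.trace (C' * unitField s p) *
          ((if p.1 = p.2 then a * T p.1 else 0) * Φ
            + insertSum a R τ ε Q (C * ∑ s', unitField s' p.swap))
      = a ^ 2 * (∑ m, T m * T' m) * Φ + a * insertSum a R τ ε Q (C * tadpoleOp T') := by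
    rw [Finset.sum_comm]
    simp only [← Finset.sum_mul, ← Finset.mul_sum, htr]
    rw [Fintype.sum_prod_type]
    have : ∀ m, ∑ m', a / 2 * (if m = m' then 2 * T' m else 0) *
        ((if m = m' then a * T m else 0) * Φ +
          insertSum a R τ ε Q (C * ∑ s', unitField s' (m, m').swap))
        = a ^ 2 * (T m * T' m) * Φ
          + a * (T' m * ∑ s', insertSum a R τ ε Q (C * unitField s' (m, m))) := by
      intro m
      rw [Finset.sum_eq_single m (fun m' _ hm => by simp [hm.symm]) (by simp)]
      rw [Finset.mul_sum, insertSum_sum, if_pos rfl, if_pos rfl]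
      simp only [Prod.swap]
      ring
    simp only [this, Finset.sum_add_distrib, ← Finset.sum_mul, ← Finset.mul_sum]
    congr 2
    simp only [tadpoleOp, Finset.mul_sum, insertSum_sum, Matrix.mul_smul, insertSum_smul]
    rw [Finset.sum_comm]
  have X4 : Matrix.trace (C' * tadpoleOp T) = 2 * ∑ m, T m * T' m := by
    simp only [tadpoleOp, Finset.mul_sum, Matrix.trace_sum, Matrix.mul_smul, Matrix.trace_smul,
      smul_eq_mul]
    rw [Finset.sum_comm]
    refine Finset.sum_congr rfl fun m _ => ?_
    rw [← Finset.mul_sum, htr (m, m)]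
    simp
    ring
  simp only [mul_add, Finset.sum_add_distrib] at X1 X2 X3 ⊢
  rw [X1, X2, X3, X4]
  linear_combination (2 * (∑ m, T m * T' m) * Φ) * ha

end Cancellation

/-! ### Contractions along the `σ` propagators -/

section UnitField

variable {Λ : ℕ}

theorem unitField_inner_apply (p x y : Ix Λ) :
    unitField Border.inner p x y = if x.1 = y.1 ∧ (x.2, y.2) = p then 1 else 0 := by
  obtain ⟨p1, p2⟩ := p
  simp only [unitField, Matrix.kroneckerMap_apply, Matrix.one_apply, Matrix.single_apply,
    Prod.mk.injEq]
  by_cases h1 : x.1 = y.1 <;> simp [h1, eq_comm]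

theorem unitField_outer_apply (p x y : Ix Λ) :
    unitField Border.outer p x y = if x.2 = y.2 ∧ (y.1, x.1) = p then 1 else 0 := by
  obtain ⟨p1, p2⟩ := p
  simp only [unitField, Matrix.kroneckerMap_apply, Matrix.one_apply, Matrix.single_apply,
    Prod.mk.injEq, Matrix.transpose_apply]
  by_cases h1 : x.2 = y.2 <;> simp [h1, eq_comm]

theorem sum_smul_unitField (x : Coord Λ) :
    ∑ s, ∑ p : Ix Λ, sigma x p.1 p.2 • unitField s p = sigmaHat x := by
  ext u v
  simp only [sum_border, Matrix.add_apply, Matrix.sum_apply, Matrix.smul_apply,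
    unitField_inner_apply, unitField_outer_apply, sigmaHat, Matrix.kroneckerMap_apply,
    Matrix.one_apply, Matrix.transpose_apply, smul_eq_mul, mul_ite, mul_one, mul_zero, ite_and]
  by_cases h1 : u.1 = v.1 <;> by_cases h2 : u.2 = v.2 <;> simp [h1, h2, add_comm]

theorem tadpoleOp_apply (T : Fin (Λ + 1) → ℂ) (x y : Ix Λ) :
    tadpoleOp T x y = if x = y then T x.1 + T x.2 else 0 := by
  simp only [tadpoleOp, sum_border, Matrix.sum_apply, Matrix.smul_apply,
    unitField_inner_apply, unitField_outer_apply, smul_eq_mul, mul_ite, mul_one, mul_zero,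
    Prod.ext_iff, ite_and]
  by_cases h1 : x.1 = y.1 <;> by_cases h2 : x.2 = y.2 <;> simp [h1, h2, Ne.symm, eq_comm]

theorem unitField_inner_diagonal_apply (c : Ix Λ → ℂ) (p x y : Ix Λ) :
    (unitField Border.inner p * Matrix.diagonal c * unitField Border.inner p.swap) x y
      = if x = y ∧ x.2 = p.1 then c (x.1, p.2) else 0 := by
  simp only [Matrix.mul_apply (N := unitField _ _), Matrix.mul_diagonal]
  rw [Fintype.sum_eq_single (x.1, p.2)]
  · obtain ⟨x1, x2⟩ := x
    obtain ⟨y1, y2⟩ := y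
    obtain ⟨p1, p2⟩ := p
    simp only [unitField_inner_apply, Prod.swap, Prod.mk.injEq]
    split_ifs <;> grind
  · intro z hz
    rw [unitField_inner_apply, if_neg, zero_mul, zero_mul]
    rintro ⟨h1, rfl⟩
    exact hz (Prod.ext h1.symm rfl)

theorem unitField_outer_diagonal_apply (c : Ix Λ → ℂ) (p x y : Ix Λ) :
    (unitField Border.outer p * Matrix.diagonal c * unitField Border.outer p.swap) x y
      = if x = y ∧ x.1 = p.2 then c (p.1, x.2) else 0 := by
  simp only [Matrix.mul_apply (N := unitField _ _), Matrix.mul_diagonal]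
  rw [Fintype.sum_eq_single (p.1, x.2)]
  · obtain ⟨x1, x2⟩ := x
    obtain ⟨y1, y2⟩ := y
    obtain ⟨p1, p2⟩ := p
    simp only [unitField_outer_apply, Prod.swap, Prod.mk.injEq]
    split_ifs <;> grind
  · intro z hz
    rw [unitField_outer_apply, if_neg, zero_mul, zero_mul]
    rintro ⟨h1, rfl⟩
    exact hz (Prod.ext rfl h1.symm)

/-- The contraction of two consecutive half-edges hooked on the same border yields a tadpole. -/
theorem sum_unitField_diagonal (c : Ix Λ → ℂ) (hc : ∀ p, c p.swap = c p) :
    ∑ s, ∑ p : Ix Λ, unitField s p * Matrix.diagonal c * unitField s p.swap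
      = tadpoleOp fun m => ∑ n, c (m, n) := by
  ext x y
  have hc' : ∀ m n, c (m, n) = c (n, m) := fun m n => hc (n, m)
  rw [tadpoleOp_apply, sum_border, Matrix.add_apply, Matrix.sum_apply, Matrix.sum_apply]
  simp only [unitField_inner_diagonal_apply, unitField_outer_diagonal_apply,
    Fintype.sum_prod_type, ite_and]
  by_cases h : x = y
  · simp [h, hc' _ y.2, add_comm]
  · simp [h]

theorem sum_unitField_diagonal_swap (c : Ix Λ → ℂ) (hc : ∀ p, c p.swap = c p) :
    ∑ s, ∑ p : Ix Λ, unitField s p.swap * Matrix.diagonal c * unitField s p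
      = tadpoleOp fun m => ∑ n, c (m, n) := by
  rw [← sum_unitField_diagonal c hc]
  refine Finset.sum_congr rfl fun s _ => ?_
  exact Fintype.sum_equiv (Equiv.prodComm _ _) _ _ fun p => by simp

theorem sum_trace_diagonal_unitField (c : Ix Λ → ℂ) (hc : ∀ p, c p.swap = c p) (p : Ix Λ) :
    ∑ s, Matrix.trace (Matrix.diagonal c * unitField s p)
      = if p.1 = p.2 then 2 * ∑ n, c (p.1, n) else 0 := by
  simp only [sum_border, Matrix.trace, Matrix.diag_apply, Matrix.diagonal_mul,
    unitField_inner_apply, unitField_outer_apply, Fintype.sum_prod_type]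
  obtain ⟨p1, p2⟩ := p
  by_cases h : p1 = p2
  · subst h
    have h1 : ∀ n, c (n, p1) = c (p1, n) := fun n => hc (p1, n)
    have h2 : ∀ x, (x = p1 ∧ x = p1) ↔ x = p1 := fun x => and_self_iff
    simp [h1, two_mul]
  · have : ∀ x, ¬ (x = p1 ∧ x = p2) := by
      rintro x ⟨rfl, h'⟩; exact h h'
    simp [this, h]

end UnitField

/-- The assignments of index pairs to the half-edges, such that the two ends of a propagator carry
opposite pairs. -/
def Contraction {H : Type} (Λ : ℕ) (π : Equiv.Perm H) : Type :=
  {k : H → Ix Λ // ∀ h, k (π h) = (k h).swap}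

instance {H : Type} [Fintype H] [DecidableEq H] {Λ : ℕ} (π : Equiv.Perm H) :
    Fintype (Contraction Λ π) :=
  inferInstanceAs (Fintype {k : H → Ix Λ // ∀ h, k (π h) = (k h).swap})

/-- A contraction along a permutation with an additional transposition `(none, some none)`. -/
def contractionInsert {H : Type} [DecidableEq H] (Λ : ℕ) (π : Equiv.Perm H) :
    Contraction Λ (Equiv.Perm.decomposeOption.symm
      (some none, Equiv.Perm.decomposeOption.symm (none, π))) ≃ Contraction Λ π × Ix Λ where
  toFun k := (⟨fun h => k.1 (some (some h)), fun h => by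
    have := k.2 (some (some h))
    simpa [Equiv.swap_apply_of_ne_of_ne] using this⟩, k.1 (some none))
  invFun p := ⟨fun o => match o with
    | none => p.2.swap
    | some none => p.2
    | some (some h) => p.1.1 h, fun h => by
      rcases h with _ | _ | h
      · simp
      · simp
      · simpa [Equiv.swap_apply_of_ne_of_ne] using p.1.2 h⟩
  left_inv k := by
    apply Subtype.ext
    funext h
    rcases h with _ | _ | h
    · have := k.2 (some none)
      simpa using this.symm
    · rfl
    · rfl
  right_inv p := rfl

namespace ResolventGraph

variable {H : Type} {Λ : ℕ}

theorem unitField_side_apply (G : ResolventGraph H) (i j : H → Ix Λ) (h : H) (p : Ix Λ)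
    [Decidable (G.SpectatorMatch i j h ∧ G.fieldIndex i j h = p)] :
    unitField (G.side h) p (j h) (i (G.next h))
      = if G.SpectatorMatch i j h ∧ G.fieldIndex i j h = p then 1 else 0 := by
  cases hs : G.side h
  · rw [unitField_outer_apply]
    refine if_congr ?_ rfl rfl
    simp [SpectatorMatch, fieldIndex, hs]
  · rw [unitField_inner_apply]
    refine if_congr ?_ rfl rfl
    simp [SpectatorMatch, fieldIndex, hs]

/-- The contraction of the graph, as a sum over the values of all the fields. -/
theorem sum_contraction_prod_unitField [Fintype H] [DecidableEq H] (G : ResolventGraph H)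
    (i j : H → Ix Λ) [Decidable (G.Compatible i j)] :
    ∑ k : Contraction Λ G.pair, ∏ h, unitField (G.side h) (k.1 h) (j h) (i (G.next h))
      = if G.Compatible i j then 1 else 0 := by
  classical
  simp only [unitField_side_apply, Finset.prod_ite_zero, Finset.prod_const_one, Finset.mem_univ,
    true_imp_iff]
  by_cases hc : G.Compatible i j
  · rw [if_pos hc]
    have hk : ∀ h, G.fieldIndex i j (G.pair h) = (G.fieldIndex i j h).swap := by
      intro h
      have h1 := hc.2 (G.pair h)
      rw [G.pair_pair] at h1
      exact Prod.ext h1 (hc.2 h).symm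
    rw [Fintype.sum_eq_single ⟨fun h => G.fieldIndex i j h, hk⟩]
    · rw [if_pos fun h => ⟨hc.1 h, rfl⟩]
    · intro k hne
      rw [if_neg]
      intro hk'
      exact hne (Subtype.ext (funext fun h => (hk' h).2.symm))
  · rw [if_neg hc]
    refine Finset.sum_eq_zero fun k _ => if_neg fun hk => hc ⟨fun h => (hk h).1, fun h => ?_⟩
    rw [(hk h).2, (hk (G.pair h)).2, k.2]
    rfl

open Classical in
/-- The tadpole indicator of a graph. -/
def tadpoleIndicator (G : ResolventGraph H) (h : H) : ℂ := if G.IsTadpole h then 1 else 0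

/-- The matrices at the half-edges of `G`, without the resolvents. -/
def bareProp (I : Finset ℕ) (t : ℕ → ℝ) (G : ResolventGraph H) (k : H → Ix Λ) (h : H) : Op Λ :=
  G.cprop Λ I t h * unitField (G.side h) (k h)

/-- The amplitude as a sum of products of traces along the loop vertices. -/
theorem amplitude_eq [Fintype H] [DecidableEq H] (lam : ℂ) (I : Finset ℕ) (t : ℕ → ℝ) (x : Coord Λ)
    (G : ResolventGraph H) :
    G.amplitude lam I t x = (-lam) ^ G.order * ∑ k : Contraction Λ G.pair,
      loopTrace G.next (dressed (resolvent lam I t x) G.tadpoleIndicator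
        (G.bareProp I t k.1)) := by
  classical
  have hW : ∀ h, G.resolventProp lam I t x h
      = (resolvent lam I t x - G.tadpoleIndicator h • 1) * G.cprop Λ I t h := by
    intro h
    unfold resolventProp tadpoleIndicator
    split_ifs <;> simp
  have h1 : ∀ k : Contraction Λ G.pair, loopTrace G.next (dressed (resolvent lam I t x)
      G.tadpoleIndicator (G.bareProp I t k.1))
      = ∑ i : H → Ix Λ, ∑ j : H → Ix Λ, (∏ h, G.resolventProp lam I t x h (i h) (j h)) *
          ∏ h, unitField (G.side h) (k.1 h) (j h) (i (G.next h)) := by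
    intro k
    unfold loopTrace
    refine Finset.sum_congr rfl fun i _ => ?_
    simp only [dressed, bareProp, ← mul_assoc, ← hW, ← Finset.prod_mul_distrib]
    simp only [Matrix.mul_apply, Finset.prod_univ_sum, Fintype.piFinset_univ]
  have h2 : ∑ k : Contraction Λ G.pair, ∑ i : H → Ix Λ, ∑ j : H → Ix Λ,
      (∏ h, G.resolventProp lam I t x h (i h) (j h)) *
          ∏ h, unitField (G.side h) (k.1 h) (j h) (i (G.next h))
      = ∑ i : H → Ix Λ, ∑ j : H → Ix Λ, if G.Compatible i j then
          ∏ h, G.resolventProp lam I t x h (i h) (j h) else 0 := by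
    rw [Finset.sum_comm]
    refine Finset.sum_congr rfl fun i _ => ?_
    rw [Finset.sum_comm]
    refine Finset.sum_congr rfl fun j _ => ?_
    rw [← Finset.mul_sum, sum_contraction_prod_unitField]
    split_ifs <;> simp
  simp only [h1]
  rw [h2]
  unfold amplitude
  congr!

/-! ### Marking a c-propagator, inserting a propagator -/

section Operations

variable [DecidableEq H]

/-- The graph `G`, with the mark `ω` on the c-propagator ending at `h`. -/
def markAt (G : ResolventGraph H) (ω : ℕ) (h : H) : ResolventGraph H :=
  { G with mark := Function.update G.mark h (some ω) }

/-- The graph obtained from `G` by inserting a half-edge `some none` before `o₁`, or on a new loop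
vertex if `o₁ = none`, and then a half-edge `none` before `o₂`, or on a new loop vertex if
`o₂ = none`. The two new half-edges are joined by a propagator, and the c-propagator ending at the
first one bears the mark `ω`. -/
def insertPair (G : ResolventGraph H) (ω : ℕ) (o₁ : Option H) (o₂ : Option (Option H))
    (s s' : Border) : ResolventGraph (Option (Option H)) where
  next := Equiv.Perm.decomposeOption.symm (o₂, Equiv.Perm.decomposeOption.symm (o₁, G.next))
  pair := Equiv.Perm.decomposeOption.symm
    (some none, Equiv.Perm.decomposeOption.symm (none, G.pair))
  pair_pair h := by
    rcases h with _ | _ | h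
    · simp
    · simp
    · simp [Equiv.swap_apply_of_ne_of_ne, G.pair_pair]
  pair_ne h := by
    rcases h with _ | _ | h
    · simp
    · simp
    · simp [Equiv.swap_apply_of_ne_of_ne, G.pair_ne]
  side h := match h with
    | none => s'
    | some none => s
    | some (some h) => G.side h
  mark h := match h with
    | none => none
    | some none => some ω
    | some (some h) => G.mark h

variable (G : ResolventGraph H) (ω : ℕ) (o₁ : Option H) (o₂ : Option (Option H)) (s s' : Border)

theorem insertPair_pair_none : (G.insertPair ω o₁ o₂ s s').pair none = some none := by
  simp [insertPair]

theorem insertPair_pair_some_none : (G.insertPair ω o₁ o₂ s s').pair (some none) = none := by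
  simp [insertPair]

theorem insertPair_pair_some_some (h : H) :
    (G.insertPair ω o₁ o₂ s s').pair (some (some h)) = some (some (G.pair h)) := by
  simp [insertPair, Equiv.swap_apply_of_ne_of_ne]

theorem insertPair_next_eq_some_some (k h : H) :
    (G.insertPair ω o₁ o₂ s s').next (some (some k)) = some (some h)
      ↔ G.next k = h ∧ o₁ ≠ some h ∧ o₂ ≠ some (some h) := by
  simp only [insertPair, Equiv.Perm.decomposeOption_symm_apply, Equiv.Perm.mul_apply,
    Equiv.optionCongr_apply, Option.map_some]
  simp only [Equiv.swap_apply_def, reduceCtorEq, if_false]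
  grind

theorem insertPair_next_none : (G.insertPair ω o₁ o₂ s s').next none = o₂ := by
  simp [insertPair]

theorem insertPair_next_some_none :
    (G.insertPair ω o₁ o₂ s s').next (some none) = if o₂ = some o₁ then none else some o₁ := by
  simp only [insertPair, Equiv.Perm.decomposeOption_symm_apply, Equiv.Perm.mul_apply,
    Equiv.optionCongr_apply, Option.map_some, Option.map_none, Equiv.swap_apply_def]
  grind

theorem insertPair_tadpoleIndicator :
    (G.insertPair ω o₁ o₂ s s').tadpoleIndicator
      = pairTadpole o₁ o₂ (s = s') G.tadpoleIndicator := by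
  funext h
  have aux : ∀ (P Q : Prop) {_ : Decidable P} {_ : Decidable Q}, (P ↔ Q) →
      (if P then (1 : ℂ) else 0) = if Q then 1 else 0 := fun P Q _ _ h => if_congr h rfl rfl
  rcases h with _ | _ | h
  · refine aux _ _ ?_
    unfold IsTadpole
    rw [insertPair_pair_none, insertPair_next_none, insertPair_next_some_none]
    refine or_congr Iff.rfl (and_congr ?_ Iff.rfl)
    simp
  · refine aux _ _ ?_
    unfold IsTadpole
    rw [insertPair_pair_some_none, insertPair_next_none, insertPair_next_some_none]
    refine or_congr ?_ (and_congr Iff.rfl eq_comm)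
    by_cases h1 : o₁ = none
    · subst h1
      by_cases h2 : o₂ = some none <;> simp [h2]
    · by_cases h2 : o₂ = some o₁ <;> simp [h1, h2]
  · unfold tadpoleIndicator pairTadpole IsTadpole
    rw [insertPair_pair_some_some, insertPair_next_eq_some_some, insertPair_next_eq_some_some]
    simp only [insertPair]
    by_cases h1 : o₁ = some h <;> by_cases h2 : o₂ = some (some h) <;> simp [h1, h2]

theorem insertPair_bareProp (I : Finset ℕ) (t : ℕ → ℝ) (k : H → Ix Λ) (p : Ix Λ)
    (k' : Option (Option H) → Ix Λ) (h0 : k' none = p.swap) (h1 : k' (some none) = p)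
    (h2 : ∀ h, k' (some (some h)) = k h) :
    (G.insertPair ω o₁ o₂ s s').bareProp I t k'
      = extendMatrix (prop Λ I t * unitField s' p.swap)
          (extendMatrix (sliceProp Λ ω * unitField s p) (G.bareProp I t k)) := by
  funext h
  rcases h with _ | _ | h
  · simp [bareProp, insertPair, cprop, extendMatrix, h0]
  · simp [bareProp, insertPair, cprop, extendMatrix, h1]
  · simp [bareProp, insertPair, cprop, extendMatrix, h2]

theorem insertPair_order [Finite H] : (G.insertPair ω o₁ o₂ s s').order = G.order + 1 := by
  have := Fintype.ofFinite H
  simp only [order, Nat.card_eq_fintype_card, Fintype.card_option]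
  omega

theorem insertPair_amplitude [Fintype H] (lam : ℂ) (I : Finset ℕ) (t : ℕ → ℝ) (x : Coord Λ) :
    (G.insertPair ω o₁ o₂ s s').amplitude lam I t x
      = (-lam) ^ (G.order + 1) * ∑ k : Contraction Λ G.pair, ∑ p : Ix Λ,
        loopTrace (Equiv.Perm.decomposeOption.symm (o₂,
            Equiv.Perm.decomposeOption.symm (o₁, G.next)))
          (dressed (resolvent lam I t x) (pairTadpole o₁ o₂ (s = s') G.tadpoleIndicator)
            (extendMatrix (prop Λ I t * unitField s' p.swap)
              (extendMatrix (sliceProp Λ ω * unitField s p) (G.bareProp I t k.1)))) := by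
  rw [amplitude_eq, insertPair_order, insertPair_tadpoleIndicator, ← Fintype.sum_prod_type']
  congr 1
  refine Fintype.sum_equiv (contractionInsert Λ G.pair) _ _ fun k => ?_
  obtain ⟨⟨k, p⟩, rfl⟩ := (contractionInsert Λ G.pair).symm.surjective k
  rw [Equiv.apply_symm_apply]
  rw [G.insertPair_bareProp ω o₁ o₂ s s' I t k.1 p _ rfl rfl fun h => rfl]
  rfl

theorem insertPair_weight (hG : G.Covered) :
    weight _ (G.insertPair ω o₁ o₂ s s')
      = 1 / 2 * (if o₁ = none then 1 / 2 else 1) * (if o₂ = none then 1 / 2 else 1)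
        * weight H G := by
  have hG' : (G.insertPair ω o₁ o₂ s s').Covered := by
    intro h
    rcases h with _ | _ | h
    · rw [insertPair_pair_none]; exact Or.inr rfl
    · exact Or.inl rfl
    · rw [insertPair_pair_some_some]; exact hG h
  unfold weight
  rw [if_pos hG, if_pos hG']
  simp only [insertPair, cycleWeight_decomposeOption, reduceCtorEq, if_false, if_true]
  ring

theorem markAt_tadpoleIndicator (h : H) :
    (G.markAt ω h).tadpoleIndicator = G.tadpoleIndicator := rfl

theorem markAt_bareProp (I : Finset ℕ) (t : ℕ → ℝ) (k : H → Ix Λ) (h : H) :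
    (G.markAt ω h).bareProp I t k = Function.update (G.bareProp I t k) h
      (sliceProp Λ ω * unitField (G.side h) (k h)) := by
  funext h'
  by_cases hh : h' = h
  · subst hh
    simp [bareProp, markAt, cprop]
  · simp [bareProp, markAt, cprop, hh]

theorem markAt_weight (h : H) (hG : G.Covered) :
    weight H (G.markAt ω h) = weight H G := by
  have hG' : (G.markAt ω h).Covered := by
    intro k
    have := hG k
    simp only [markAt, Function.update_apply]
    split_ifs <;> simp_all
  unfold weight
  rw [if_pos hG, if_pos hG']
  rfl

theorem markAt_amplitude [Fintype H] (h : H) (lam : ℂ) (I : Finset ℕ) (t : ℕ → ℝ) (x : Coord Λ) :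
    (G.markAt ω h).amplitude lam I t x
      = (-lam) ^ G.order * ∑ k : Contraction Λ G.pair,
        loopForm G.next (dressed (resolvent lam I t x) G.tadpoleIndicator (G.bareProp I t k.1)) h
          ((resolvent lam I t x - G.tadpoleIndicator h • 1) *
            (sliceProp Λ ω * unitField (G.side h) (k.1 h))) := by
  rw [amplitude_eq]
  congr 1
  refine Finset.sum_congr rfl fun k _ => ?_
  rw [markAt_bareProp, markAt_tadpoleIndicator, ← loopTrace_update]
  congr 1
  funext h'
  by_cases hh : h' = h
  · subst hh
    simp [dressed]
  · simp [dressed, hh]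

end Operations

theorem Iso.isTadpole_iff {H' : Type} {G : ResolventGraph H} {G' : ResolventGraph H'} (e : H ≃ H')
    (h1 : ∀ h, e (G.next h) = G'.next (e h)) (h2 : ∀ h, e (G.pair h) = G'.pair (e h))
    (h3 : ∀ h, G'.side (e h) = G.side h) (h : H) : G'.IsTadpole (e h) ↔ G.IsTadpole h := by
  unfold IsTadpole
  rw [← h2, ← h1, ← h1, h3, h3, e.apply_eq_iff_eq, e.apply_eq_iff_eq]

/-- Amplitudes are invariant under isomorphism. -/
theorem Iso.amplitude_eq {H' : Type} [Fintype H] [Fintype H'] {G : ResolventGraph H}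
    {G' : ResolventGraph H'} (hG : G.Iso G') (lam : ℂ) (I : Finset ℕ) (t : ℕ → ℝ) (x : Coord Λ) :
    G.amplitude lam I t x = G'.amplitude lam I t x := by
  classical
  obtain ⟨e, h1, h2, h3, h4⟩ := hG
  rw [ResolventGraph.amplitude_eq, ResolventGraph.amplitude_eq]
  congr 1
  · rw [order, order, Nat.card_congr e]
  let E : Contraction Λ G'.pair ≃ Contraction Λ G.pair :=
    (e.symm.arrowCongr (Equiv.refl (Ix Λ))).subtypeEquiv fun k => by
      rw [← e.forall_congr_right]
      simp [h2]
  rw [← Fintype.sum_equiv E _ _ fun k => rfl]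
  refine Finset.sum_congr rfl fun k _ => ?_
  rw [← loopTrace_congr e h1]
  congr 1
  funext h
  have ht : G'.tadpoleIndicator (e h) = G.tadpoleIndicator h := by
    unfold tadpoleIndicator
    exact if_congr (Iso.isTadpole_iff e h1 h2 h3 h) rfl rfl
  simp only [dressed, ht, bareProp, cprop, h3, h4]
  rfl

end ResolventGraph

/-! ### Invertibility and bounds for the resolvents -/

/-- The coefficient `i √(2λ) / 2` of the field. -/
def coupling (lam : ℂ) : ℂ := Complex.I * sqrtTwo lam / 2

theorem coupling_sq (lam : ℂ) : coupling lam ^ 2 = -lam / 2 := by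
  have h : sqrtTwo lam ^ 2 = 2 * lam := by
    simp [sqrtTwo, one_div]
  unfold coupling
  rw [div_pow, mul_pow, h, Complex.I_sq]
  ring

/-- As `√(2λ)` vanishes or has positive real part, `1 + i (√(2λ) / 2) β` stays away from zero. -/
theorem exists_coupling_bound {lam : ℂ} (hlam : |lam.arg| < Real.pi) :
    ∃ δ : ℝ, 0 < δ ∧ ∀ β : ℝ, δ ≤ ‖1 + coupling lam * (β : ℂ)‖ := by
  by_cases h0 : lam = 0
  · refine ⟨1, one_pos, fun β => ?_⟩
    simp [coupling, sqrtTwo, h0]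
  have h2 : (2 * lam) ≠ 0 := mul_ne_zero two_ne_zero h0
  set z := sqrtTwo lam with hz
  have hre : 0 < z.re := by
    rw [hz, sqrtTwo, Complex.cpow_def_of_ne_zero h2, Complex.exp_re]
    refine mul_pos (Real.exp_pos _) (Real.cos_pos_of_mem_Ioo ?_)
    have harg : (2 * lam).arg = lam.arg := by
      have := Complex.arg_real_mul lam (r := 2) (by norm_num)
      simpa using this
    have him : (Complex.log (2 * lam) * (1 / 2 : ℂ)).im = lam.arg / 2 := by
      rw [show (1 / 2 : ℂ) = ((1 / 2 : ℝ) : ℂ) by norm_num, Complex.im_mul_ofReal, Complex.log_im,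
        harg]
      ring
    rw [him]
    obtain ⟨h3, h4⟩ := abs_lt.1 hlam
    constructor <;> linarith
  have hz0 : 0 < ‖z‖ := lt_of_lt_of_le hre (Complex.re_le_norm z)
  refine ⟨z.re / ‖z‖, div_pos hre hz0, fun β => ?_⟩
  rw [div_le_iff₀ hz0]
  have e : (1 + coupling lam * (β : ℂ)) * (starRingEnd ℂ z)
      = starRingEnd ℂ z + Complex.I * ((Complex.normSq z * β / 2 : ℝ) : ℂ) := by
    push_cast
    rw [← Complex.mul_conj, coupling, ← hz]
    ring
  have : ‖1 + coupling lam * (β : ℂ)‖ * ‖z‖ = ‖starRingEnd ℂ z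
      + Complex.I * ((Complex.normSq z * β / 2 : ℝ) : ℂ)‖ := by
    rw [← e, norm_mul, Complex.norm_conj]
  rw [this]
  refine le_trans (le_of_eq ?_) (Complex.re_le_norm _)
  simp

section MatrixBounds

variable {n : Type} [Fintype n] [DecidableEq n]

/-- The quadratic form of a Hermitian matrix is real, so that the bound on the numbers `1 + a β`
carries over to the numerical range of `1 + a B`. -/
theorem norm_one_add_smul_quadForm {a : ℂ} {δ : ℝ} (hδ : ∀ β : ℝ, δ ≤ ‖1 + a * (β : ℂ)‖)
    {B : Matrix n n ℂ} (hB : B.IsHermitian) (v : n → ℂ) :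
    δ * ∑ i, ‖v i‖ ^ 2 ≤ ‖star v ⬝ᵥ ((1 + a • B).mulVec v)‖ := by
  have hS : star v ⬝ᵥ v = ((∑ i, ‖v i‖ ^ 2 : ℝ) : ℂ) := by
    simp only [dotProduct, Pi.star_apply, Complex.ofReal_sum]
    refine Finset.sum_congr rfl fun i _ => ?_
    rw [Complex.star_def, mul_comm, Complex.mul_conj, Complex.normSq_eq_norm_sq]
  obtain ⟨β, hβ⟩ : ∃ β : ℝ, star v ⬝ᵥ (B.mulVec v) = (β : ℂ) :=
    ⟨(star v ⬝ᵥ B.mulVec v).re, Complex.ext (by simp)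
      (by simpa using hB.im_star_dotProduct_mulVec_self v)⟩
  have e : star v ⬝ᵥ ((1 + a • B).mulVec v) = ((∑ i, ‖v i‖ ^ 2 : ℝ) : ℂ) + a * β := by
    rw [Matrix.add_mulVec, Matrix.one_mulVec, Matrix.smul_mulVec, dotProduct_add, dotProduct_smul,
      hS, hβ, smul_eq_mul]
  rw [e]
  set S := ∑ i, ‖v i‖ ^ 2
  have hS0 : 0 ≤ S := Finset.sum_nonneg fun i _ => by positivity
  rcases hS0.eq_or_lt with h0 | h0
  · rw [← h0, mul_zero]; exact norm_nonneg _
  · have : ((S : ℝ) : ℂ) + a * β = (S : ℂ) * (1 + a * ((β / S : ℝ) : ℂ)) := by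
      have : (S : ℂ) ≠ 0 := by exact_mod_cast h0.ne'
      push_cast
      field_simp
    rw [this, norm_mul, Complex.norm_real, Real.norm_of_nonneg hS0, mul_comm]
    exact mul_le_mul_of_nonneg_left (hδ _) hS0

theorem isUnit_one_add_smul_hermitian {a : ℂ} {δ : ℝ} (hδ0 : 0 < δ)
    (hδ : ∀ β : ℝ, δ ≤ ‖1 + a * (β : ℂ)‖) {B : Matrix n n ℂ} (hB : B.IsHermitian) :
    IsUnit (1 + a • B) := by
  rw [← Matrix.mulVec_injective_iff_isUnit, ← Matrix.coe_mulVecLin, ← LinearMap.ker_eq_bot,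
    LinearMap.ker_eq_bot']
  intro v hv
  have h := norm_one_add_smul_quadForm hδ hB v
  rw [Matrix.mulVecLin_apply] at hv
  rw [hv, dotProduct_zero, norm_zero] at h
  have h2 : ∑ i, ‖v i‖ ^ 2 ≤ 0 := by
    by_contra hc
    push Not at hc
    linarith [mul_pos hδ0 hc]
  funext i
  have h3 : ‖v i‖ ^ 2 ≤ 0 := (Finset.single_le_sum (f := fun i => ‖v i‖ ^ 2)
    (fun i _ => by positivity) (Finset.mem_univ i)).trans h2
  have h4 : ‖v i‖ = 0 := by nlinarith [norm_nonneg (v i)]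
  simpa using h4

/-- The entries of `(1 + a B)⁻¹` are bounded uniformly in the Hermitian matrix `B`. -/
theorem norm_inv_one_add_smul_hermitian_le {a : ℂ} {δ : ℝ} (hδ0 : 0 < δ)
    (hδ : ∀ β : ℝ, δ ≤ ‖1 + a * (β : ℂ)‖) {B : Matrix n n ℂ} (hB : B.IsHermitian) (i j : n) :
    ‖(1 + a • B)⁻¹ i j‖ ≤ δ⁻¹ := by
  have hu := (Matrix.isUnit_iff_isUnit_det _).1 (isUnit_one_add_smul_hermitian hδ0 hδ hB)
  set v : n → ℂ := (1 + a • B)⁻¹.mulVec (Pi.single j 1) with hv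
  have hvi : ∀ i, v i = (1 + a • B)⁻¹ i j := by
    intro i
    rw [hv, Matrix.mulVec_single_one]
    rfl
  have h := norm_one_add_smul_quadForm hδ hB v
  rw [hv, Matrix.mulVec_mulVec, Matrix.mul_nonsing_inv _ hu, Matrix.one_mulVec, ← hv,
    dotProduct_single_one, Pi.star_apply, norm_star] at h
  have hle : ∀ i, ‖v i‖ ^ 2 ≤ ∑ i, ‖v i‖ ^ 2 := fun i =>
    Finset.single_le_sum (f := fun i => ‖v i‖ ^ 2) (fun i _ => by positivity) (Finset.mem_univ i)
  rw [← hvi, ← one_div, le_div_iff₀ hδ0]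
  have h1 : ‖v j‖ * δ ≤ 1 := by
    by_contra hc
    push Not at hc
    have h2 : 0 < ‖v j‖ := by
      by_contra h0
      have : ‖v j‖ = 0 := le_antisymm (not_lt.1 h0) (norm_nonneg _)
      rw [this] at hc
      linarith
    have h3 := mul_le_mul_of_nonneg_left (hle j) hδ0.le
    nlinarith
  have h4 : (‖v i‖ * δ) ^ 2 ≤ 1 := by
    have h5 := mul_le_mul_of_nonneg_left (hle i) (by positivity : 0 ≤ δ ^ 2)
    nlinarith
  exact le_of_sq_le_sq (by simpa using h4) zero_le_one

/-- The resolvent of `D² F` in terms of the resolvent of the Hermitian matrix `D F D`. -/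
theorem one_add_mul_resolvent (a : ℂ) (D F : Matrix n n ℂ) (hu : IsUnit (1 + a • (D * F * D))) :
    (1 + a • (D * D * F)) * (1 - a • (D * (1 + a • (D * F * D))⁻¹ * (D * F))) = 1 := by
  have hu' := (Matrix.isUnit_iff_isUnit_det _).1 hu
  set Y := (1 + a • (D * F * D))⁻¹ with hY
  have h1 : Y + a • (D * F * D * Y) = 1 := by
    have := Matrix.mul_nonsing_inv _ hu'
    rwa [add_mul, one_mul, Matrix.smul_mul] at this
  have h2 : D * Y * (D * F) + a • (D * D * F * (D * Y * (D * F))) = D * (D * F) := by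
    have : D * Y * (D * F) + a • (D * D * F * (D * Y * (D * F)))
        = D * (Y + a • (D * F * D * Y)) * (D * F) := by
      rw [mul_add, add_mul, Matrix.mul_smul, Matrix.smul_mul]
      congr 2
      noncomm_ring
    rw [this, h1, mul_one]
  calc (1 + a • (D * D * F)) * (1 - a • (D * Y * (D * F)))
      = 1 + a • (D * D * F) - a • (D * Y * (D * F) + a • (D * D * F * (D * Y * (D * F)))) := by
        rw [mul_sub, mul_one, add_mul, one_mul, Matrix.mul_smul (a • _), Matrix.smul_mul, smul_add]
    _ = 1 := by
        rw [h2, mul_assoc D D F, add_sub_cancel_right]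

/-- The trace in `log₂`, in terms of the resolvent of the Hermitian matrix `D F D`. -/
theorem trace_mul_resolvent (a : ℂ) (D F Z : Matrix n n ℂ) (hu : IsUnit (1 + a • (D * F * D)))
    (hZ : (1 + a • (D * D * F)) * Z = 1) :
    Matrix.trace ((D * D * F) * Z) = Matrix.trace (D * F * D * (1 + a • (D * F * D))⁻¹) := by
  have hu' := (Matrix.isUnit_iff_isUnit_det _).1 hu
  have h1 : (1 + a • (D * F * D)) * (D * F * Z) = D * F := by
    calc (1 + a • (D * F * D)) * (D * F * Z) = D * F * ((1 + a • (D * D * F)) * Z) := by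
          rw [add_mul, add_mul, one_mul, one_mul, mul_add, Matrix.smul_mul, Matrix.smul_mul,
            Matrix.mul_smul]
          congr 2
          noncomm_ring
      _ = D * F := by rw [hZ, mul_one]
  have h2 : D * F * Z = (1 + a • (D * F * D))⁻¹ * (D * F) := by
    calc D * F * Z = ((1 + a • (D * F * D))⁻¹ * (1 + a • (D * F * D))) * (D * F * Z) := by
          rw [Matrix.nonsing_inv_mul _ hu', one_mul]
      _ = _ := by rw [mul_assoc, h1]
  rw [mul_assoc D D F, mul_assoc D (D * F) Z, h2, ← mul_assoc, Matrix.trace_mul_comm, ← mul_assoc]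

end MatrixBounds

/-! ### The covariance, and the field in real coordinates -/

section Field

variable {Λ : ℕ}

/-- The interpolation parameters in `[0, 1]`. -/
def paramCube : Set (ℕ → ℝ) := {t | ∀ ω, t ω ∈ Set.Icc (0 : ℝ) 1}

/-- The diagonal entries of `C(t)`. -/
def propCoeff (I : Finset ℕ) (t : ℕ → ℝ) (p : Ix Λ) : ℝ :=
  ∑ ω ∈ I, t ω * if (p.1 : ℕ) + (p.2 : ℕ) = ω then 1 / ((p.1 : ℝ) + (p.2 : ℝ) + 1) else 0

theorem prop_eq_diagonal (I : Finset ℕ) (t : ℕ → ℝ) :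
    prop Λ I t = Matrix.diagonal fun p => (propCoeff I t p : ℂ) := by
  ext p q
  rw [prop, Matrix.sum_apply]
  by_cases h : p = q
  · subst h
    simp only [Matrix.smul_apply, sliceProp, Matrix.diagonal_apply_eq, propCoeff, sliceCoeff,
      Complex.ofReal_sum]
    refine Finset.sum_congr rfl fun ω _ => ?_
    split_ifs <;> simp
  · simp [sliceProp, Matrix.diagonal_apply_ne _ h]

theorem propCoeff_nonneg {I : Finset ℕ} {t : ℕ → ℝ} (ht : t ∈ paramCube) (p : Ix Λ) :
    0 ≤ propCoeff I t p :=
  Finset.sum_nonneg fun ω _ => mul_nonneg (ht ω).1 (by split_ifs <;> positivity)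

theorem propCoeff_le {I : Finset ℕ} {t : ℕ → ℝ} (ht : t ∈ paramCube) (p : Ix Λ) :
    propCoeff I t p ≤ 1 := by
  have h1 : ∀ ω ∈ I, t ω * (if (p.1 : ℕ) + (p.2 : ℕ) = ω then 1 / ((p.1 : ℝ) + (p.2 : ℝ) + 1)
      else 0) ≤ if (p.1 : ℕ) + (p.2 : ℕ) = ω then 1 else 0 := by
    intro ω _
    split_ifs with h
    · refine mul_le_one₀ (ht ω).2 (by positivity) ?_
      rw [div_le_one (by positivity)]
      have : (0 : ℝ) ≤ (p.1 : ℝ) + (p.2 : ℝ) := by positivity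
      linarith
    · simp
  refine (Finset.sum_le_sum h1).trans ?_
  rw [Finset.sum_ite_eq]
  split_ifs <;> norm_num

theorem propCoeff_swap (I : Finset ℕ) (t : ℕ → ℝ) (p : Ix Λ) :
    propCoeff I t p.swap = propCoeff I t p := by
  simp [propCoeff, add_comm]

theorem sliceCoeff_swap (ω : ℕ) (p : Ix Λ) : sliceCoeff ω p.swap = sliceCoeff ω p := by
  simp [sliceCoeff, add_comm]

theorem tadpole_eq_sum (I : Finset ℕ) (t : ℕ → ℝ) :
    (tadpole I t : Fin (Λ + 1) → ℂ) = fun m => ∑ n : Fin (Λ + 1), (propCoeff I t (m, n) : ℂ) := by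
  funext m
  simp only [tadpole, sliceTadpole, propCoeff, sliceCoeff, Complex.ofReal_sum, Finset.mul_sum]
  rw [Finset.sum_comm]
  refine Finset.sum_congr rfl fun n _ => Finset.sum_congr rfl fun ω _ => ?_
  split_ifs <;> simp

theorem sigma_isHermitian (x : Coord Λ) : (sigma x).IsHermitian := by
  ext m n
  simp only [Matrix.conjTranspose_apply, sigma, Matrix.of_apply]
  rcases lt_trichotomy m n with h | rfl | h
  · simp [h, h.ne, h.ne', h.not_gt, Complex.conj_ofReal]
  · simp
  · simp [h, h.ne, h.ne', h.not_gt, Complex.conj_ofReal]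
    ring

theorem sigmaHat_isHermitian (x : Coord Λ) : (sigmaHat x).IsHermitian := by
  have h := sigma_isHermitian x
  have h' : (sigma x).transpose.IsHermitian := h.transpose
  unfold sigmaHat Matrix.IsHermitian
  rw [Matrix.conjTranspose_add, Matrix.conjTranspose_kronecker, Matrix.conjTranspose_kronecker,
    Matrix.conjTranspose_one, h, h']

theorem sigma_add (x y : Coord Λ) : sigma (x + y) = sigma x + sigma y := by
  ext m n
  simp only [sigma, Matrix.of_apply, Matrix.add_apply, Pi.add_apply, Complex.ofReal_add]
  split_ifs <;> ring

theorem sigma_smul (c : ℝ) (x : Coord Λ) : sigma (c • x) = (c : ℂ) • sigma x := by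
  ext m n
  simp only [sigma, Matrix.of_apply, Matrix.smul_apply, Pi.smul_apply, smul_eq_mul,
    Complex.ofReal_mul]
  split_ifs <;> ring

theorem sigmaHat_add (x y : Coord Λ) : sigmaHat (x + y) = sigmaHat x + sigmaHat y := by
  simp only [← sum_smul_unitField, sigma_add, Matrix.add_apply, add_smul, Finset.sum_add_distrib]

theorem sigmaHat_smul (c : ℝ) (x : Coord Λ) : sigmaHat (c • x) = (c : ℂ) • sigmaHat x := by
  simp only [← sum_smul_unitField, sigma_smul, Matrix.smul_apply, smul_eq_mul, mul_smul,
    Finset.smul_sum]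

/-- The sum of the absolute values of the coordinates of the field. -/
def fieldSize (x : Coord Λ) : ℝ := ∑ p, |x p|

theorem abs_le_fieldSize (x : Coord Λ) (p : Ix Λ) : |x p| ≤ fieldSize x :=
  Finset.single_le_sum (f := fun p => |x p|) (fun _ _ => abs_nonneg _) (Finset.mem_univ p)

theorem fieldSize_nonneg (x : Coord Λ) : 0 ≤ fieldSize x :=
  Finset.sum_nonneg fun _ _ => abs_nonneg _

theorem norm_sigma_le (x : Coord Λ) (m n : Fin (Λ + 1)) : ‖sigma x m n‖ ≤ 2 * fieldSize x := by
  have h1 := abs_le_fieldSize x (m, n)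
  have h2 := abs_le_fieldSize x (n, m)
  have hs : (1 : ℝ) ≤ Real.sqrt 2 := Real.one_le_sqrt.2 (by norm_num)
  have key : ∀ u v : ℂ, ‖u‖ ≤ fieldSize x → ‖v‖ ≤ fieldSize x →
      ‖(u + v) / (Real.sqrt 2 : ℂ)‖ ≤ 2 * fieldSize x := by
    intro u v hu hv
    rw [norm_div, Complex.norm_real, Real.norm_of_nonneg (by positivity)]
    refine (div_le_self (norm_nonneg _) hs).trans ((norm_add_le _ _).trans ?_)
    linarith
  simp only [sigma, Matrix.of_apply]
  split_ifs with h h'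
  · subst h
    rw [Complex.norm_real, Real.norm_eq_abs]
    linarith [abs_nonneg (x (m, m))]
  · refine key _ _ ?_ ?_ <;> simpa
  · rw [sub_eq_add_neg]
    refine key _ _ ?_ ?_ <;> simpa

theorem norm_sigmaHat_le (x : Coord Λ) (p q : Ix Λ) : ‖sigmaHat x p q‖ ≤ 4 * fieldSize x := by
  have h1 := norm_sigma_le x p.2 q.2
  have h2 := norm_sigma_le x q.1 p.1
  have h0 := fieldSize_nonneg x
  simp only [sigmaHat, Matrix.add_apply, Matrix.kroneckerMap_apply, Matrix.one_apply,
    Matrix.transpose_apply]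
  refine (norm_add_le _ _).trans ?_
  split_ifs <;> simp <;> linarith

/-- The coordinate vectors of the space of fields. -/
def coordVec (p : Ix Λ) : Coord Λ := Pi.single p 1

theorem sigma_eq_sum (x : Coord Λ) : sigma x = ∑ p, (x p : ℂ) • sigma (coordVec p) := by
  let f : Coord Λ →+ Matrix (Fin (Λ + 1)) (Fin (Λ + 1)) ℂ :=
    { toFun := sigma
      map_zero' := by simpa using sigma_smul (0 : ℝ) (0 : Coord Λ)
      map_add' := sigma_add }
  have hx : x = ∑ p, x p • coordVec p := by
    funext q
    simp [coordVec, Finset.sum_apply, Pi.single_apply]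
  have : f x = ∑ p, f (x p • coordVec p) := by
    conv_lhs => rw [hx]
    rw [map_sum]
  simpa [f, sigma_smul] using this

theorem sum_sigma_coordVec_mul (a b : Fin (Λ + 1)) (f : Ix Λ → ℂ) :
    ∑ p, sigma (coordVec p) a b * f p = if a = b then f (a, a)
      else if a < b then (f (a, b) + f (b, a) * Complex.I) / (Real.sqrt 2 : ℂ)
      else (f (b, a) - f (a, b) * Complex.I) / (Real.sqrt 2 : ℂ) := by
  have h1 : ∀ p q : Ix Λ, ((coordVec p q : ℝ) : ℂ) = if p = q then 1 else 0 := by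
    intro p q
    by_cases h : q = p <;> simp [coordVec, h, Ne.symm]
  simp only [sigma, Matrix.of_apply, h1]
  split_ifs with h h'
  · simp
  · simp only [div_mul_eq_mul_div, add_mul, ← Finset.sum_div, Finset.sum_add_distrib, ite_mul,
      one_mul, zero_mul, Finset.sum_ite_eq', Finset.mem_univ, if_true]
    ring
  · simp only [div_mul_eq_mul_div, sub_mul, ← Finset.sum_div, Finset.sum_sub_distrib, ite_mul,
      one_mul, zero_mul, Finset.sum_ite_eq', Finset.mem_univ, if_true]
    ring

/-- The covariance of the Gaussian measure, `⟨σ_ab σ_cd⟩ = δ_ad δ_bc`. -/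
theorem sum_sigma_coordVec_sigma_coordVec (a b c d : Fin (Λ + 1)) :
    ∑ p, sigma (coordVec p) a b * sigma (coordVec p) c d = if a = d ∧ b = c then 1 else 0 := by
  have h1 : ∀ p q : Ix Λ, ((coordVec p q : ℝ) : ℂ) = if p = q then 1 else 0 := by
    intro p q
    by_cases h : q = p <;> simp [coordVec, h, Ne.symm]
  have h2 : (Real.sqrt 2 : ℂ) * (Real.sqrt 2 : ℂ) = 2 := by
    rw [← Complex.ofReal_mul, Real.mul_self_sqrt (by norm_num)]; norm_num
  have h0 : (Real.sqrt 2 : ℂ) ≠ 0 := by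
    intro h; rw [h] at h2; norm_num at h2
  rw [sum_sigma_coordVec_mul]
  simp only [sigma, Matrix.of_apply, h1, Prod.mk.injEq]
  by_cases e1 : a = d ∧ b = c
  · obtain ⟨rfl, rfl⟩ := e1
    rcases lt_trichotomy a b with h | rfl | h
    · simp [h.ne, h.ne', h, h.not_gt]
      field_simp
      linear_combination (-1 : ℂ) * h2 - Complex.I_sq
    · simp
    · simp [h.ne, h.ne', h, h.not_gt]
      field_simp
      linear_combination (-1 : ℂ) * h2 - Complex.I_sq
  · rw [if_neg e1]
    by_cases e2 : a = c ∧ b = d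
    · obtain ⟨rfl, rfl⟩ := e2
      rcases lt_trichotomy a b with h | rfl | h
      · simp [h.ne, h.ne', h]
        field_simp
        linear_combination Complex.I_sq
      · simp at e1
      · simp [h.ne, h.ne', h.not_gt]
        field_simp
        linear_combination Complex.I_sq
    · have e3 : ¬ (b = c ∧ a = d) := fun h => e1 h.symm
      have e4 : ¬ (b = d ∧ a = c) := fun h => e2 h.symm
      clear h1 h2 h0
      split_ifs <;> first | (exfalso; grind) | simp

theorem sum_sigma_coordVec_smul_sigmaHat (a b : Fin (Λ + 1)) :
    ∑ p, sigma (coordVec p) a b • sigmaHat (coordVec p) = ∑ s, unitField s (b, a) := by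
  simp only [← sum_smul_unitField, Finset.smul_sum, smul_smul]
  rw [Finset.sum_comm]
  refine Finset.sum_congr rfl fun s _ => ?_
  rw [Finset.sum_comm]
  simp only [← Finset.sum_smul, sum_sigma_coordVec_sigma_coordVec]
  rw [Fintype.sum_eq_single (b, a)]
  · simp
  · rintro ⟨c, d⟩ h
    rw [if_neg, zero_smul]
    rintro ⟨rfl, rfl⟩
    exact h rfl

end Field

/-! ### The resolvents of the field -/

section Resolvent

variable {Λ : ℕ}

/-- The square root `D` of `C(t)`. The resolvents of `C(t) σ̂ = D² σ̂` are controlled by those of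
the Hermitian operator `D σ̂ D`. -/
def sqrtProp (Λ : ℕ) (I : Finset ℕ) (t : ℕ → ℝ) : Op Λ :=
  Matrix.diagonal fun p => (Real.sqrt (propCoeff I t p) : ℂ)

theorem sqrtProp_mul_self {I : Finset ℕ} {t : ℕ → ℝ} (ht : t ∈ paramCube) :
    sqrtProp Λ I t * sqrtProp Λ I t = prop Λ I t := by
  rw [sqrtProp, Matrix.diagonal_mul_diagonal, prop_eq_diagonal]
  congr 1
  funext p
  rw [← Complex.ofReal_mul, Real.mul_self_sqrt (propCoeff_nonneg ht p)]

theorem sqrtProp_mul_mul_isHermitian (I : Finset ℕ) (t : ℕ → ℝ) {F : Op Λ} (hF : F.IsHermitian) :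
    (sqrtProp Λ I t * F * sqrtProp Λ I t).IsHermitian := by
  have hD : (sqrtProp Λ I t).IsHermitian := by
    refine Matrix.isHermitian_diagonal_of_self_adjoint _ ?_
    funext p
    simp
  have := Matrix.isHermitian_mul_mul_conjTranspose (sqrtProp Λ I t) hF
  rwa [hD] at this

theorem vertexOp_eq (lam : ℂ) {I : Finset ℕ} {t : ℕ → ℝ} (ht : t ∈ paramCube) (x : Coord Λ) :
    vertexOp lam I t x = coupling lam • (sqrtProp Λ I t * sqrtProp Λ I t * sigmaHat x) := by
  rw [sqrtProp_mul_self ht]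
  rfl

theorem one_add_smul_vertexOp (lam : ℂ) {I : Finset ℕ} {t : ℕ → ℝ} (ht : t ∈ paramCube)
    (x : Coord Λ) (u : ℝ) :
    1 + (u : ℂ) • vertexOp lam I t x
      = 1 + (u * coupling lam) • (sqrtProp Λ I t * sqrtProp Λ I t * sigmaHat x) := by
  rw [vertexOp_eq lam ht, smul_smul]

theorem mul_coupling_bound {lam : ℂ} {δ : ℝ} (hδ : ∀ β : ℝ, δ ≤ ‖1 + coupling lam * (β : ℂ)‖)
    (u β : ℝ) : δ ≤ ‖1 + u * coupling lam * (β : ℂ)‖ := by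
  have h := hδ (u * β)
  have e : coupling lam * ((u * β : ℝ) : ℂ) = u * coupling lam * (β : ℂ) := by
    push_cast
    ring
  rwa [e] at h

theorem isUnit_one_add_smul_vertexOp {lam : ℂ} (hlam : |lam.arg| < Real.pi) {I : Finset ℕ}
    {t : ℕ → ℝ} (ht : t ∈ paramCube) (x : Coord Λ) (u : ℝ) :
    IsUnit (1 + (u : ℂ) • vertexOp lam I t x) := by
  obtain ⟨δ, hδ0, hδ⟩ := exists_coupling_bound hlam
  rw [one_add_smul_vertexOp lam ht]
  have h := one_add_mul_resolvent (u * coupling lam) (sqrtProp Λ I t) (sigmaHat x)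
    (isUnit_one_add_smul_hermitian hδ0 (mul_coupling_bound hδ u)
      (sqrtProp_mul_mul_isHermitian I t (sigmaHat_isHermitian x)))
  exact (Matrix.isUnit_iff_isUnit_det _).2 (Matrix.isUnit_det_of_right_inverse h)

theorem isUnit_one_add_vertexOp {lam : ℂ} (hlam : |lam.arg| < Real.pi) {I : Finset ℕ}
    {t : ℕ → ℝ} (ht : t ∈ paramCube) (x : Coord Λ) : IsUnit (1 + vertexOp lam I t x) := by
  simpa using isUnit_one_add_smul_vertexOp hlam (I := I) ht x 1

/-- The resolvents grow at most linearly in the field, and the trace in `log₂` too. -/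
theorem exists_resolvent_bound {lam : ℂ} (hlam : |lam.arg| < Real.pi) (Λ : ℕ) :
    ∃ A : ℝ, 0 ≤ A ∧ ∀ (I : Finset ℕ), ∀ t ∈ paramCube, ∀ (x : Coord Λ) (u : ℝ), |u| ≤ 1 →
      (∀ p q, ‖(1 + (u : ℂ) • vertexOp lam I t x)⁻¹ p q‖ ≤ 1 + A * fieldSize x) ∧
      ‖Matrix.trace (vertexOp lam I t x * ((1 + (u : ℂ) • vertexOp lam I t x)⁻¹ - 1))‖
        ≤ A * fieldSize x := by
  obtain ⟨δ, hδ0, hδ⟩ := exists_coupling_bound hlam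
  obtain ⟨N, hN⟩ : ∃ N : ℝ, N = (Fintype.card (Ix Λ) : ℝ) := ⟨_, rfl⟩
  have hN1 : 1 ≤ N := by
    have : 1 ≤ Fintype.card (Ix Λ) := Fintype.card_pos
    rw [hN]
    exact_mod_cast this
  have hδi : 0 < δ⁻¹ := inv_pos.2 hδ0
  have ha := norm_nonneg (coupling lam)
  have hsum : ∀ (f : Ix Λ → ℂ) (b : ℝ), (∀ p, ‖f p‖ ≤ b) → ‖∑ p, f p‖ ≤ N * b := by
    intro f b hf
    refine (norm_sum_le_of_le _ fun p _ => hf p).trans ?_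
    simp [hN]
  refine ⟨‖coupling lam‖ * (N * (N * (4 * δ⁻¹)) + N * 4), by positivity, ?_⟩
  intro I t ht x u hu
  have hx := fieldSize_nonneg x
  have hX := one_add_smul_vertexOp (Λ := Λ) lam (I := I) ht x u
  have hδu := mul_coupling_bound hδ u
  obtain ⟨a, ha'⟩ : ∃ a, a = u * coupling lam := ⟨_, rfl⟩
  rw [← ha'] at hX hδu
  have hau : ‖a‖ ≤ ‖coupling lam‖ := by
    rw [ha', norm_mul, Complex.norm_real, Real.norm_eq_abs]
    exact mul_le_of_le_one_left ha hu
  obtain ⟨F, hF⟩ : ∃ F, F = sigmaHat x := ⟨_, rfl⟩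
  obtain ⟨D, hD⟩ : ∃ D, D = sqrtProp Λ I t := ⟨_, rfl⟩
  have hHerm := sqrtProp_mul_mul_isHermitian I t (sigmaHat_isHermitian x)
  rw [← hD, ← hF] at hHerm hX
  have hu1 : IsUnit (1 + a • (D * F * D)) := isUnit_one_add_smul_hermitian hδ0 hδu hHerm
  have hinv := one_add_mul_resolvent a D F hu1
  have hYb := norm_inv_one_add_smul_hermitian_le hδ0 hδu hHerm
  obtain ⟨Z, hZd⟩ : ∃ Z, Z = (1 + (u : ℂ) • vertexOp lam I t x)⁻¹ := ⟨_, rfl⟩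
  have hZ : Z = 1 - a • (D * (1 + a • (D * F * D))⁻¹ * (D * F)) := by
    rw [hZd, hX]
    exact Matrix.inv_eq_right_inv hinv
  have htr := trace_mul_resolvent a D F Z hu1 (by rw [hZ]; exact hinv)
  rw [← hZd]
  obtain ⟨Y, hY⟩ : ∃ Y, Y = (1 + a • (D * F * D))⁻¹ := ⟨_, rfl⟩
  rw [← hY] at hYb hZ htr
  have hDb : ∀ p : Ix Λ, ‖((Real.sqrt (propCoeff I t p) : ℝ) : ℂ)‖ ≤ 1 := by
    intro p
    rw [Complex.norm_real, Real.norm_of_nonneg (Real.sqrt_nonneg _)]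
    exact Real.sqrt_le_one.2 (propCoeff_le ht p)
  have hFb : ∀ p q, ‖F p q‖ ≤ 4 * fieldSize x := by
    rw [hF]; exact norm_sigmaHat_le x
  constructor
  · intro p q
    rw [hZ, Matrix.sub_apply, Matrix.smul_apply]
    have h1 : ‖(1 : Op Λ) p q‖ ≤ 1 := by
      rw [Matrix.one_apply]
      split_ifs <;> simp
    have h2 : ‖(D * Y * (D * F)) p q‖ ≤ N * (δ⁻¹ * (4 * fieldSize x)) := by
      rw [Matrix.mul_apply]
      refine hsum _ _ fun r => ?_
      rw [hD, sqrtProp, Matrix.diagonal_mul, Matrix.diagonal_mul, norm_mul, norm_mul, norm_mul]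
      have e1 : ‖((Real.sqrt (propCoeff I t p) : ℝ) : ℂ)‖ * ‖Y p r‖ ≤ δ⁻¹ :=
        (mul_le_of_le_one_left (norm_nonneg _) (hDb p)).trans (hYb p r)
      have e2 : ‖((Real.sqrt (propCoeff I t r) : ℝ) : ℂ)‖ * ‖F r q‖ ≤ 4 * fieldSize x :=
        (mul_le_of_le_one_left (norm_nonneg _) (hDb r)).trans (hFb r q)
      exact mul_le_mul e1 e2 (by positivity) hδi.le
    refine (norm_sub_le _ _).trans (add_le_add h1 ?_)
    rw [norm_smul, mul_assoc ‖coupling lam‖]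
    refine (mul_le_mul hau h2 (norm_nonneg _) ha).trans (mul_le_mul_of_nonneg_left ?_ ha)
    have h3 : N * (δ⁻¹ * (4 * fieldSize x)) ≤ N * (N * (4 * δ⁻¹)) * fieldSize x := by
      have h4 : 0 ≤ N * (δ⁻¹ * (4 * fieldSize x)) := by positivity
      nlinarith
    have h5 : 0 ≤ N * 4 * fieldSize x := by positivity
    linarith
  · rw [vertexOp_eq lam ht, ← hD, ← hF, mul_sub, mul_one, Matrix.smul_mul, ← smul_sub,
      Matrix.trace_smul, Matrix.trace_sub, htr, norm_smul, mul_assoc ‖coupling lam‖]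
    refine mul_le_mul_of_nonneg_left ((norm_sub_le _ _).trans ?_) ha
    rw [add_mul]
    refine add_le_add ?_ ?_
    · rw [Matrix.trace, mul_assoc N, mul_assoc N (4 * δ⁻¹)]
      refine hsum _ _ fun p => ?_
      rw [Matrix.diag_apply, Matrix.mul_apply]
      refine hsum _ _ fun q => ?_
      rw [hD, sqrtProp, Matrix.mul_diagonal, Matrix.diagonal_mul, norm_mul, norm_mul, norm_mul]
      have e1 : ‖((Real.sqrt (propCoeff I t p) : ℝ) : ℂ)‖ * ‖F p q‖
          * ‖((Real.sqrt (propCoeff I t q) : ℝ) : ℂ)‖ ≤ 4 * fieldSize x :=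
        (mul_le_of_le_one_right (by positivity) (hDb q)).trans
          ((mul_le_of_le_one_left (norm_nonneg _) (hDb p)).trans (hFb p q))
      calc _ ≤ 4 * fieldSize x * δ⁻¹ := mul_le_mul e1 (hYb q p) (norm_nonneg _) (by positivity)
        _ = 4 * δ⁻¹ * fieldSize x := by ring
    · rw [Matrix.trace, mul_assoc N]
      refine hsum _ _ fun p => ?_
      rw [Matrix.diag_apply, hD, sqrtProp, mul_assoc, Matrix.diagonal_mul, Matrix.diagonal_mul,
        norm_mul, norm_mul]
      exact (mul_le_of_le_one_left (by positivity) (hDb p)).trans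
        ((mul_le_of_le_one_left (norm_nonneg _) (hDb p)).trans (hFb p p))

end Resolvent

/-! ### Continuity and derivatives of the resolvents and of the interaction -/

section MatrixCalculus

open Filter Topology

variable {n : Type} [Fintype n] [DecidableEq n]

theorem continuousOn_matrix_inv {T : Type} [TopologicalSpace T] {A : T → Matrix n n ℂ} {s : Set T}
    (hA : ContinuousOn A s) (hu : ∀ x ∈ s, IsUnit (A x)) :
    ContinuousOn (fun x => (A x)⁻¹) s := by
  rw [continuousOn_iff_continuous_domRestrict] at hA ⊢
  have h1 : Continuous fun x : s => (A x).det := Continuous.matrix_det hA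
  have h2 : Continuous fun x : s => (A x).adjugate := Continuous.matrix_adjugate hA
  have h3 : ∀ x : s, (A x).det ≠ 0 := fun x =>
    ((Matrix.isUnit_iff_isUnit_det _).1 (hu x x.2)).ne_zero
  have h4 : (s.domRestrict fun x => (A x)⁻¹) = fun x : s => (A x).det⁻¹ • (A x).adjugate := by
    funext x
    simp [Matrix.inv_def, Set.domRestrict_apply]
  rw [h4]
  exact (h1.inv₀ h3).smul h2

theorem trace_mul_mul_mul_comm {m : Type} [Fintype m] (X Y Z : Matrix m m ℂ) :
    Matrix.trace (X * (Z * Y * Z)) = Matrix.trace (Y * (Z * X * Z)) := by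
  rw [mul_assoc Z Y, ← mul_assoc X, Matrix.trace_mul_comm, mul_assoc Y, mul_assoc Z X]

attribute [local instance] Matrix.linftyOpNormedRing Matrix.linftyOpNormedAlgebra

theorem HasDerivAt.linearMap_comp {M : ℝ → Matrix n n ℂ} {M' : Matrix n n ℂ} {s : ℝ}
    (hM : HasDerivAt M M' s) (L : Matrix n n ℂ →ₗ[ℂ] ℂ) :
    HasDerivAt (fun s => L (M s)) (L M') s :=
  (LinearMap.toContinuousLinearMap (L.restrictScalars ℝ)).hasFDerivAt.comp_hasDerivAt s hM

theorem hasDerivAt_affine (X Y : Matrix n n ℂ) (s : ℝ) :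
    HasDerivAt (fun s : ℝ => X + (s : ℂ) • Y) Y s := by
  have h : HasDerivAt (fun s : ℝ => (s : ℂ)) 1 s := Complex.ofRealCLM.hasDerivAt
  exact ((h.smul_const Y).const_add X).congr_deriv (one_smul _ _)

theorem hasDerivAt_matrix_inv {A : ℝ → Matrix n n ℂ} {A' : Matrix n n ℂ} {s : ℝ}
    (hA : HasDerivAt A A' s) (hu : IsUnit (A s)) :
    HasDerivAt (fun s => (A s)⁻¹) (-((A s)⁻¹ * A' * (A s)⁻¹)) s := by
  obtain ⟨v, hv⟩ := hu
  have h1 := hasFDerivAt_ringInverse (𝕜 := ℝ) v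
  rw [hv] at h1
  have h3 : (↑v⁻¹ : Matrix n n ℂ) = (A s)⁻¹ := by
    rw [← hv, Matrix.coe_units_inv]
  have h2 : HasDerivAt (fun s => Ring.inverse (A s))
      ((-ContinuousLinearMap.mulLeftRight ℝ (Matrix n n ℂ) ↑v⁻¹ ↑v⁻¹) A') s :=
    h1.comp_hasDerivAt s hA
  simp only [← Matrix.nonsing_inv_eq_ringInverse] at h2
  refine h2.congr_deriv ?_
  rw [h3]
  rfl

/-- Differentiation of a product of traces along the loop vertices. -/
theorem hasDerivAt_loopTrace {K : Type} [Fintype K] [DecidableEq K] (τ : Equiv.Perm K)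
    {M : ℝ → K → Matrix n n ℂ} {M' : K → Matrix n n ℂ} {s : ℝ}
    (hM : ∀ h, HasDerivAt (fun s => M s h) (M' h) s) :
    HasDerivAt (fun s => loopTrace τ (M s)) (∑ h, loopForm τ (M s) h (M' h)) s := by
  have h1 : ∀ h p q, HasDerivAt (fun s => M s h p q) (M' h p q) s := fun h p q =>
    HasDerivAt.linearMap_comp (hM h) (Matrix.entryLinearMap ℂ ℂ p q)
  unfold loopTrace
  have h2 : HasDerivAt (fun s => ∑ i : K → n, ∏ h, M s h (i h) (i (τ h)))
      (∑ i : K → n, ∑ h, (∏ k ∈ Finset.univ.erase h, M s k (i k) (i (τ k)))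
        • M' h (i h) (i (τ h))) s :=
    HasDerivAt.fun_sum fun i _ => HasDerivAt.fun_finsetProd fun h _ => h1 h _ _
  convert h2 using 1
  rw [Finset.sum_comm]
  refine Finset.sum_congr rfl fun h _ => ?_
  simp only [loopForm, LinearMap.coe_mk, AddHom.coe_mk, smul_eq_mul]
  exact Finset.sum_congr rfl fun i _ => mul_comm _ _

/-- The derivative of `Tr log₂ (1 + X)` in the direction `Y` is `Tr [Y ((1 + X)⁻¹ - 1)]`. -/
theorem hasDerivAt_trLogTwo {Λ : ℕ} (X Y : Op Λ) (s₀ : ℝ)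
    (hu : ∀ᶠ s : ℝ in 𝓝 s₀, ∀ u ∈ Set.Icc (0 : ℝ) 1, IsUnit (1 + (u : ℂ) • (X + (s : ℂ) • Y))) :
    HasDerivAt (fun s : ℝ => trLogTwo (X + (s : ℂ) • Y))
      (Matrix.trace (Y * ((1 + (X + (s₀ : ℂ) • Y))⁻¹ - 1))) s₀ := by
  obtain ⟨ε, hε, hball⟩ := Metric.eventually_nhds_iff_ball.1 hu
  set Z : ℝ → ℝ → Op Λ := fun s u => (1 + (u : ℂ) • (X + (s : ℂ) • Y))⁻¹ with hZ
  set F : ℝ → ℝ → ℂ := fun s u => Matrix.trace ((X + (s : ℂ) • Y) * (Z s u - 1)) with hF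
  set F' : ℝ → ℝ → ℂ := fun s u => Matrix.trace (Y * (Z s u - 1))
    - u * Matrix.trace ((X + (s : ℂ) • Y) * (Z s u * Y * Z s u)) with hF'
  set B : Set (ℝ × ℝ) := Metric.closedBall s₀ (ε / 2) ×ˢ Set.Icc (0 : ℝ) 1 with hB
  have hball' : ∀ s ∈ Metric.closedBall s₀ (ε / 2), ∀ u ∈ Set.Icc (0 : ℝ) 1,
      IsUnit (1 + (u : ℂ) • (X + (s : ℂ) • Y)) := fun s hs =>
    hball s (Metric.closedBall_subset_ball (by linarith) hs)
  have hZc : ContinuousOn (fun p : ℝ × ℝ => Z p.1 p.2) B := by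
    refine continuousOn_matrix_inv (Continuous.continuousOn ?_) fun p hp => hball' _ hp.1 _ hp.2
    fun_prop
  have htrace : ∀ {M : ℝ × ℝ → Op Λ}, ContinuousOn M B →
      ContinuousOn (fun p => Matrix.trace (M p)) B := fun hM =>
    (Continuous.matrix_trace continuous_id).comp_continuousOn hM
  have hXc : ContinuousOn (fun p : ℝ × ℝ => X + (p.1 : ℂ) • Y) B :=
    Continuous.continuousOn (by fun_prop)
  have hFc : ContinuousOn (fun p : ℝ × ℝ => F p.1 p.2) B :=
    htrace (hXc.mul (hZc.sub continuousOn_const))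
  have hF'c : ContinuousOn (fun p : ℝ × ℝ => F' p.1 p.2) B := by
    refine (htrace (continuousOn_const.mul (hZc.sub continuousOn_const))).sub
      (ContinuousOn.mul (Continuous.continuousOn (by fun_prop))
        (htrace (hXc.mul ((hZc.mul continuousOn_const).mul hZc))))
  have hBc : IsCompact B := (isCompact_closedBall s₀ _).prod isCompact_Icc
  obtain ⟨b, hb⟩ := hBc.exists_bound_of_continuousOn hF'c
  have hsec : ∀ {f : ℝ → ℝ → ℂ}, ContinuousOn (fun p : ℝ × ℝ => f p.1 p.2) B →
      ∀ s ∈ Metric.closedBall s₀ (ε / 2), ContinuousOn (f s) (Set.uIcc 0 1) := by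
    intro f hf s hs
    rw [Set.uIcc_of_le zero_le_one]
    exact hf.comp (f := fun u : ℝ => (s, u)) (by fun_prop) fun u hu => ⟨hs, hu⟩
  have hs₀ : s₀ ∈ Metric.closedBall s₀ (ε / 2) := Metric.mem_closedBall_self (by linarith)
  have hderX : ∀ s, HasDerivAt (fun s : ℝ => X + (s : ℂ) • Y) Y s := hasDerivAt_affine X Y
  have hmem : ∀ u ∈ Set.uIoc (0 : ℝ) 1, u ∈ Set.Icc (0 : ℝ) 1 := by
    intro u hu
    rw [Set.uIoc_of_le zero_le_one] at hu
    exact ⟨hu.1.le, hu.2⟩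
  have hdiff : ∀ u ∈ Set.Icc (0 : ℝ) 1, ∀ s ∈ Metric.closedBall s₀ (ε / 2),
      HasDerivAt (fun s => F s u) (F' s u) s := by
    intro u hu s hs
    have h1 : HasDerivAt (fun s : ℝ => 1 + (u : ℂ) • (X + (s : ℂ) • Y)) ((u : ℂ) • Y) s :=
      ((hderX s).const_smul (u : ℂ)).const_add 1
    have h2 := hasDerivAt_matrix_inv h1 (hball' s hs u hu)
    have h3 := HasDerivAt.linearMap_comp ((hderX s).mul (h2.sub_const 1))
      (Matrix.traceLinearMap (Ix Λ) ℂ ℂ)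
    refine h3.congr_deriv ?_
    simp only [hF', hZ, Matrix.traceLinearMap_apply, Matrix.trace_add, mul_neg, Matrix.trace_neg,
      Matrix.mul_smul, Matrix.smul_mul, Matrix.trace_smul, smul_eq_mul]
    ring
  have key := intervalIntegral.hasDerivAt_integral_of_dominated_loc_of_deriv_le
    (μ := MeasureTheory.volume) (a := 0) (b := 1) (F := F) (F' := F') (x₀ := s₀)
    (s := Metric.closedBall s₀ (ε / 2)) (bound := fun _ => b)
    (Metric.closedBall_mem_nhds s₀ (by linarith))
    (by
      filter_upwards [Metric.closedBall_mem_nhds s₀ (by linarith : 0 < ε / 2)] with s hs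
      exact ((hsec hFc s hs).intervalIntegrable).def'.aestronglyMeasurable)
    ((hsec hFc s₀ hs₀).intervalIntegrable)
    ((hsec hF'c s₀ hs₀).intervalIntegrable).def'.aestronglyMeasurable
    (Eventually.of_forall fun u hu s hs => hb (s, u) ⟨hs, hmem u hu⟩)
    intervalIntegrable_const
    (Eventually.of_forall fun u hu s hs => hdiff u (hmem u hu) s hs)
  have hval : ∫ u in (0 : ℝ)..1, F' s₀ u
      = Matrix.trace (Y * ((1 + (X + (s₀ : ℂ) • Y))⁻¹ - 1)) := by
    -- The integrand is the derivative in `u` of `u Tr [Y ((1 + u X)⁻¹ - 1)]`.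
    have hprim : ∀ u ∈ Set.uIcc (0 : ℝ) 1, HasDerivAt
        (fun u : ℝ => (u : ℂ) * Matrix.trace (Y * (Z s₀ u - 1))) (F' s₀ u) u := by
      intro u hu
      rw [Set.uIcc_of_le zero_le_one] at hu
      have h2 := hasDerivAt_matrix_inv (hasDerivAt_affine 1 (X + (s₀ : ℂ) • Y) u)
        (hball' s₀ hs₀ u hu)
      have h3 := HasDerivAt.linearMap_comp ((h2.sub_const 1).const_mul Y)
        (Matrix.traceLinearMap (Ix Λ) ℂ ℂ)
      have h4 : HasDerivAt (fun s : ℝ => (s : ℂ)) 1 u := Complex.ofRealCLM.hasDerivAt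
      refine (h4.mul h3).congr_deriv ?_
      simp only [hF', hZ, Matrix.traceLinearMap_apply, mul_neg, Matrix.trace_neg, one_mul]
      rw [trace_mul_mul_mul_comm]
      ring
    rw [intervalIntegral.integral_eq_sub_of_hasDerivAt hprim (hsec hF'c s₀ hs₀).intervalIntegrable]
    simp [hZ]
  rw [← hval]
  exact key.2

end MatrixCalculus

/-! ### Derivatives of resolvent amplitudes in the field and in the parameters -/

/-- The terms of the interaction which are polynomial in the field. -/
def counterTerm {Λ : ℕ} (lam : ℂ) (I : Finset ℕ) (t : ℕ → ℝ) (x : Coord Λ) : ℂ :=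
  coupling lam * ∑ m, tadpole I t m * sigma x m m + lam / 2 * ∑ m : Fin (Λ + 1), tadpole I t m ^ 2

theorem interaction_eq {Λ : ℕ} (lam : ℂ) (I : Finset ℕ) (t : ℕ → ℝ) (x : Coord Λ) :
    interaction lam I t x
      = -(1 / 2) * trLogTwo (vertexOp lam I t x) + counterTerm lam I t x := by
  unfold interaction counterTerm coupling
  ring

/-- The exponential of the interaction, times a product of traces of resolvent propagators along
loop vertices. -/
def expTrace {Λ : ℕ} {K : Type} [Fintype K] [DecidableEq K] (lam : ℂ) (I : Finset ℕ) (t : ℕ → ℝ)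
    (x : Coord Λ) (τ : Equiv.Perm K) (ε : K → ℂ) (Q : K → Op Λ) : ℂ :=
  Complex.exp (interaction lam I t x) * loopTrace τ (dressed (resolvent lam I t x) ε Q)

section Derivatives

open Filter Topology

variable {K : Type} [Fintype K] [DecidableEq K] {Λ : ℕ}

attribute [local instance] Matrix.linftyOpNormedRing Matrix.linftyOpNormedAlgebra

/-- A derivation acting on `exp V` times a product of traces of resolvent propagators inserts a
half-edge in all possible ways. -/
theorem hasDerivAt_exp_mul_loopTrace (a : ℂ) (X Y : Op Λ) (s₀ : ℝ)
    (hu : ∀ᶠ s : ℝ in 𝓝 s₀, ∀ u ∈ Set.Icc (0 : ℝ) 1,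
      IsUnit (1 + (u : ℂ) • (X + (s : ℂ) • (a • Y))))
    {P : ℝ → ℂ} {P' : ℂ} (hP : HasDerivAt P P' s₀) (τ : Equiv.Perm K) (ε : K → ℂ)
    {Q : ℝ → K → Op Λ} {Q' : K → Op Λ} (hQ : ∀ h, HasDerivAt (fun s => Q s h) (Q' h) s₀)
    {V : ℝ → ℂ} (hV : ∀ s, V s = -(1 / 2) * trLogTwo (X + (s : ℂ) • (a • Y)) + P s)
    {R : ℝ → Op Λ} (hR : ∀ s, R s = (1 + (X + (s : ℂ) • (a • Y)))⁻¹) :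
    HasDerivAt (fun s : ℝ => Complex.exp (V s) * loopTrace τ (dressed (R s) ε (Q s)))
      (Complex.exp (V s₀) * (P' * loopTrace τ (dressed (R s₀) ε (Q s₀))
        + insertSum a (R s₀) τ ε (Q s₀) Y
        + ∑ h, loopForm τ (dressed (R s₀) ε (Q s₀)) h ((R s₀ - ε h • 1) * Q' h))) s₀ := by
  obtain rfl : V = fun s : ℝ => -(1 / 2) * trLogTwo (X + (s : ℂ) • (a • Y)) + P s := funext hV
  obtain rfl : R = fun s : ℝ => (1 + (X + (s : ℂ) • (a • Y)))⁻¹ := funext hR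
  have hu1 : IsUnit (1 + (X + (s₀ : ℂ) • (a • Y))) := by
    simpa using hu.self_of_nhds 1 (by simp)
  have h1 := ((hasDerivAt_trLogTwo X (a • Y) s₀ hu).const_mul (-(1 / 2) : ℂ)).add hP
  have h2 := hasDerivAt_matrix_inv ((hasDerivAt_affine X (a • Y) s₀).const_add 1) hu1
  have h3 : ∀ h, HasDerivAt (fun s : ℝ => dressed (1 + (X + (s : ℂ) • (a • Y)))⁻¹ ε (Q s) h) _ s₀ :=
    fun h => (h2.sub_const (ε h • 1)).mul (hQ h)
  have h4 := h1.cexp.mul (hasDerivAt_loopTrace τ h3)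
  refine h4.congr_deriv ?_
  beta_reduce
  generalize (1 + (X + (s₀ : ℂ) • (a • Y)))⁻¹ = Z
  generalize Complex.exp _ = E
  simp only [map_add, Finset.sum_add_distrib, insertSum_eq, neg_mul, map_neg, Matrix.mul_smul,
    Matrix.smul_mul, map_smul, Matrix.trace_smul, smul_eq_mul, mul_assoc]
  rw [Matrix.trace_mul_comm Y, Finset.sum_neg_distrib]
  ring

variable {lam : ℂ} {I : Finset ℕ} {t : ℕ → ℝ}

theorem update_eq_add_smul (x : Coord Λ) (p : Ix Λ) (y : ℝ) :
    Function.update x p y = Function.update x p 0 + y • coordVec p := by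
  funext q
  by_cases h : q = p
  · subst h; simp [coordVec]
  · simp [coordVec, h]

theorem hasDerivAt_expTrace_coord (hlam : |lam.arg| < Real.pi) (ht : t ∈ paramCube)
    (τ : Equiv.Perm K) (ε : K → ℂ) (Q : K → Op Λ) (x : Coord Λ) (p : Ix Λ) :
    HasDerivAt (fun y : ℝ => expTrace lam I t (Function.update x p y) τ ε Q)
      (Complex.exp (interaction lam I t x) *
        (coupling lam * (∑ m, tadpole I t m * sigma (coordVec p) m m) *
            loopTrace τ (dressed (resolvent lam I t x) ε Q)
          + insertSum (coupling lam) (resolvent lam I t x) τ ε Q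
              (prop Λ I t * sigmaHat (coordVec p)))) (x p) := by
  have hX : ∀ y : ℝ, vertexOp lam I t (Function.update x p y)
      = vertexOp lam I t (Function.update x p 0)
        + (y : ℂ) • (coupling lam • (prop Λ I t * sigmaHat (coordVec p))) := by
    intro y
    rw [update_eq_add_smul x p y, vertexOp, sigmaHat_add, sigmaHat_smul, mul_add, smul_add,
      Matrix.mul_smul, smul_comm]
    rfl
  have hP : HasDerivAt (fun y : ℝ => counterTerm lam I t (Function.update x p y))
      (coupling lam * ∑ m, tadpole I t m * sigma (coordVec p) m m) (x p) := by
    have e : (fun y : ℝ => counterTerm lam I t (Function.update x p y)) = fun y : ℝ =>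
        counterTerm lam I t (Function.update x p 0)
          + (y : ℂ) * (coupling lam * ∑ m, tadpole I t m * sigma (coordVec p) m m) := by
      funext y
      rw [counterTerm, counterTerm, update_eq_add_smul x p y, sigma_add, sigma_smul]
      simp only [Matrix.add_apply, Matrix.smul_apply, smul_eq_mul, mul_add, Finset.sum_add_distrib,
        Finset.mul_sum]
      rw [add_right_comm]
      refine congrArg₂ (· + ·) rfl (Finset.sum_congr rfl fun m _ => by ring)
    rw [e]
    have h : HasDerivAt (fun s : ℝ => (s : ℂ)) 1 (x p) := Complex.ofRealCLM.hasDerivAt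
    exact ((h.mul_const _).const_add _).congr_deriv (one_mul _)
  have key := hasDerivAt_exp_mul_loopTrace (coupling lam) _ _ (x p)
    (Eventually.of_forall fun s u _ => by
      rw [← hX]; exact isUnit_one_add_smul_vertexOp hlam ht _ u) hP τ ε
    (Q := fun _ => Q) (Q' := fun _ => 0) (fun h => hasDerivAt_const _ _)
    (V := fun y => interaction lam I t (Function.update x p y))
    (fun s => by rw [← hX, interaction_eq])
    (R := fun y => resolvent lam I t (Function.update x p y)) (fun s => by rw [← hX]; rfl)
  refine key.congr_deriv ?_
  simp only [Function.update_eq_self, mul_zero, map_zero, Finset.sum_const_zero, add_zero]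

theorem prop_update {ω : ℕ} (hω : ω ∈ I) (t : ℕ → ℝ) (s : ℝ) :
    prop Λ I (Function.update t ω s)
      = prop Λ I (Function.update t ω 0) + (s : ℂ) • sliceProp Λ ω := by
  unfold prop
  rw [← Finset.add_sum_erase _ _ hω, ← Finset.add_sum_erase _ (fun _ => _ • _) hω]
  simp only [Function.update_self, Complex.ofReal_zero, zero_smul, zero_add]
  rw [add_comm]
  congr 1
  refine Finset.sum_congr rfl fun ω' h => ?_
  simp [Function.update_of_ne (Finset.ne_of_mem_erase h)]

theorem tadpole_update {ω : ℕ} (hω : ω ∈ I) (t : ℕ → ℝ) (s : ℝ) (m : Fin (Λ + 1)) :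
    tadpole I (Function.update t ω s) m
      = tadpole I (Function.update t ω 0) m + (s : ℂ) * sliceTadpole ω m := by
  unfold tadpole
  rw [← Finset.add_sum_erase _ _ hω, ← Finset.add_sum_erase _ (fun _ => _ * _) hω]
  simp only [Function.update_self, Complex.ofReal_zero, zero_mul, zero_add]
  rw [add_comm]
  congr 1
  refine Finset.sum_congr rfl fun ω' h => ?_
  simp [Function.update_of_ne (Finset.ne_of_mem_erase h)]

theorem update_mem_paramCube (ht : t ∈ paramCube) (ω : ℕ) {s : ℝ} (hs : s ∈ Set.Icc (0 : ℝ) 1) :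
    Function.update t ω s ∈ paramCube := by
  intro ω'
  by_cases h : ω' = ω
  · subst h; simpa using hs
  · simpa [h] using ht ω'

open Classical in
/-- The derivative of the bare propagators with respect to `t^ω`: it marks the unmarked ones. -/
def slicedBareProp {H : Type} (G : ResolventGraph H) (ω : ℕ) (k : H → Ix Λ) (h : H) : Op Λ :=
  if G.mark h = none then sliceProp Λ ω * unitField (G.side h) (k h) else 0

theorem hasDerivAt_expTrace_param (hlam : |lam.arg| < Real.pi) (ht : t ∈ paramCube) {ω : ℕ}
    (hω : ω ∈ I) (htω : t ω ∈ Set.Ioo (0 : ℝ) 1) (G : ResolventGraph K) (k : K → Ix Λ)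
    (x : Coord Λ) :
    HasDerivAt (fun s : ℝ => expTrace lam I (Function.update t ω s) x G.next G.tadpoleIndicator
        (G.bareProp I (Function.update t ω s) k))
      (Complex.exp (interaction lam I t x) *
        ((coupling lam * (∑ m, sliceTadpole ω m * sigma x m m)
            + lam * ∑ m : Fin (Λ + 1), tadpole I t m * sliceTadpole ω m) *
            loopTrace G.next (dressed (resolvent lam I t x) G.tadpoleIndicator (G.bareProp I t k))
          + insertSum (coupling lam) (resolvent lam I t x) G.next G.tadpoleIndicator
              (G.bareProp I t k) (sliceProp Λ ω * sigmaHat x)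
          + ∑ h, loopForm G.next
              (dressed (resolvent lam I t x) G.tadpoleIndicator (G.bareProp I t k)) h
              ((resolvent lam I t x - G.tadpoleIndicator h • 1) * slicedBareProp G ω k h)))
      (t ω) := by
  have hX : ∀ s : ℝ, vertexOp lam I (Function.update t ω s) x
      = vertexOp lam I (Function.update t ω 0) x
        + (s : ℂ) • (coupling lam • (sliceProp Λ ω * sigmaHat x)) := by
    intro s
    rw [vertexOp, prop_update hω t s, add_mul, smul_add, Matrix.smul_mul, smul_comm]
    rfl
  have hofReal : HasDerivAt (fun s : ℝ => (s : ℂ)) 1 (t ω) := Complex.ofRealCLM.hasDerivAt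
  have hT : ∀ m : Fin (Λ + 1), HasDerivAt (fun s : ℝ => tadpole I (Function.update t ω s) m)
      (sliceTadpole ω m) (t ω) := by
    intro m
    rw [show (fun s : ℝ => tadpole I (Function.update t ω s) m) = fun s : ℝ =>
      tadpole I (Function.update t ω 0) m + (s : ℂ) * sliceTadpole ω m from
      funext fun s => tadpole_update hω t s m]
    exact ((hofReal.mul_const _).const_add _).congr_deriv (one_mul _)
  have hP : HasDerivAt (fun s : ℝ => counterTerm lam I (Function.update t ω s) x)
      (coupling lam * (∑ m, sliceTadpole ω m * sigma x m m)
            + lam * ∑ m : Fin (Λ + 1), tadpole I t m * sliceTadpole ω m) (t ω) := by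
    have h1 := (HasDerivAt.fun_sum fun m (_ : m ∈ Finset.univ) =>
      (hT m).mul_const (sigma x m m)).const_mul (coupling lam)
    have h2 := (HasDerivAt.fun_sum fun m (_ : m ∈ Finset.univ) => (hT m).pow 2).const_mul (lam / 2)
    refine (h1.add h2).congr_deriv ?_
    congr 1
    rw [Finset.mul_sum, Finset.mul_sum]
    refine Finset.sum_congr rfl fun m _ => ?_
    simp only [Function.update_eq_self]
    norm_num
    ring
  have hQ : ∀ h, HasDerivAt (fun s : ℝ => G.bareProp I (Function.update t ω s) k h)
      (slicedBareProp G ω k h) (t ω) := by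
    intro h
    unfold ResolventGraph.bareProp slicedBareProp ResolventGraph.cprop
    cases hm : G.mark h with
    | none =>
      simp only [if_true]
      refine HasDerivAt.mul_const ?_ _
      rw [show (fun s : ℝ => prop Λ I (Function.update t ω s)) = fun s : ℝ =>
        prop Λ I (Function.update t ω 0) + (s : ℂ) • sliceProp Λ ω from
        funext fun s => prop_update hω t s]
      exact hasDerivAt_affine _ _ _
    | some ω' =>
      simp only [reduceCtorEq, if_false]
      exact hasDerivAt_const _ _
  have key := hasDerivAt_exp_mul_loopTrace (coupling lam) _ _ (t ω)
    (by
      filter_upwards [Icc_mem_nhds htω.1 htω.2] with s hs u _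
      rw [← hX]
      exact isUnit_one_add_smul_vertexOp hlam (update_mem_paramCube ht ω hs) _ u) hP
    G.next G.tadpoleIndicator hQ
    (V := fun s => interaction lam I (Function.update t ω s) x)
    (fun s => by rw [← hX, interaction_eq])
    (R := fun s => resolvent lam I (Function.update t ω s) x) (fun s => by rw [← hX]; rfl)
  refine key.congr_deriv ?_
  simp only [Function.update_eq_self]

end Derivatives

/-! ### Functions of controlled growth -/

section Tame

open MeasureTheory ProbabilityTheory

variable {Λ : ℕ}

/-- Functions of the interpolation parameters and of the field which are continuous, and which
grow at most exponentially with the field, uniformly in the parameters. They are integrable for the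
Gaussian measure. -/
def Tame (F : (ℕ → ℝ) → Coord Λ → ℂ) : Prop :=
  ContinuousOn (fun q : (ℕ → ℝ) × Coord Λ => F q.1 q.2) (paramCube ×ˢ Set.univ) ∧
    ∃ A : ℝ, 0 ≤ A ∧ ∀ t ∈ paramCube, ∀ x, ‖F t x‖ ≤ A * Real.exp (A * fieldSize x)

theorem Tame.const (c : ℂ) : Tame fun _ (_ : Coord Λ) => c :=
  ⟨continuousOn_const, ‖c‖, norm_nonneg c, fun _ _ x =>
    le_mul_of_one_le_right (norm_nonneg c)
      (Real.one_le_exp (mul_nonneg (norm_nonneg c) (fieldSize_nonneg x)))⟩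

theorem tame_of_linear_bound {F : (ℕ → ℝ) → Coord Λ → ℂ}
    (hF : ContinuousOn (fun q : (ℕ → ℝ) × Coord Λ => F q.1 q.2) (paramCube ×ˢ Set.univ))
    {A : ℝ} (hA : 0 ≤ A) (h : ∀ t ∈ paramCube, ∀ x, ‖F t x‖ ≤ A * (1 + fieldSize x)) : Tame F := by
  refine ⟨hF, A + 1, by linarith, fun t ht x => (h t ht x).trans ?_⟩
  have h0 := fieldSize_nonneg x
  have h1 : 1 + fieldSize x ≤ Real.exp ((A + 1) * fieldSize x) := by
    have h2 := Real.add_one_le_exp ((A + 1) * fieldSize x)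
    have h3 : 0 ≤ A * fieldSize x := mul_nonneg hA h0
    linarith
  exact mul_le_mul (by linarith) h1 (by linarith) (by linarith)

theorem Tame.add {F G : (ℕ → ℝ) → Coord Λ → ℂ} (hF : Tame F) (hG : Tame G) :
    Tame fun t x => F t x + G t x := by
  obtain ⟨hF, A, hA, hFA⟩ := hF
  obtain ⟨hG, B, hB, hGB⟩ := hG
  refine ⟨hF.add hG, A + B, add_nonneg hA hB, fun t ht x => ?_⟩
  have h0 := fieldSize_nonneg x
  have hA' : Real.exp (A * fieldSize x) ≤ Real.exp ((A + B) * fieldSize x) :=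
    Real.exp_le_exp.2 (mul_le_mul_of_nonneg_right (by linarith) h0)
  have hB' : Real.exp (B * fieldSize x) ≤ Real.exp ((A + B) * fieldSize x) :=
    Real.exp_le_exp.2 (mul_le_mul_of_nonneg_right (by linarith) h0)
  calc ‖F t x + G t x‖ ≤ A * Real.exp (A * fieldSize x) + B * Real.exp (B * fieldSize x) :=
        (norm_add_le _ _).trans (add_le_add (hFA t ht x) (hGB t ht x))
    _ ≤ _ := by
        rw [add_mul]
        exact add_le_add (mul_le_mul_of_nonneg_left hA' hA) (mul_le_mul_of_nonneg_left hB' hB)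

theorem Tame.mul {F G : (ℕ → ℝ) → Coord Λ → ℂ} (hF : Tame F) (hG : Tame G) :
    Tame fun t x => F t x * G t x := by
  obtain ⟨hF, A, hA, hFA⟩ := hF
  obtain ⟨hG, B, hB, hGB⟩ := hG
  have hAB := mul_nonneg hA hB
  refine ⟨hF.mul hG, A + B + A * B, by positivity, fun t ht x => ?_⟩
  have h0 := fieldSize_nonneg x
  calc ‖F t x * G t x‖ ≤ (A * Real.exp (A * fieldSize x)) * (B * Real.exp (B * fieldSize x)) := by
        rw [norm_mul]
        exact mul_le_mul (hFA t ht x) (hGB t ht x) (norm_nonneg _) (by positivity)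
    _ = A * B * Real.exp ((A + B) * fieldSize x) := by
        rw [add_mul, Real.exp_add]; ring
    _ ≤ _ := mul_le_mul (by linarith)
        (Real.exp_le_exp.2 (mul_le_mul_of_nonneg_right (by linarith) h0)) (Real.exp_pos _).le
        (by positivity)

theorem Tame.sum {ι : Type*} (s : Finset ι) {F : ι → (ℕ → ℝ) → Coord Λ → ℂ}
    (h : ∀ i ∈ s, Tame (F i)) : Tame fun t x => ∑ i ∈ s, F i t x := by
  classical
  induction s using Finset.induction_on with
  | empty => simpa using Tame.const (Λ := Λ) 0
  | insert a s ha ih =>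
    simp only [Finset.sum_insert ha]
    exact (h a (Finset.mem_insert_self a s)).add
      (ih fun i hi => h i (Finset.mem_insert_of_mem hi))

theorem Tame.prod {ι : Type*} (s : Finset ι) {F : ι → (ℕ → ℝ) → Coord Λ → ℂ}
    (h : ∀ i ∈ s, Tame (F i)) : Tame fun t x => ∏ i ∈ s, F i t x := by
  classical
  induction s using Finset.induction_on with
  | empty => simpa using Tame.const (Λ := Λ) 1
  | insert a s ha ih =>
    simp only [Finset.prod_insert ha]
    exact (h a (Finset.mem_insert_self a s)).mul
      (ih fun i hi => h i (Finset.mem_insert_of_mem hi))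

theorem tame_exp {F : (ℕ → ℝ) → Coord Λ → ℂ}
    (hF : ContinuousOn (fun q : (ℕ → ℝ) × Coord Λ => F q.1 q.2) (paramCube ×ˢ Set.univ))
    {A : ℝ} (hA : 0 ≤ A) (h : ∀ t ∈ paramCube, ∀ x, ‖F t x‖ ≤ A * (1 + fieldSize x)) :
    Tame fun t x => Complex.exp (F t x) := by
  refine ⟨hF.cexp, Real.exp A + A, by positivity, fun t ht x => ?_⟩
  have h0 := fieldSize_nonneg x
  have h1 := Real.exp_pos A
  calc ‖Complex.exp (F t x)‖ ≤ Real.exp (A * (1 + fieldSize x)) := by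
        rw [Complex.norm_exp]
        exact Real.exp_le_exp.2 ((Complex.re_le_norm _).trans (h t ht x))
    _ = Real.exp A * Real.exp (A * fieldSize x) := by
        rw [← Real.exp_add]; ring_nf
    _ ≤ _ := mul_le_mul (by linarith)
        (Real.exp_le_exp.2 (mul_le_mul_of_nonneg_right (by linarith) h0)) (Real.exp_pos _).le
        (by positivity)

theorem integrable_exp_mul_abs_gaussianReal (A : ℝ) :
    Integrable (fun y => Real.exp (A * |y|)) (gaussianReal 0 1) := by
  refine Integrable.mono' ((integrable_exp_mul_gaussianReal A).add
    (integrable_exp_mul_gaussianReal (-A))) (by fun_prop) (Filter.Eventually.of_forall fun y => ?_)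
  rw [Real.norm_of_nonneg (Real.exp_pos _).le]
  have h1 := Real.exp_pos (A * y)
  have h2 := Real.exp_pos (-A * y)
  rcases abs_cases y with ⟨h, _⟩ | ⟨h, _⟩
  · simp only [h, Pi.add_apply]; linarith
  · simp only [h, Pi.add_apply, mul_neg]
    rw [neg_mul] at *
    linarith

instance : IsProbabilityMeasure (nu Λ) := by unfold nu; infer_instance

theorem integrable_exp_fieldSize (A : ℝ) :
    Integrable (fun x : Coord Λ => Real.exp (A * fieldSize x)) (nu Λ) := by
  have h : (fun x : Coord Λ => Real.exp (A * fieldSize x))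
      = fun x => ∏ p, Real.exp (A * |x p|) := by
    funext x
    rw [fieldSize, Finset.mul_sum, Real.exp_sum]
  rw [h]
  exact Integrable.fintype_prod fun _ => integrable_exp_mul_abs_gaussianReal A

theorem Tame.continuous {F : (ℕ → ℝ) → Coord Λ → ℂ} (hF : Tame F) {t : ℕ → ℝ}
    (ht : t ∈ paramCube) : Continuous (F t) :=
  continuousOn_univ.1 (hF.1.comp (f := fun x : Coord Λ => (t, x)) (by fun_prop)
    fun _ _ => ⟨ht, trivial⟩)

theorem Tame.integrable {F : (ℕ → ℝ) → Coord Λ → ℂ} (hF : Tame F) {t : ℕ → ℝ}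
    (ht : t ∈ paramCube) : Integrable (F t) (nu Λ) := by
  have hc := hF.continuous ht
  obtain ⟨_, A, hA, h⟩ := hF
  exact Integrable.mono' ((integrable_exp_fieldSize A).const_mul A) hc.aestronglyMeasurable
    (Filter.Eventually.of_forall (h t ht))

/-- Integrability in the field and in some of the interpolation parameters. -/
theorem Tame.integrable_prod {F : (ℕ → ℝ) → Coord Λ → ℂ} (hF : Tame F) {Ω : Finset ℕ}
    {φ : (Ω → ℝ) → ℕ → ℝ} (hφ : Continuous φ)
    (hφ' : ∀ t, (∀ ω, t ω ∈ Set.Icc (0 : ℝ) 1) → φ t ∈ paramCube) :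
    Integrable (fun p : Coord Λ × (Ω → ℝ) => F (φ p.2) p.1) ((nu Λ).prod (cube Ω)) := by
  obtain ⟨hc, A, hA, h⟩ := hF
  set S : Set (Ω → ℝ) := Set.univ.pi fun _ => Set.Icc (0 : ℝ) 1 with hS
  have hcube : cube Ω = (volume : Measure (Ω → ℝ)).restrict S := by
    rw [volume_pi, hS, Measure.restrict_pi_pi]
    rfl
  have hfin : IsFiniteMeasure (cube Ω) := by
    rw [hcube]
    exact ⟨by rw [Measure.restrict_apply_univ]; exact
      (isCompact_univ_pi fun _ => isCompact_Icc).measure_lt_top⟩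
  have hprod : (nu Λ).prod (cube Ω)
      = ((nu Λ).prod (volume : Measure (Ω → ℝ))).restrict (Set.univ ×ˢ S) := by
    rw [hcube, ← Measure.prod_restrict, Measure.restrict_univ]
  have hSm : MeasurableSet S := MeasurableSet.univ_pi fun _ => measurableSet_Icc
  have hmS : ∀ t ∈ S, φ t ∈ paramCube := fun t ht => hφ' t fun ω => ht ω trivial
  have hmeas : AEStronglyMeasurable (fun p : Coord Λ × (Ω → ℝ) => F (φ p.2) p.1)
      ((nu Λ).prod (cube Ω)) := by
    rw [hprod]
    refine ContinuousOn.aestronglyMeasurable ?_ (MeasurableSet.univ.prod hSm)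
    exact hc.comp (f := fun p : Coord Λ × (Ω → ℝ) => (φ p.2, p.1)) (by fun_prop)
      fun p hp => ⟨hmS _ hp.2, trivial⟩
  refine Integrable.mono' (((integrable_exp_fieldSize A).const_mul A).comp_fst (cube Ω)) hmeas ?_
  rw [hprod]
  exact (ae_restrict_iff' (MeasurableSet.univ.prod hSm)).2
    (Filter.Eventually.of_forall fun p hp => h _ (hmS _ hp.2) _)

/-! ### Integration by parts -/

theorem measurePreserving_update (p : Ix Λ) :
    MeasurePreserving (fun q : ℝ × Coord Λ => Function.update q.2 p q.1)
      ((gaussianReal 0 1).prod (nu Λ)) (nu Λ) := by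
  have hm : Measurable fun q : ℝ × Coord Λ => Function.update q.2 p q.1 :=
    measurable_update'.comp measurable_swap
  refine ⟨hm, ?_⟩
  symm
  refine Measure.pi_eq fun s hs => ?_
  rw [Measure.map_apply hm (MeasurableSet.univ_pi hs)]
  have e : (fun q : ℝ × Coord Λ => Function.update q.2 p q.1) ⁻¹' Set.univ.pi s
      = s p ×ˢ Set.univ.pi (Function.update s p Set.univ) := by
    ext ⟨y, x⟩
    simp only [Set.mem_preimage, Set.mem_pi, Set.mem_univ, true_imp_iff, Set.mem_prod]
    constructor
    · intro h
      refine ⟨by simpa using h p, fun i => ?_⟩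
      by_cases hi : i = p
      · subst hi; simp
      · simpa [hi] using h i
    · rintro ⟨h1, h2⟩ i
      by_cases hi : i = p
      · subst hi; simpa using h1
      · simpa [hi] using h2 i
  rw [e, Measure.prod_prod, nu, Measure.pi_pi, ← Finset.mul_prod_erase _ _ (Finset.mem_univ p),
    ← Finset.mul_prod_erase _ (fun i => gaussianReal 0 1 (s i)) (Finset.mem_univ p)]
  rw [Function.update_self, measure_univ, one_mul]
  congr 1
  refine Finset.prod_congr rfl fun i hi => ?_
  rw [Function.update_of_ne (Finset.ne_of_mem_erase hi)]

/-- Integration by parts for the normal law. -/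
theorem integral_mul_gaussianReal {g g' : ℝ → ℂ} (hg : ∀ y, HasDerivAt g (g' y) y)
    (hi : Integrable g (gaussianReal 0 1)) (hi' : Integrable g' (gaussianReal 0 1))
    (hyi : Integrable (fun y : ℝ => (y : ℂ) * g y) (gaussianReal 0 1)) :
    ∫ y : ℝ, (y : ℂ) * g y ∂gaussianReal 0 1 = ∫ y, g' y ∂gaussianReal 0 1 := by
  have hvol : ∀ {f : ℝ → ℂ}, Integrable f (gaussianReal 0 1) →
      Integrable (fun y => gaussianPDFReal 0 1 y • f y) := by
    intro f hf
    rw [gaussianReal_of_var_ne_zero _ one_ne_zero, integrable_withDensity_iff_integrable_smul'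
      (measurable_gaussianPDF 0 1) (Filter.Eventually.of_forall fun y => by
        simp [gaussianPDF])] at hf
    simpa only [toReal_gaussianPDF] using hf
  have hpdf : ∀ y, HasDerivAt (gaussianPDFReal 0 1) (-y * gaussianPDFReal 0 1 y) y := by
    intro y
    have h1 : HasDerivAt (fun x : ℝ => -(x - 0) ^ 2 / (2 * ((1 : NNReal) : ℝ))) (-y) y := by
      have h := (((hasDerivAt_id y).sub_const 0).pow 2).neg.div_const (2 * ((1 : NNReal) : ℝ))
      refine h.congr_deriv ?_
      simp
      ring
    rw [gaussianPDFReal_def]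
    refine (h1.exp.const_mul _).congr_deriv ?_
    ring
  have key := integral_eq_zero_of_hasDerivAt_of_integrable
    (f := fun y => gaussianPDFReal 0 1 y • g y)
    (f' := fun y => gaussianPDFReal 0 1 y • g' y - gaussianPDFReal 0 1 y • ((y : ℂ) * g y))
    (fun y => ((hpdf y).smul (hg y)).congr_deriv (by
      simp only [Complex.real_smul]; push_cast; ring))
    ((hvol hi').sub (hvol hyi)) (hvol hi)
  rw [integral_sub (hvol hi') (hvol hyi)] at key
  rw [integral_gaussianReal_eq_integral_smul one_ne_zero,
    integral_gaussianReal_eq_integral_smul one_ne_zero]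
  exact (sub_eq_zero.1 key).symm

theorem fieldSize_update_le (x : Coord Λ) (p : Ix Λ) (y : ℝ) :
    fieldSize (Function.update x p y) ≤ fieldSize x + |y| := by
  unfold fieldSize
  rw [← Finset.add_sum_erase _ _ (Finset.mem_univ p),
    ← Finset.add_sum_erase _ (fun q => |x q|) (Finset.mem_univ p), Function.update_self]
  have h : ∑ q ∈ Finset.univ.erase p, |Function.update x p y q|
      = ∑ q ∈ Finset.univ.erase p, |x q| := Finset.sum_congr rfl fun q hq => by
    rw [Function.update_of_ne (Finset.ne_of_mem_erase hq)]
  rw [h]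
  linarith [abs_nonneg (x p)]

theorem integrable_update_of_bound {f : Coord Λ → ℂ} (hf : Continuous f) {A : ℝ} (hA : 0 ≤ A)
    (h : ∀ x, ‖f x‖ ≤ A * Real.exp (A * fieldSize x)) (x : Coord Λ) (p : Ix Λ) :
    Integrable (fun y : ℝ => f (Function.update x p y)) (gaussianReal 0 1) := by
  refine Integrable.mono' ((integrable_exp_mul_abs_gaussianReal A).const_mul
    (A * Real.exp (A * fieldSize x))) ?_ (Filter.Eventually.of_forall fun y => (h _).trans ?_)
  · exact (hf.comp (continuous_const.update p continuous_id)).aestronglyMeasurable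
  · rw [mul_assoc, ← Real.exp_add, ← mul_add]
    exact mul_le_mul_of_nonneg_left (Real.exp_le_exp.2
      (mul_le_mul_of_nonneg_left (fieldSize_update_le x p y) hA)) hA

theorem tame_coord (p : Ix Λ) : Tame fun _ (x : Coord Λ) => (x p : ℂ) := by
  refine tame_of_linear_bound (Continuous.continuousOn (by fun_prop)) zero_le_one fun t _ x => ?_
  rw [one_mul, Complex.norm_real]
  exact (abs_le_fieldSize x p).trans (by linarith)

/-- Integration by parts with respect to one coordinate of the field. -/
theorem integral_coord_mul {F F' : (ℕ → ℝ) → Coord Λ → ℂ} (hF : Tame F) (hF' : Tame F')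
    {t : ℕ → ℝ} (ht : t ∈ paramCube) (p : Ix Λ)
    (hd : ∀ x, HasDerivAt (fun y => F t (Function.update x p y)) (F' t x) (x p)) :
    ∫ x, (x p : ℂ) * F t x ∂(nu Λ) = ∫ x, F' t x ∂(nu Λ) := by
  have hmp := measurePreserving_update p
  have hxF := (tame_coord p).mul hF
  have hswap : ∀ {f : (ℕ → ℝ) → Coord Λ → ℂ}, Tame f → ∫ x, f t x ∂(nu Λ)
      = ∫ x, ∫ y, f t (Function.update x p y) ∂(gaussianReal 0 1) ∂(nu Λ) := by
    intro f hf
    have hint := hf.integrable ht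
    have h1 : ∫ x, f t x ∂(nu Λ) = ∫ q : ℝ × Coord Λ, f t (Function.update q.2 p q.1)
        ∂((gaussianReal 0 1).prod (nu Λ)) := by
      conv_lhs => rw [← hmp.map_eq]
      exact integral_map hmp.measurable.aemeasurable (hf.continuous ht).aestronglyMeasurable
    rw [h1]
    refine integral_prod_symm (fun q : ℝ × Coord Λ => f t (Function.update q.2 p q.1)) ?_
    exact (hmp.integrable_comp hint.aestronglyMeasurable).2 hint
  rw [hswap hxF, hswap hF']
  refine integral_congr_ae (Filter.Eventually.of_forall fun x => ?_)
  have hint : ∀ {f : (ℕ → ℝ) → Coord Λ → ℂ}, Tame f →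
      Integrable (fun y : ℝ => f t (Function.update x p y)) (gaussianReal 0 1) := by
    intro f hf
    obtain ⟨A, hA, h⟩ := hf.2
    exact integrable_update_of_bound (hf.continuous ht) hA (h t ht) x p
  have hyi := hint hxF
  simp only [Function.update_self] at hyi ⊢
  refine integral_mul_gaussianReal (fun y => ?_) (hint hF) (hint hF') hyi
  have := hd (Function.update x p y)
  simpa only [Function.update_idem, Function.update_self] using this

end Tame

/-! ### Operators of controlled growth, and contraction of a field -/

section TameOperators

open MeasureTheory ProbabilityTheory

variable {Λ : ℕ}

/-- Families of operators with tame entries. -/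
def TameOp (X : (ℕ → ℝ) → Coord Λ → Op Λ) : Prop := ∀ p q, Tame fun t x => X t x p q

theorem TameOp.const (Z : Op Λ) : TameOp fun _ (_ : Coord Λ) => Z := fun _ _ => Tame.const _

theorem TameOp.add {X Y : (ℕ → ℝ) → Coord Λ → Op Λ} (hX : TameOp X) (hY : TameOp Y) :
    TameOp fun t x => X t x + Y t x := fun p q => (hX p q).add (hY p q)

theorem TameOp.smul {X : (ℕ → ℝ) → Coord Λ → Op Λ} (c : ℂ) (hX : TameOp X) :
    TameOp fun t x => c • X t x := fun p q => (Tame.const c).mul (hX p q)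

theorem TameOp.sub {X Y : (ℕ → ℝ) → Coord Λ → Op Λ} (hX : TameOp X) (hY : TameOp Y) :
    TameOp fun t x => X t x - Y t x := by
  have h := hX.add (hY.smul (-1))
  simpa only [neg_smul, one_smul, ← sub_eq_add_neg] using h

theorem TameOp.mul {X Y : (ℕ → ℝ) → Coord Λ → Op Λ} (hX : TameOp X) (hY : TameOp Y) :
    TameOp fun t x => X t x * Y t x := fun p q => by
  simp only [Matrix.mul_apply]
  exact Tame.sum _ fun r _ => (hX p r).mul (hY r q)

theorem tame_param (ω : ℕ) : Tame fun t (_ : Coord Λ) => (t ω : ℂ) := by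
  refine tame_of_linear_bound (Continuous.continuousOn (by fun_prop)) zero_le_one fun t ht x => ?_
  rw [Complex.norm_real, Real.norm_of_nonneg (ht ω).1, one_mul]
  linarith [(ht ω).2, fieldSize_nonneg x]

theorem tame_sigma (m n : Fin (Λ + 1)) : Tame fun _ (x : Coord Λ) => sigma x m n := by
  have h : (fun (_ : ℕ → ℝ) (x : Coord Λ) => sigma x m n)
      = fun _ x => ∑ p, (x p : ℂ) * sigma (coordVec p) m n := by
    funext t x
    conv_lhs => rw [sigma_eq_sum]
    simp [Matrix.sum_apply]
  rw [h]
  exact Tame.sum _ fun p _ => (tame_coord p).mul (Tame.const _)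

theorem tameOp_sigmaHat : TameOp fun _ (x : Coord Λ) => sigmaHat x := by
  simp only [← sum_smul_unitField]
  intro p q
  simp only [Matrix.sum_apply, Matrix.smul_apply, smul_eq_mul]
  exact Tame.sum _ fun s _ => Tame.sum _ fun r _ => (tame_sigma _ _).mul (Tame.const _)

theorem tameOp_prop (I : Finset ℕ) : TameOp fun t (_ : Coord Λ) => prop Λ I t := by
  intro p q
  simp only [prop, Matrix.sum_apply, Matrix.smul_apply, smul_eq_mul]
  exact Tame.sum _ fun ω _ => (tame_param ω).mul (Tame.const _)

theorem tame_tadpole (I : Finset ℕ) (m : Fin (Λ + 1)) :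
    Tame fun t (_ : Coord Λ) => tadpole I t m :=
  Tame.sum _ fun ω _ => (tame_param ω).mul (Tame.const _)

theorem tameOp_vertexOp (lam : ℂ) (I : Finset ℕ) :
    TameOp fun t (x : Coord Λ) => vertexOp lam I t x :=
  ((tameOp_prop I).mul tameOp_sigmaHat).smul _

theorem TameOp.continuousOn {X : (ℕ → ℝ) → Coord Λ → Op Λ} (hX : TameOp X) :
    ContinuousOn (fun q : (ℕ → ℝ) × Coord Λ => X q.1 q.2) (paramCube ×ˢ Set.univ) :=
  continuousOn_pi.2 fun p => continuousOn_pi.2 fun q => (hX p q).1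

variable {lam : ℂ}

theorem tameOp_resolvent (hlam : |lam.arg| < Real.pi) (I : Finset ℕ) :
    TameOp fun t (x : Coord Λ) => resolvent lam I t x := by
  intro p q
  obtain ⟨A, hA, h⟩ := exists_resolvent_bound hlam Λ
  have h1 : ContinuousOn (fun q : (ℕ → ℝ) × Coord Λ => (1 + vertexOp lam I q.1 q.2)⁻¹)
      (paramCube ×ˢ Set.univ) :=
    continuousOn_matrix_inv (((TameOp.const 1).add (tameOp_vertexOp lam I)).continuousOn)
      fun q hq => isUnit_one_add_vertexOp hlam hq.1 _
  refine tame_of_linear_bound (A := A + 1) ?_ (by linarith) fun t ht x => ?_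
  · exact (continuousOn_pi.1 (continuousOn_pi.1 h1 p)) q
  · have h2 := (h I t ht x 1 (by simp)).1 p q
    simp only [Complex.ofReal_one, one_smul] at h2
    refine h2.trans ?_
    have := fieldSize_nonneg x
    nlinarith

theorem continuousOn_trLogTwo (hlam : |lam.arg| < Real.pi) (I : Finset ℕ) :
    ContinuousOn (fun q : (ℕ → ℝ) × Coord Λ => trLogTwo (vertexOp lam I q.1 q.2))
      (paramCube ×ˢ Set.univ) := by
  set S : Set ((ℕ → ℝ) × Coord Λ) := paramCube ×ˢ Set.univ with hS
  have hX : Continuous fun q : S => vertexOp lam I q.1.1 q.1.2 :=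
    continuousOn_iff_continuous_domRestrict.1 (tameOp_vertexOp lam I).continuousOn
  rw [continuousOn_iff_continuous_domRestrict]
  have hX' : Continuous fun r : S × ℝ => vertexOp lam I r.1.1.1 r.1.1.2 := hX.comp continuous_fst
  have hZ : Continuous fun r : S × ℝ =>
      (1 + (r.2 : ℂ) • vertexOp lam I r.1.1.1 r.1.1.2)⁻¹ := by
    rw [← continuousOn_univ]
    refine continuousOn_matrix_inv (Continuous.continuousOn ?_) fun r _ =>
      isUnit_one_add_smul_vertexOp hlam r.1.2.1 _ _
    exact continuous_const.add
      ((Complex.continuous_ofReal.comp continuous_snd).smul hX')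
  refine intervalIntegral.continuous_parametric_intervalIntegral_of_continuous'
    (f := fun (q : S) u => Matrix.trace (vertexOp lam I q.1.1 q.1.2 *
      ((1 + (u : ℂ) • vertexOp lam I q.1.1 q.1.2)⁻¹ - 1))) ?_ 0 1
  exact (hX'.matrix_mul (hZ.sub continuous_const)).matrix_trace

theorem tame_exp_interaction (hlam : |lam.arg| < Real.pi) (I : Finset ℕ) :
    Tame fun t (x : Coord Λ) => Complex.exp (interaction lam I t x) := by
  obtain ⟨A, hA, h⟩ := exists_resolvent_bound hlam Λ
  have hlog : ∀ t ∈ paramCube, ∀ x : Coord Λ,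
      ‖trLogTwo (vertexOp lam I t x)‖ ≤ A * fieldSize x := by
    intro t ht x
    have := intervalIntegral.norm_integral_le_of_norm_le_const (a := 0) (b := 1)
      (f := fun u : ℝ => Matrix.trace (vertexOp lam I t x *
        ((1 + (u : ℂ) • vertexOp lam I t x)⁻¹ - 1))) (C := A * fieldSize x) fun u hu => by
          rw [Set.uIoc_of_le zero_le_one] at hu
          exact (h I t ht x u (abs_le.2 ⟨by linarith [hu.1], hu.2⟩)).2
    simpa [trLogTwo] using this
  obtain ⟨B, hB⟩ : ∃ B : ℝ, B = ∑ ω ∈ I, ∑ m : Fin (Λ + 1), ‖sliceTadpole ω m‖ := ⟨_, rfl⟩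
  have hB0 : 0 ≤ B := by
    rw [hB]
    exact Finset.sum_nonneg fun _ _ => Finset.sum_nonneg fun _ _ => norm_nonneg _
  have hT : ∀ t ∈ paramCube, ∀ m : Fin (Λ + 1), ‖tadpole I t m‖ ≤ B := by
    intro t ht m
    rw [hB, tadpole]
    refine (norm_sum_le _ _).trans (Finset.sum_le_sum fun ω _ => ?_)
    rw [norm_mul, Complex.norm_real, Real.norm_of_nonneg (ht ω).1]
    refine (mul_le_of_le_one_left (norm_nonneg _) (ht ω).2).trans ?_
    exact Finset.single_le_sum (f := fun m : Fin (Λ + 1) => ‖sliceTadpole ω m‖)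
      (fun _ _ => norm_nonneg _) (Finset.mem_univ m)
  obtain ⟨N, hN⟩ : ∃ N : ℝ, N = ((Λ + 1 : ℕ) : ℝ) := ⟨_, rfl⟩
  have hN0 : 0 ≤ N := by rw [hN]; positivity
  have hc : Tame fun t (x : Coord Λ) => counterTerm lam I t x := by
    unfold counterTerm
    refine ((Tame.const _).mul (Tame.sum _ fun m _ => (tame_tadpole I m).mul (tame_sigma m m))).add
      ((Tame.const _).mul (Tame.sum _ fun m _ => ?_))
    simp only [pow_two]
    exact (tame_tadpole I m).mul (tame_tadpole I m)
  simp only [interaction_eq]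
  refine tame_exp (A := 1 / 2 * A + ‖coupling lam‖ * (N * (B * 2)) + ‖lam / 2‖ * (N * B ^ 2))
    ((continuousOn_const.mul (continuousOn_trLogTwo hlam I)).add hc.1) (by positivity)
    fun t ht x => ?_
  have h0 := fieldSize_nonneg x
  have hsum : ∀ (f : Fin (Λ + 1) → ℂ) (b : ℝ), (∀ m, ‖f m‖ ≤ b) → ‖∑ m, f m‖ ≤ N * b := by
    intro f b hf
    refine (norm_sum_le_of_le (f := f) (n := fun _ => b) _ fun m _ => hf m).trans (le_of_eq ?_)
    simp [hN]
  have h1 : ‖∑ m, tadpole I t m * sigma x m m‖ ≤ N * (B * (2 * fieldSize x)) :=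
    hsum _ _ fun m => by
      rw [norm_mul]
      exact mul_le_mul (hT t ht m) (norm_sigma_le x m m) (norm_nonneg _) hB0
  have h2 : ‖∑ m : Fin (Λ + 1), tadpole I t m ^ 2‖ ≤ N * B ^ 2 :=
    hsum _ _ fun m => by
      rw [norm_pow]
      exact pow_le_pow_left₀ (norm_nonneg _) (hT t ht m) 2
  have h3 := hlog t ht x
  have h4 := norm_nonneg (coupling lam)
  have h5 := norm_nonneg (lam / 2)
  calc ‖-(1 / 2) * trLogTwo (vertexOp lam I t x) + counterTerm lam I t x‖
      ≤ 1 / 2 * (A * fieldSize x) + (‖coupling lam‖ * (N * (B * (2 * fieldSize x)))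
          + ‖lam / 2‖ * (N * B ^ 2)) := by
        refine (norm_add_le _ _).trans (add_le_add ?_ ((norm_add_le _ _).trans (add_le_add ?_ ?_)))
        · rw [norm_mul]
          norm_num
          linarith
        · rw [norm_mul]
          exact mul_le_mul_of_nonneg_left h1 h4
        · rw [norm_mul]
          exact mul_le_mul_of_nonneg_left h2 h5
    _ ≤ _ := by
        have e1 : 0 ≤ 1 / 2 * A := by positivity
        have e2 : 0 ≤ ‖coupling lam‖ * (N * (B * 2)) := by positivity
        have e3 : 0 ≤ ‖lam / 2‖ * (N * B ^ 2) * fieldSize x := by positivity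
        nlinarith

variable {K : Type}

theorem tameOp_dressed (hlam : |lam.arg| < Real.pi) (I : Finset ℕ) (ε : K → ℂ)
    {Q : (ℕ → ℝ) → Coord Λ → K → Op Λ} (hQ : ∀ h, TameOp fun t x => Q t x h) (h : K) :
    TameOp fun t x => dressed (resolvent lam I t x) ε (Q t x) h :=
  ((tameOp_resolvent hlam I).sub (TameOp.const _)).mul (hQ h)

theorem tameOp_extendMatrix {Y : (ℕ → ℝ) → Coord Λ → Op Λ} {Q : (ℕ → ℝ) → Coord Λ → K → Op Λ}
    (hY : TameOp Y) (hQ : ∀ h, TameOp fun t x => Q t x h) (o : Option K) :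
    TameOp fun t x => extendMatrix (Y t x) (Q t x) o := by
  cases o with
  | none => exact hY
  | some h => exact hQ h

theorem tameOp_bareProp (I : Finset ℕ) (G : ResolventGraph K) (k : K → Ix Λ) (h : K) :
    TameOp fun t (_ : Coord Λ) => G.bareProp I t k h := by
  refine TameOp.mul ?_ (TameOp.const _)
  unfold ResolventGraph.cprop
  cases G.mark h with
  | none => exact tameOp_prop I
  | some ω => exact TameOp.const _

variable [Fintype K] [DecidableEq K]

theorem tame_loopTrace (τ : Equiv.Perm K) {M : K → (ℕ → ℝ) → Coord Λ → Op Λ}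
    (hM : ∀ h, TameOp (M h)) : Tame fun t x => loopTrace τ fun h => M h t x := by
  unfold loopTrace
  exact Tame.sum _ fun i _ => Tame.prod _ fun h _ => hM h _ _

theorem tame_exp_mul_loopTrace (hlam : |lam.arg| < Real.pi) (I : Finset ℕ) (τ : Equiv.Perm K)
    (ε : K → ℂ) {Q : (ℕ → ℝ) → Coord Λ → K → Op Λ} (hQ : ∀ h, TameOp fun t x => Q t x h) :
    Tame fun t x => expTrace lam I t x τ ε (Q t x) :=
  (tame_exp_interaction hlam I).mul (tame_loopTrace τ fun h => tameOp_dressed hlam I ε hQ h)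

theorem tame_exp_mul_insertSum (hlam : |lam.arg| < Real.pi) (I : Finset ℕ) (a : ℂ)
    (τ : Equiv.Perm K) (ε : K → ℂ) {Q : (ℕ → ℝ) → Coord Λ → K → Op Λ}
    {Y : (ℕ → ℝ) → Coord Λ → Op Λ} (hQ : ∀ h, TameOp fun t x => Q t x h) (hY : TameOp Y) :
    Tame fun t x => Complex.exp (interaction lam I t x) *
      insertSum a (resolvent lam I t x) τ ε (Q t x) (Y t x) := by
  refine (tame_exp_interaction hlam I).mul (Tame.sum _ fun o _ => (Tame.const _).mul ?_)
  exact tame_loopTrace _ fun h => tameOp_dressed hlam I _ (tameOp_extendMatrix hY hQ) h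

theorem tame_exp_mul_loopForm (hlam : |lam.arg| < Real.pi) (I : Finset ℕ) (τ : Equiv.Perm K)
    (ε : K → ℂ) {Q : (ℕ → ℝ) → Coord Λ → K → Op Λ} (hQ : ∀ h, TameOp fun t x => Q t x h)
    (h : K) (Q' : Op Λ) :
    Tame fun t x => Complex.exp (interaction lam I t x) *
      loopForm τ (dressed (resolvent lam I t x) ε (Q t x)) h
        ((resolvent lam I t x - ε h • 1) * Q') := by
  refine (tame_exp_interaction hlam I).mul ?_
  simp only [← loopTrace_update]
  refine tame_loopTrace τ (M := fun k t x => Function.update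
    (dressed (resolvent lam I t x) ε (Q t x)) h ((resolvent lam I t x - ε h • 1) * Q') k)
    fun k => ?_
  by_cases hk : k = h
  · subst hk
    simp only [Function.update_self]
    exact ((tameOp_resolvent hlam I).sub (TameOp.const _)).mul (TameOp.const _)
  · simp only [Function.update_of_ne hk]
    exact tameOp_dressed hlam I ε hQ k

theorem tame_exp_mul_amplitude (hlam : |lam.arg| < Real.pi) (I : Finset ℕ) (G : ResolventGraph K) :
    Tame fun t (x : Coord Λ) =>
      Complex.exp (interaction lam I t x) * G.amplitude lam I t x := by
  simp only [ResolventGraph.amplitude_eq]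
  refine (tame_exp_interaction hlam I).mul ((Tame.const _).mul (Tame.sum _ fun k _ => ?_))
  exact tame_loopTrace _ fun h => tameOp_dressed hlam I _ (tameOp_bareProp I G k.1) h

/-- Contraction of a field with the exponential of the interaction and with the resolvents. -/
theorem integral_sigma_mul_expTrace (hlam : |lam.arg| < Real.pi) (I : Finset ℕ) {t : ℕ → ℝ}
    (ht : t ∈ paramCube) (τ : Equiv.Perm K) (ε : K → ℂ) (Q : K → Op Λ) (p : Ix Λ) :
    ∫ x, sigma x p.1 p.2 * expTrace lam I t x τ ε Q ∂(nu Λ)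
      = ∫ x, Complex.exp (interaction lam I t x) *
        ((if p.1 = p.2 then coupling lam * tadpole I t p.1 else 0) *
            loopTrace τ (dressed (resolvent lam I t x) ε Q)
          + insertSum (coupling lam) (resolvent lam I t x) τ ε Q
              (prop Λ I t * ∑ s', unitField s' p.swap)) ∂(nu Λ) := by
  have hQ : ∀ h, TameOp fun _ (_ : Coord Λ) => Q h := fun h => TameOp.const _
  have hF := tame_exp_mul_loopTrace hlam I τ ε hQ
  set D : Ix Λ → (ℕ → ℝ) → Coord Λ → ℂ := fun q t x => Complex.exp (interaction lam I t x) *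
        (coupling lam * (∑ m, tadpole I t m * sigma (coordVec q) m m) *
            loopTrace τ (dressed (resolvent lam I t x) ε Q)
          + insertSum (coupling lam) (resolvent lam I t x) τ ε Q
              (prop Λ I t * sigmaHat (coordVec q))) with hD
  have hDt : ∀ q, Tame (D q) := by
    intro q
    simp only [hD, mul_add]
    refine Tame.add ?_ (tame_exp_mul_insertSum hlam I _ τ ε hQ
      ((tameOp_prop I).mul (TameOp.const _)))
    refine (tame_exp_interaction hlam I).mul (Tame.mul ((Tame.const _).mul (Tame.sum _ fun m _ =>
      (tame_tadpole I m).mul (Tame.const _))) (tame_loopTrace τ fun h => ?_))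
    exact tameOp_dressed hlam I ε hQ h
  -- The entry of the field as a combination of its coordinates, which are integrated by parts.
  have h1 : ∀ x : Coord Λ, sigma x p.1 p.2 * expTrace lam I t x τ ε Q
      = ∑ q, sigma (coordVec q) p.1 p.2 * ((x q : ℂ) * expTrace lam I t x τ ε Q) := by
    intro x
    conv_lhs => rw [sigma_eq_sum]
    simp only [Matrix.sum_apply, Matrix.smul_apply, smul_eq_mul, Finset.sum_mul]
    exact Finset.sum_congr rfl fun q _ => by ring
  simp only [h1]
  rw [integral_finsetSum _ fun q _ => (((tame_coord q).mul hF).integrable ht).const_mul _]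
  simp only [integral_const_mul]
  simp only [integral_coord_mul hF (hDt _) ht _ fun x =>
    hasDerivAt_expTrace_coord hlam ht τ ε Q x _]
  simp only [← integral_const_mul]
  rw [← integral_finsetSum _ fun q _ => ((hDt q).integrable ht).const_mul _]
  congr 1
  funext x
  -- The sums over the coordinates are evaluated with the covariance of `ν`.
  have e1 : ∑ q, sigma (coordVec q) p.1 p.2 * ∑ m, tadpole I t m * sigma (coordVec q) m m
      = if p.1 = p.2 then tadpole I t p.1 else 0 := by
    simp only [Finset.mul_sum]
    rw [Finset.sum_comm]
    have e2 : ∀ m : Fin (Λ + 1), ∑ q, sigma (coordVec q) p.1 p.2 *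
        (tadpole I t m * sigma (coordVec q) m m)
        = tadpole I t m * if p.1 = m ∧ p.2 = m then 1 else 0 := by
      intro m
      rw [← sum_sigma_coordVec_sigma_coordVec, Finset.mul_sum]
      exact Finset.sum_congr rfl fun q _ => by ring
    simp only [e2]
    rw [Finset.sum_eq_single p.1 (fun m _ hm => by simp [hm.symm]) (by simp)]
    by_cases h : p.1 = p.2
    · simp [h]
    · simp [h, Ne.symm h]
  have e3 : insertSum (coupling lam) (resolvent lam I t x) τ ε Q
        (prop Λ I t * ∑ s', unitField s' p.swap)
      = ∑ q, sigma (coordVec q) p.1 p.2 * insertSum (coupling lam) (resolvent lam I t x) τ ε Q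
        (prop Λ I t * sigmaHat (coordVec q)) := by
    have := sum_sigma_coordVec_smul_sigmaHat (Λ := Λ) p.1 p.2
    rw [show p.swap = (p.2, p.1) from rfl, ← this, Finset.mul_sum, insertSum_sum]
    exact Finset.sum_congr rfl fun q _ => by rw [Matrix.mul_smul, insertSum_smul]
  rw [e3]
  have e4 : (if p.1 = p.2 then coupling lam * tadpole I t p.1 else 0)
      = coupling lam * ∑ q, sigma (coordVec q) p.1 p.2 *
        ∑ m, tadpole I t m * sigma (coordVec q) m m := by
    rw [e1]; split_ifs <;> simp
  rw [e4, mul_add, Finset.mul_sum, Finset.mul_sum, Finset.sum_mul, Finset.mul_sum,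
    ← Finset.sum_add_distrib]
  exact Finset.sum_congr rfl fun q _ => by simp only [hD]; ring

end TameOperators

/-! ### The derivative of an amplitude with respect to an interpolation parameter -/

section Derivation

open MeasureTheory ProbabilityTheory ResolventGraph

variable {Λ : ℕ}

/-- `f` is integrable with respect to the Gaussian measure, with integral `v`. It makes the
linearity of the integral available without side conditions. -/
def HasGaussianIntegral (f : Coord Λ → ℂ) (v : ℂ) : Prop :=
  Integrable f (nu Λ) ∧ ∫ x, f x ∂(nu Λ) = v

theorem HasGaussianIntegral.add {f g : Coord Λ → ℂ} {v w : ℂ} (hf : HasGaussianIntegral f v)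
    (hg : HasGaussianIntegral g w) : HasGaussianIntegral (fun x => f x + g x) (v + w) :=
  ⟨hf.1.add hg.1, by rw [integral_add hf.1 hg.1, hf.2, hg.2]⟩

theorem HasGaussianIntegral.const_mul {f : Coord Λ → ℂ} {v : ℂ} (c : ℂ)
    (hf : HasGaussianIntegral f v) : HasGaussianIntegral (fun x => c * f x) (c * v) :=
  ⟨hf.1.const_mul c, by rw [integral_const_mul, hf.2]⟩

theorem HasGaussianIntegral.sum {ι : Type*} (s : Finset ι) {f : ι → Coord Λ → ℂ} {v : ι → ℂ}
    (hf : ∀ i ∈ s, HasGaussianIntegral (f i) (v i)) :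
    HasGaussianIntegral (fun x => ∑ i ∈ s, f i x) (∑ i ∈ s, v i) :=
  ⟨integrable_finsetSum _ fun i hi => (hf i hi).1, by
    rw [integral_finsetSum _ fun i hi => (hf i hi).1]
    exact Finset.sum_congr rfl fun i hi => (hf i hi).2⟩

theorem Tame.hasGaussianIntegral {F : (ℕ → ℝ) → Coord Λ → ℂ} (hF : Tame F) {t : ℕ → ℝ}
    (ht : t ∈ paramCube) : HasGaussianIntegral (F t) (∫ x, F t x ∂(nu Λ)) :=
  ⟨hF.integrable ht, rfl⟩

variable {K : Type} [Fintype K] [DecidableEq K] {lam : ℂ} {I : Finset ℕ} {t : ℕ → ℝ}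

/-- A field may be contracted with the exponential of the interaction and the resolvents. -/
theorem hasGaussianIntegral_contract (hlam : |lam.arg| < Real.pi) (ht : t ∈ paramCube)
    (τ : Equiv.Perm K) (ε : K → ℂ) (Q : K → Op Λ) (p : Ix Λ) :
    ∃ v, HasGaussianIntegral (fun x => sigma x p.1 p.2 * expTrace lam I t x τ ε Q) v ∧
      HasGaussianIntegral (fun x => Complex.exp (interaction lam I t x) *
        ((if p.1 = p.2 then coupling lam * tadpole I t p.1 else 0) *
            loopTrace τ (dressed (resolvent lam I t x) ε Q)
          + insertSum (coupling lam) (resolvent lam I t x) τ ε Q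
              (prop Λ I t * ∑ s', unitField s' p.swap))) v := by
  have hQ : ∀ h, TameOp fun _ (_ : Coord Λ) => Q h := fun h => TameOp.const _
  have h1 := ((tame_sigma p.1 p.2).mul
    (tame_exp_mul_loopTrace hlam I τ ε hQ)).hasGaussianIntegral ht
  refine ⟨_, h1, ?_, (integral_sigma_mul_expTrace hlam I ht τ ε Q p).symm⟩
  refine Tame.integrable (F := fun t x => Complex.exp (interaction lam I t x) *
        ((if p.1 = p.2 then coupling lam * tadpole I t p.1 else 0) *
            loopTrace τ (dressed (resolvent lam I t x) ε Q)
          + insertSum (coupling lam) (resolvent lam I t x) τ ε Q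
              (prop Λ I t * ∑ s', unitField s' p.swap))) ?_ ht
  simp only [mul_add]
  refine Tame.add ?_ (tame_exp_mul_insertSum hlam I _ τ ε hQ
    ((tameOp_prop I).mul (TameOp.const _)))
  refine (tame_exp_interaction hlam I).mul (Tame.mul ?_ (tame_loopTrace τ fun h =>
    tameOp_dressed hlam I ε hQ h))
  split_ifs
  · exact (Tame.const _).mul (tame_tadpole I _)
  · exact Tame.const _

/-- The derivative of the integrand of an amplitude with respect to `t^ω`. -/
def paramDerivative (lam : ℂ) (I : Finset ℕ) (ω : ℕ) (G : ResolventGraph K) (k : K → Ix Λ)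
    (t : ℕ → ℝ) (x : Coord Λ) : ℂ :=
  Complex.exp (interaction lam I t x) *
    ((coupling lam * (∑ m, sliceTadpole ω m * sigma x m m)
        + lam * ∑ m : Fin (Λ + 1), tadpole I t m * sliceTadpole ω m) *
        loopTrace G.next (dressed (resolvent lam I t x) G.tadpoleIndicator (G.bareProp I t k))
      + insertSum (coupling lam) (resolvent lam I t x) G.next G.tadpoleIndicator
          (G.bareProp I t k) (sliceProp Λ ω * sigmaHat x)
      + ∑ h, loopForm G.next
          (dressed (resolvent lam I t x) G.tadpoleIndicator (G.bareProp I t k)) h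
          ((resolvent lam I t x - G.tadpoleIndicator h • 1) * slicedBareProp G ω k h))

theorem tame_paramDerivative (hlam : |lam.arg| < Real.pi) (I : Finset ℕ) (ω : ℕ)
    (G : ResolventGraph K) (k : K → Ix Λ) : Tame (paramDerivative lam I ω G k) := by
  unfold paramDerivative
  have hQ := tameOp_bareProp I G k
  simp only [mul_add, add_mul, Finset.mul_sum]
  refine Tame.add (Tame.add (Tame.add ?_ ?_) ?_) (Tame.sum _ fun h _ =>
    tame_exp_mul_loopForm hlam I G.next G.tadpoleIndicator hQ h _)
  · refine (tame_exp_interaction hlam I).mul (Tame.mul (Tame.sum _ fun m _ => (Tame.const _).mul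
      ((Tame.const _).mul (tame_sigma m m))) (tame_loopTrace _ fun h =>
        tameOp_dressed hlam I _ hQ h))
  · refine (tame_exp_interaction hlam I).mul (Tame.mul (Tame.sum _ fun m _ => (Tame.const _).mul
      ((tame_tadpole I m).mul (Tame.const _))) (tame_loopTrace _ fun h =>
        tameOp_dressed hlam I _ hQ h))
  · exact tame_exp_mul_insertSum hlam I _ _ _ hQ ((TameOp.const _).mul tameOp_sigmaHat)

/-- The contraction of the field created by the derivation: the tadpoles cancel against the
counter-terms. -/
theorem integral_paramDerivative (hlam : |lam.arg| < Real.pi) (ht : t ∈ paramCube) (ω : ℕ)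
    (G : ResolventGraph K) (k : K → Ix Λ) :
    ∫ x, paramDerivative lam I ω G k t x ∂(nu Λ)
      = (∑ s, ∑ s', ∑ p : Ix Λ, ∑ o₁ : Option K, ∑ o₂ : Option (Option K),
          insertFactor (coupling lam) o₁ * insertFactor (coupling lam) o₂ *
          ∫ x, expTrace lam I t x
            (Equiv.Perm.decomposeOption.symm (o₂, Equiv.Perm.decomposeOption.symm (o₁, G.next)))
            (pairTadpole o₁ o₂ (s = s') G.tadpoleIndicator)
            (extendMatrix (prop Λ I t * unitField s' p.swap)
              (extendMatrix (sliceProp Λ ω * unitField s p) (G.bareProp I t k))) ∂(nu Λ))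
        + ∑ h, ∫ x, Complex.exp (interaction lam I t x) * loopForm G.next
          (dressed (resolvent lam I t x) G.tadpoleIndicator (G.bareProp I t k)) h
          ((resolvent lam I t x - G.tadpoleIndicator h • 1) * slicedBareProp G ω k h) ∂(nu Λ) := by
  set a := coupling lam with ha
  set τ := G.next with hτ
  set ε := G.tadpoleIndicator with hε
  set Q := G.bareProp I t k with hQd
  set C' := sliceProp Λ ω with hC'
  have hQ : ∀ h, TameOp fun _ (_ : Coord Λ) => Q h := fun h => TameOp.const _
  choose v hv hv' using fun p => hasGaussianIntegral_contract (I := I) hlam ht τ ε Q p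
  choose w hw hw' using fun (s : Border) (p : Ix Λ) (o : Option K) =>
    hasGaussianIntegral_contract (I := I) hlam ht (Equiv.Perm.decomposeOption.symm (o, τ))
      (extendTadpole o ε) (extendMatrix (C' * unitField s p) Q) p
  obtain ⟨c, hc⟩ : ∃ c, c = lam * ∑ m : Fin (Λ + 1), tadpole I t m * sliceTadpole ω m := ⟨_, rfl⟩
  have hct := ((tame_exp_mul_loopTrace hlam I τ ε hQ).hasGaussianIntegral ht).const_mul c
  have hloop := HasGaussianIntegral.sum Finset.univ fun h (_ : h ∈ Finset.univ) =>
    (tame_exp_mul_loopForm hlam I τ ε hQ h (slicedBareProp G ω k h)).hasGaussianIntegral ht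
  have hsw : ∀ p : Ix Λ, sliceCoeff ω p.swap = sliceCoeff ω p := sliceCoeff_swap ω
  have htr : ∀ p : Ix Λ, ∑ s, Matrix.trace (C' * unitField s p)
      = if p.1 = p.2 then 2 * sliceTadpole ω p.1 else 0 := sum_trace_diagonal_unitField _ hsw
  -- The derivative before the contraction of the field.
  have hA := ((HasGaussianIntegral.sum Finset.univ fun s (_ : s ∈ Finset.univ) =>
    HasGaussianIntegral.sum Finset.univ fun p (_ : p ∈ Finset.univ) =>
      (HasGaussianIntegral.sum Finset.univ fun o (_ : o ∈ Finset.univ) =>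
        (hw s p o).const_mul (insertFactor a o)).add
        ((hv p).const_mul (a / 2 * Matrix.trace (C' * unitField s p)))).add hct).add hloop
  -- The derivative after the contraction of the field, term by term with the same values.
  have hB := ((HasGaussianIntegral.sum Finset.univ fun s (_ : s ∈ Finset.univ) =>
    HasGaussianIntegral.sum Finset.univ fun p (_ : p ∈ Finset.univ) =>
      (HasGaussianIntegral.sum Finset.univ fun o (_ : o ∈ Finset.univ) =>
        (hw' s p o).const_mul (insertFactor a o)).add
        ((hv' p).const_mul (a / 2 * Matrix.trace (C' * unitField s p)))).add hct).add hloop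
  -- The amplitudes with a new propagator.
  have hD := HasGaussianIntegral.sum Finset.univ fun s (_ : s ∈ Finset.univ) =>
    HasGaussianIntegral.sum Finset.univ fun s' (_ : s' ∈ Finset.univ) =>
    HasGaussianIntegral.sum Finset.univ fun p (_ : p ∈ Finset.univ) =>
    HasGaussianIntegral.sum Finset.univ fun o₁ (_ : o₁ ∈ Finset.univ) =>
    HasGaussianIntegral.sum Finset.univ fun o₂ (_ : o₂ ∈ Finset.univ) =>
      ((tame_exp_mul_loopTrace hlam I (Equiv.Perm.decomposeOption.symm
          (o₂, Equiv.Perm.decomposeOption.symm (o₁, τ)))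
        (pairTadpole o₁ o₂ (s = s') ε)
        (Q := fun _ _ => extendMatrix (prop Λ I t * unitField s' p.swap)
              (extendMatrix (C' * unitField s p) Q))
        fun h => TameOp.const _).hasGaussianIntegral ht).const_mul
        (insertFactor a o₁ * insertFactor a o₂)
  rw [← (hD.add hloop).2]
  refine Eq.trans ?_ (hA.2.trans (hB.2.symm.trans ?_))
  -- The field is a sum over its entries.
  · congr 1
    funext x
    have e1 : a * (∑ m, sliceTadpole ω m * sigma x m m)
        = ∑ s, ∑ p : Ix Λ, a / 2 * Matrix.trace (C' * unitField s p) * sigma x p.1 p.2 := by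
      rw [Finset.sum_comm]
      simp only [← Finset.sum_mul, ← Finset.mul_sum, htr]
      rw [Fintype.sum_prod_type, Finset.mul_sum]
      refine Finset.sum_congr rfl fun m _ => ?_
      rw [Finset.sum_eq_single m (fun m' _ hm => by simp [hm.symm]) (by simp), if_pos rfl]
      ring
    have e2 : insertSum a (resolvent lam I t x) τ ε Q (C' * sigmaHat x)
        = ∑ s, ∑ p : Ix Λ, sigma x p.1 p.2 *
          insertSum a (resolvent lam I t x) τ ε Q (C' * unitField s p) := by
      rw [← sum_smul_unitField]
      simp only [Finset.mul_sum, insertSum_sum, Matrix.mul_smul, insertSum_smul]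
    rw [paramDerivative, ← hc, ← ha, e1, ← hτ, ← hε, ← hQd, ← hC', e2, mul_add, mul_add,
      Finset.mul_sum Finset.univ (fun h => loopForm _ _ h _), add_mul, mul_add]
    congr 1
    rw [add_right_comm]
    congr 1
    · rw [← mul_add, Finset.sum_mul, ← Finset.sum_add_distrib, Finset.mul_sum]
      refine Finset.sum_congr rfl fun s _ => ?_
      rw [Finset.sum_mul, ← Finset.sum_add_distrib, Finset.mul_sum]
      refine Finset.sum_congr rfl fun p _ => ?_
      rw [insertSum, Finset.mul_sum, mul_add, Finset.mul_sum, add_comm]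
      refine congrArg₂ (· + ·) (Finset.sum_congr rfl fun o _ => ?_) ?_
      · unfold expTrace; ring
      · unfold expTrace; ring
    · unfold expTrace; ring
  -- The cancellation of the tadpoles holds for each value of the field.
  · congr 1
    funext x
    have hT : ∑ s, ∑ p : Ix Λ, unitField s p * prop Λ I t * unitField s p.swap
        = tadpoleOp (tadpole I t) := by
      rw [prop_eq_diagonal, sum_unitField_diagonal _ fun p => by rw [propCoeff_swap],
        tadpole_eq_sum]
    have key := tadpole_cancellation (coupling_sq lam) (resolvent lam I t x) (prop Λ I t) C'
      (tadpole I t) (sliceTadpole ω) hT (sum_unitField_diagonal_swap _ hsw) htr τ ε Q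
    refine congrArg₂ (· + ·) (Eq.trans ?_
      ((congrArg (Complex.exp (interaction lam I t x) * ·) key).trans ?_)) rfl
    · simp only [mul_add, Finset.mul_sum, hc, ← ha, expTrace]
      refine congrArg₂ (· + ·) (Finset.sum_congr rfl fun s _ => Finset.sum_congr rfl fun p _ => ?_)
        ?_
      · refine congrArg₂ (· + ·) (Finset.sum_congr rfl fun o _ => ?_) ?_ <;> ring
      · rw [Finset.sum_mul, Finset.sum_mul, Finset.mul_sum]
        exact Finset.sum_congr rfl fun m _ => by ring
    · simp only [← ha, expTrace, Finset.mul_sum]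
      refine Finset.sum_congr rfl fun s _ => Finset.sum_congr rfl fun s' _ =>
        Finset.sum_congr rfl fun p _ => Finset.sum_congr rfl fun o₁ _ =>
        Finset.sum_congr rfl fun o₂ _ => by ring

/-- Differentiation under the integral sign. -/
theorem hasDerivAt_integral_expTrace (hlam : |lam.arg| < Real.pi) (ht : t ∈ paramCube) {ω : ℕ}
    (hω : ω ∈ I) (htω : t ω ∈ Set.Ioo (0 : ℝ) 1) (G : ResolventGraph K) (k : K → Ix Λ) :
    HasDerivAt (fun s : ℝ => ∫ x, expTrace lam I (Function.update t ω s) x G.next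
        G.tadpoleIndicator (G.bareProp I (Function.update t ω s) k) ∂(nu Λ))
      (∫ x, paramDerivative lam I ω G k t x ∂(nu Λ)) (t ω) := by
  have hF := tame_exp_mul_loopTrace hlam I G.next G.tadpoleIndicator (tameOp_bareProp I G k)
  have hF' := tame_paramDerivative hlam I ω G k
  obtain ⟨A, hA, hb⟩ := hF'.2
  have hmem : ∀ s ∈ Set.Ioo (0 : ℝ) 1, Function.update t ω s ∈ paramCube := fun s hs =>
    update_mem_paramCube ht ω ⟨hs.1.le, hs.2.le⟩
  have h := hasDerivAt_integral_of_dominated_loc_of_deriv_le (μ := nu Λ)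
    (F := fun s x => expTrace lam I (Function.update t ω s) x G.next
        G.tadpoleIndicator (G.bareProp I (Function.update t ω s) k))
    (F' := fun s x => paramDerivative lam I ω G k (Function.update t ω s) x)
    (bound := fun x => A * Real.exp (A * fieldSize x)) (x₀ := t ω)
    (isOpen_Ioo.mem_nhds htω)
    (by
      filter_upwards [isOpen_Ioo.mem_nhds htω] with s hs
      exact (hF.integrable (hmem s hs)).aestronglyMeasurable)
    (hF.integrable (hmem _ htω)) (hF'.integrable (hmem _ htω)).aestronglyMeasurable
    (Filter.Eventually.of_forall fun x s hs => hb _ (hmem s hs) x)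
    ((integrable_exp_fieldSize A).const_mul A)
    (Filter.Eventually.of_forall fun x s hs => by
      have := hasDerivAt_expTrace_param hlam (hmem s hs) hω (by simpa using hs) G k x
      simp only [Function.update_idem, Function.update_self] at this
      exact this)
  have h2 := h.2
  simp only [Function.update_eq_self] at h2
  exact h2

/-- The Gaussian integral of the renormalized amplitude, with the exponential of the interaction. -/
def graphIntegral (Λ : ℕ) (lam : ℂ) (I : Finset ℕ) (t : ℕ → ℝ) {H : Type} [Fintype H]
    (G : ResolventGraph H) : ℂ :=
  ∫ x : Coord Λ, Complex.exp (interaction lam I t x) * G.amplitude lam I t x ∂(nu Λ)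

theorem graphIntegral_congr {H H' : Type} [Fintype H] [Fintype H'] {G : ResolventGraph H}
    {G' : ResolventGraph H'} (h : G.Iso G') :
    graphIntegral Λ lam I t G = graphIntegral Λ lam I t G' := by
  unfold graphIntegral
  simp only [h.amplitude_eq]

theorem graphIntegral_eq (hlam : |lam.arg| < Real.pi) (ht : t ∈ paramCube) (G : ResolventGraph K) :
    graphIntegral Λ lam I t G = (-lam) ^ G.order * ∑ k : Contraction Λ G.pair,
      ∫ x, expTrace lam I t x G.next G.tadpoleIndicator (G.bareProp I t k.1) ∂(nu Λ) := by
  have h := (HasGaussianIntegral.sum Finset.univ fun (k : Contraction Λ G.pair)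
    (_ : k ∈ Finset.univ) => (tame_exp_mul_loopTrace hlam I G.next G.tadpoleIndicator
      (tameOp_bareProp I G k.1)).hasGaussianIntegral ht).const_mul ((-lam) ^ G.order)
  rw [← h.2, graphIntegral]
  congr 1
  funext x
  rw [amplitude_eq, mul_left_comm, Finset.mul_sum]
  rfl

theorem graphIntegral_markAt (hlam : |lam.arg| < Real.pi) (ht : t ∈ paramCube)
    (G : ResolventGraph K) (ω : ℕ) (h : K) :
    graphIntegral Λ lam I t (G.markAt ω h) = (-lam) ^ G.order * ∑ k : Contraction Λ G.pair,
      ∫ x, Complex.exp (interaction lam I t x) * loopForm G.next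
          (dressed (resolvent lam I t x) G.tadpoleIndicator (G.bareProp I t k.1)) h
          ((resolvent lam I t x - G.tadpoleIndicator h • 1) *
            (sliceProp Λ ω * unitField (G.side h) (k.1 h))) ∂(nu Λ) := by
  have h := (HasGaussianIntegral.sum Finset.univ fun (k : Contraction Λ G.pair)
    (_ : k ∈ Finset.univ) => (tame_exp_mul_loopForm hlam I G.next G.tadpoleIndicator
      (tameOp_bareProp I G k.1) h (sliceProp Λ ω * unitField (G.side h)
        (k.1 h))).hasGaussianIntegral ht).const_mul ((-lam) ^ G.order)
  rw [← h.2, graphIntegral]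
  congr 1
  funext x
  rw [markAt_amplitude, mul_left_comm, Finset.mul_sum]

theorem graphIntegral_insertPair (hlam : |lam.arg| < Real.pi) (ht : t ∈ paramCube)
    (G : ResolventGraph K) (ω : ℕ) (o₁ : Option K) (o₂ : Option (Option K)) (s s' : Border) :
    graphIntegral Λ lam I t (G.insertPair ω o₁ o₂ s s')
      = (-lam) ^ (G.order + 1) * ∑ k : Contraction Λ G.pair, ∑ p : Ix Λ,
        ∫ x, expTrace lam I t x
            (Equiv.Perm.decomposeOption.symm (o₂, Equiv.Perm.decomposeOption.symm (o₁, G.next)))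
            (pairTadpole o₁ o₂ (s = s') G.tadpoleIndicator)
            (extendMatrix (prop Λ I t * unitField s' p.swap)
              (extendMatrix (sliceProp Λ ω * unitField s p) (G.bareProp I t k.1))) ∂(nu Λ) := by
  have h := (HasGaussianIntegral.sum Finset.univ fun (k : Contraction Λ G.pair)
    (_ : k ∈ Finset.univ) => HasGaussianIntegral.sum Finset.univ fun (p : Ix Λ)
    (_ : p ∈ Finset.univ) => (tame_exp_mul_loopTrace hlam I
            (Equiv.Perm.decomposeOption.symm (o₂, Equiv.Perm.decomposeOption.symm (o₁, G.next)))
            (pairTadpole o₁ o₂ (s = s') G.tadpoleIndicator)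
            (Q := fun _ _ => extendMatrix (prop Λ I t * unitField s' p.swap)
              (extendMatrix (sliceProp Λ ω * unitField s p) (G.bareProp I t k.1)))
      (fun _ => TameOp.const _)).hasGaussianIntegral ht).const_mul ((-lam) ^ (G.order + 1))
  rw [← h.2, graphIntegral]
  congr 1
  funext x
  rw [insertPair_amplitude, mul_left_comm, Finset.mul_sum]
  congr 1
  refine Finset.sum_congr rfl fun k _ => ?_
  rw [Finset.mul_sum]
  rfl

/-- The combinatorial factor of an insertion: it is the ratio of the weights `c` of the graphs after
and before the insertion. -/
def insertWeight (o₁ : Option K) (o₂ : Option (Option K)) : ℂ :=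
  1 / 2 * (if o₁ = none then 1 / 2 else 1) * (if o₂ = none then 1 / 2 else 1)

open Classical in
/-- The derivative of the integral of an amplitude: either an unmarked c-propagator gets the mark
`ω`, or a new `σ` propagator with the mark `ω` next to it is inserted. -/
theorem hasDerivAt_graphIntegral (hlam : |lam.arg| < Real.pi) (ht : t ∈ paramCube) {ω : ℕ}
    (hω : ω ∈ I) (htω : t ω ∈ Set.Ioo (0 : ℝ) 1) (G : ResolventGraph K) :
    HasDerivAt (fun s : ℝ => graphIntegral Λ lam I (Function.update t ω s) G)
      ((∑ h, if G.mark h = none then graphIntegral Λ lam I t (G.markAt ω h) else 0)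
        + ∑ o₁ : Option K, ∑ o₂ : Option (Option K), ∑ s, ∑ s', insertWeight o₁ o₂ *
            graphIntegral Λ lam I t (G.insertPair ω o₁ o₂ s s')) (t ω) := by
  have h1 : HasDerivAt (fun s : ℝ => (-lam) ^ G.order * ∑ k : Contraction Λ G.pair,
      ∫ x, expTrace lam I (Function.update t ω s) x G.next G.tadpoleIndicator
        (G.bareProp I (Function.update t ω s) k.1) ∂(nu Λ))
      ((-lam) ^ G.order * ∑ k : Contraction Λ G.pair,
        ∫ x, paramDerivative lam I ω G k.1 t x ∂(nu Λ)) (t ω) :=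
    (HasDerivAt.fun_sum fun k _ =>
      hasDerivAt_integral_expTrace hlam ht hω htω G k.1).const_mul _
  have h2 : (fun s : ℝ => graphIntegral Λ lam I (Function.update t ω s) G) =ᶠ[nhds (t ω)]
      fun s : ℝ => (-lam) ^ G.order * ∑ k : Contraction Λ G.pair,
      ∫ x, expTrace lam I (Function.update t ω s) x G.next G.tadpoleIndicator
        (G.bareProp I (Function.update t ω s) k.1) ∂(nu Λ) := by
    filter_upwards [isOpen_Ioo.mem_nhds htω] with s hs
    exact graphIntegral_eq hlam (update_mem_paramCube ht ω ⟨hs.1.le, hs.2.le⟩) G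
  refine (h1.congr_of_eventuallyEq h2).congr_deriv ?_
  simp only [integral_paramDerivative hlam ht]
  rw [Finset.sum_add_distrib, mul_add, add_comm]
  congr 1
  · rw [Finset.sum_comm, Finset.mul_sum]
    refine Finset.sum_congr rfl fun h _ => ?_
    by_cases hm : G.mark h = none
    · simp only [if_pos hm, graphIntegral_markAt hlam ht, slicedBareProp]
    · simp only [if_neg hm, slicedBareProp, mul_zero, map_zero, integral_zero,
        Finset.sum_const_zero]
  · simp only [graphIntegral_insertPair hlam ht]
    simp only [Finset.mul_sum]
    rw [Finset.sum_comm' (t' := Finset.univ) (s' := fun _ => Finset.univ) (by simp)]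
    have hswap : ∀ f : Contraction Λ G.pair → Border → Border → Ix Λ → Option K →
        Option (Option K) → ℂ, ∑ s, ∑ k, ∑ s', ∑ p, ∑ o₁, ∑ o₂, f k s s' p o₁ o₂
          = ∑ o₁, ∑ o₂, ∑ s, ∑ s', ∑ k, ∑ p, f k s s' p o₁ o₂ := by
      intro f
      have h : ∑ q : Border × Contraction Λ G.pair × Border × Ix Λ × Option K × Option (Option K),
            f q.2.1 q.1 q.2.2.1 q.2.2.2.1 q.2.2.2.2.1 q.2.2.2.2.2
          = ∑ q : Option K × Option (Option K) × Border × Border × Contraction Λ G.pair × Ix Λ,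
            f q.2.2.2.2.1 q.2.2.1 q.2.2.2.1 q.2.2.2.2.2 q.1 q.2.1 :=
        Fintype.sum_equiv ⟨fun q => (q.2.2.2.2.1, q.2.2.2.2.2, q.1, q.2.2.1, q.2.1, q.2.2.2.1),
          fun q => (q.2.2.1, q.2.2.2.2.1, q.2.2.2.1, q.2.2.2.2.2, q.1, q.2.1),
          fun _ => rfl, fun _ => rfl⟩ _ _ fun _ => rfl
      simpa only [Fintype.sum_prod_type] using h
    rw [hswap]
    refine Finset.sum_congr rfl fun o₁ _ => Finset.sum_congr rfl fun o₂ _ =>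
      Finset.sum_congr rfl fun s _ => Finset.sum_congr rfl fun s' _ =>
      Finset.sum_congr rfl fun k _ => Finset.sum_congr rfl fun p _ => ?_
    have hfac : insertFactor (coupling lam) o₁ * insertFactor (coupling lam) o₂
        = insertWeight o₁ o₂ * (-lam) := by
      have h1 : insertFactor (coupling lam) o₁ * insertFactor (coupling lam) o₂
          = coupling lam ^ 2 *
            ((if o₁ = none then 1 / 2 else 1) * (if o₂ = none then 1 / 2 else 1)) := by
        unfold insertFactor
        split_ifs <;> ring
      rw [h1, coupling_sq, insertWeight]
      ring
    rw [hfac, pow_succ]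
    ring

end Derivation

/-! ### Labelled graphs -/

/-- A change of variables between two sums over subsets. -/
theorem sum_ite_bij {α β : Type*} [Fintype α] [Fintype β] {P : α → Prop} {Q : β → Prop}
    {_ : DecidablePred P} {_ : DecidablePred Q} {f : α → ℂ} {g : β → ℂ} (i : ∀ a, P a → β)
    (hi : ∀ a ha, Q (i a ha)) (inj : ∀ a ha b hb, i a ha = i b hb → a = b)
    (surj : ∀ b, Q b → ∃ a ha, i a ha = b) (h : ∀ a ha, f a = g (i a ha)) :
    ∑ a, (if P a then f a else 0) = ∑ b, if Q b then g b else 0 := by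
  rw [← Finset.sum_filter, ← Finset.sum_filter]
  refine Finset.sum_bij (fun a ha => i a (Finset.mem_filter.1 ha).2) ?_ ?_ ?_ ?_
  · exact fun a ha => Finset.mem_filter.2 ⟨Finset.mem_univ _, hi a _⟩
  · exact fun a ha b hb => inj a _ b _
  · intro b hb
    obtain ⟨a, ha, rfl⟩ := surj b (Finset.mem_filter.1 hb).2
    exact ⟨a, Finset.mem_filter.2 ⟨Finset.mem_univ _, ha⟩, rfl⟩
  · exact fun a ha => h a _

namespace ResolventGraph

variable {H H' : Type}

theorem ext_of_eq {G G' : ResolventGraph H} (h1 : G.next = G'.next) (h2 : G.pair = G'.pair)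
    (h3 : G.side = G'.side) (h4 : G.mark = G'.mark) : G = G' := by
  cases G; cases G'
  simp only at h1 h2 h3 h4
  subst h1 h2 h3 h4
  rfl

/-- Transport of a graph along a relabelling of its half-edges. -/
def relabel (e : H ≃ H') (G : ResolventGraph H) : ResolventGraph H' where
  next := e.permCongr G.next
  pair := e.permCongr G.pair
  pair_pair h := by simp [G.pair_pair]
  pair_ne h := by simp [← Equiv.eq_symm_apply, G.pair_ne]
  side h := G.side (e.symm h)
  mark h := G.mark (e.symm h)

theorem iso_relabel (e : H ≃ H') (G : ResolventGraph H) : G.Iso (G.relabel e) :=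
  ⟨e, fun h => by simp [relabel], fun h => by simp [relabel], fun h => by simp [relabel],
    fun h => by simp [relabel]⟩

theorem relabel_symm_relabel (e : H ≃ H') (G : ResolventGraph H) :
    (G.relabel e).relabel e.symm = G :=
  ext_of_eq (by ext h; simp [relabel]) (by ext h; simp [relabel]) (by funext h; simp [relabel])
    (by funext h; simp [relabel])

theorem eq_relabel {G : ResolventGraph H} {G' : ResolventGraph H'} (e : H ≃ H')
    (h1 : ∀ h, e (G.next h) = G'.next (e h)) (h2 : ∀ h, e (G.pair h) = G'.pair (e h))
    (h3 : ∀ h, G'.side (e h) = G.side h) (h4 : ∀ h, G'.mark (e h) = G.mark h) :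
    G.relabel e = G' :=
  ext_of_eq (by ext h; simp [relabel, h1]) (by ext h; simp [relabel, h2])
    (by funext h; simp [relabel, ← h3]) (by funext h; simp [relabel, ← h4])

theorem Iso.markedBy {G : ResolventGraph H} {G' : ResolventGraph H'} (h : G.Iso G') {Ω : Finset ℕ}
    (hG : G.MarkedBy Ω) : G'.MarkedBy Ω := by
  obtain ⟨e, _, _, _, h4⟩ := h
  refine ⟨fun k ω hk => hG.1 (e.symm k) ω (by rw [← h4]; simpa using hk), fun ω hω => ?_⟩
  obtain ⟨k, hk, hu⟩ := hG.2 ω hω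
  refine ⟨e k, by simpa [h4] using hk, fun k' hk' => ?_⟩
  rw [← hu (e.symm k') (by simpa [← h4] using hk'), Equiv.apply_symm_apply]

/-- Covered graphs with all marks distinct have no automorphisms: an automorphism fixes the marked
half-edges, and so their partners. -/
theorem Covered.automorphism_eq_refl {G : ResolventGraph H} (hG : G.Covered) {Ω : Finset ℕ}
    (hΩ : G.MarkedBy Ω) (e : H ≃ H) (h2 : ∀ h, e (G.pair h) = G.pair (e h))
    (h4 : ∀ h, G.mark (e h) = G.mark h) : e = Equiv.refl H := by
  have key : ∀ h, (G.mark h).isSome → e h = h := by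
    intro h hh
    obtain ⟨ω, hω⟩ := Option.isSome_iff_exists.1 hh
    exact (hΩ.2 ω (hΩ.1 h ω hω)).unique ((h4 h).trans hω) hω
  ext h
  rcases hG h with hh | hh
  · exact key h hh
  · exact G.pair.injective ((h2 h).symm.trans (key _ hh))

/-- Covered graphs marked by `Ω` are minimal: the marked half-edges and their partners are all the
half-edges, so that there are at most `2 |Ω|` of them. -/
theorem Covered.isMinimal [Finite H] {G : ResolventGraph H} (hG : G.Covered) {Ω : Finset ℕ}
    (hΩ : G.MarkedBy Ω) : G.IsMinimal Ω := by
  refine ⟨hΩ, fun K => ?_, ?_⟩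
  · obtain ⟨h, rfl⟩ := Quotient.exists_rep K
    rcases hG h with hh | hh
    · exact ⟨h, rfl, hh⟩
    · exact ⟨G.pair h, G.toComponent_pair h, hh⟩
  · classical
    have := Fintype.ofFinite H
    set S : Finset H := Finset.univ.filter fun h => (G.mark h).isSome with hS
    have hcard : S.card ≤ Ω.card := by
      refine Finset.card_le_card_of_injOn (fun h => (G.mark h).getD 0) ?_ ?_
      · intro h hh
        obtain ⟨ω, hω⟩ := Option.isSome_iff_exists.1 (Finset.mem_filter.1 hh).2
        simpa [hω] using hΩ.1 h ω hω
      · intro h hh h' hh' he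
        obtain ⟨ω, hω⟩ := Option.isSome_iff_exists.1 (Finset.mem_filter.1 hh).2
        obtain ⟨ω', hω'⟩ := Option.isSome_iff_exists.1 (Finset.mem_filter.1 hh').2
        simp only [hω, hω', Option.getD_some] at he
        subst he
        exact (hΩ.2 ω (hΩ.1 h ω hω)).unique hω hω'
    have hcover : (Finset.univ : Finset H) ⊆ S ∪ S.image G.pair := by
      intro h _
      rcases hG h with hh | hh
      · exact Finset.mem_union_left _ (Finset.mem_filter.2 ⟨Finset.mem_univ _, hh⟩)
      · exact Finset.mem_union_right _ (Finset.mem_image.2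
          ⟨G.pair h, Finset.mem_filter.2 ⟨Finset.mem_univ _, hh⟩, G.pair_pair h⟩)
    have h1 := (Finset.card_le_card hcover).trans
      ((Finset.card_union_le _ _).trans (add_le_add le_rfl Finset.card_image_le))
    rw [order, Nat.card_eq_fintype_card, ← Finset.card_univ]
    omega

end ResolventGraph

open ResolventGraph

/-- Covered graphs with set `H` of half-edges, marked by `Ω`. -/
def CoveredGraph (Ω : Finset ℕ) (H : Type) : Type :=
  {G : ResolventGraph H // G.Covered ∧ G.MarkedBy Ω}

instance (Ω : Finset ℕ) (H : Type) [Finite H] : Finite (CoveredGraph Ω H) := by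
  classical
  have := Fintype.ofFinite H
  let f : CoveredGraph Ω H → Equiv.Perm H × Equiv.Perm H × (H → Border) × (H → Option Ω) := fun G =>
    (G.1.next, G.1.pair, G.1.side, fun h => (G.1.mark h).pmap (fun ω hω => ⟨ω, hω⟩)
      (fun ω hω => G.2.2.1 h ω hω))
  refine Finite.of_injective f ?_
  rintro ⟨G, hG⟩ ⟨G', hG'⟩ h
  simp only [f, Prod.mk.injEq] at h
  obtain ⟨h1, h2, h3, hm⟩ := h
  refine Subtype.ext (ext_of_eq h1 h2 h3 ?_)
  funext k
  have hk := congrArg (Option.map Subtype.val) (congrFun hm k)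
  simpa [Option.map_pmap] using hk

instance (Ω : Finset ℕ) (H : Type) [Finite H] : Fintype (CoveredGraph Ω H) := Fintype.ofFinite _

instance (Ω : Finset ℕ) (n : ℕ) : Fintype (Quotient (labelledSetoid Ω n)) := Fintype.ofFinite _

/-- Relabelling as an equivalence of sets of covered graphs. -/
def relabelEquiv (Ω : Finset ℕ) {H H' : Type} (e : H ≃ H') :
    CoveredGraph Ω H ≃ CoveredGraph Ω H' where
  toFun G := ⟨G.1.relabel e, (G.1.iso_relabel e).covered_iff.1 G.2.1,
    (G.1.iso_relabel e).markedBy G.2.2⟩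
  invFun G := ⟨G.1.relabel e.symm, (G.1.iso_relabel e.symm).covered_iff.1 G.2.1,
    (G.1.iso_relabel e.symm).markedBy G.2.2⟩
  left_inv G := Subtype.ext (relabel_symm_relabel e G.1)
  right_inv G := Subtype.ext (relabel_symm_relabel e.symm G.1)

/-! ### Sums over isomorphism classes and marking -/

section Sums

/-- Functions of graphs which are invariant under isomorphism. -/
def IsoInvariant (F : (H : Type) → [Fintype H] → ResolventGraph H → ℂ) : Prop :=
  ∀ (H H' : Type) [Fintype H] [Fintype H'] (G : ResolventGraph H) (G' : ResolventGraph H'),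
    G.Iso G' → F H G = F H' G'

variable {F : (H : Type) → [Fintype H] → ResolventGraph H → ℂ}

open Classical in
/-- As covered marked graphs have no automorphisms, each isomorphism class is represented by `(2n)!`
labelled graphs. -/
theorem sum_coveredGraph_eq (hF : IsoInvariant F) (Ω : Finset ℕ) (n : ℕ) :
    ∑ G : CoveredGraph Ω (Fin (2 * n)), F _ G.1
      = ((2 * n).factorial : ℂ) * ∑ q : Quotient (labelledSetoid Ω n),
        if (Quotient.out q).1.Covered then F _ (Quotient.out q).1 else 0 := by
  have h1 : ((2 * n).factorial : ℂ) * ∑ q : Quotient (labelledSetoid Ω n),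
        (if (Quotient.out q).1.Covered then F _ (Quotient.out q).1 else 0)
      = ∑ p : Quotient (labelledSetoid Ω n) × Equiv.Perm (Fin (2 * n)),
        if (Quotient.out p.1).1.Covered then F _ (Quotient.out p.1).1 else 0 := by
    rw [Fintype.sum_prod_type]
    simp only [Finset.sum_const, Finset.card_univ, Fintype.card_perm, Fintype.card_fin,
      nsmul_eq_mul, Finset.mul_sum]
  have h2 : ∑ G : CoveredGraph Ω (Fin (2 * n)), F _ G.1
      = ∑ G : CoveredGraph Ω (Fin (2 * n)), if True then F _ G.1 else 0 := by simp
  rw [h1, h2]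
  symm
  -- A labelled graph is a relabelling of the representative of its class, in a unique way.
  refine sum_ite_bij (fun p hp => ⟨(Quotient.out p.1).1.relabel p.2,
    ((Quotient.out p.1).1.iso_relabel p.2).covered_iff.1 hp,
    ((Quotient.out p.1).1.iso_relabel p.2).markedBy (Quotient.out p.1).2.1⟩) (fun _ _ => trivial)
    ?_ ?_ fun p hp => hF _ _ _ _ (iso_relabel _ _)
  · rintro ⟨q, e⟩ hq ⟨q', e'⟩ hq' h
    have h := congrArg Subtype.val h
    simp only at h hq hq'
    have hqq : q = q' := by
      rw [← Quotient.out_eq q, ← Quotient.out_eq q']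
      refine Quotient.sound (s := labelledSetoid Ω n) ?_
      change (Quotient.out q).1.Iso (Quotient.out q').1
      have h3 := iso_relabel e (Quotient.out q).1
      rw [h] at h3
      exact h3.trans (iso_relabel e' _).symm
    subst hqq
    have hpair : ∀ k, (e.trans e'.symm) ((Quotient.out q).1.pair k)
        = (Quotient.out q).1.pair ((e.trans e'.symm) k) := by
      intro k
      have := congrArg (fun G => e'.symm (G.pair (e k))) h
      simpa [relabel] using this
    have hmark : ∀ k, (Quotient.out q).1.mark ((e.trans e'.symm) k)
        = (Quotient.out q).1.mark k := by
      intro k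
      have := congrArg (fun G => G.mark (e k)) h
      simpa [relabel] using this.symm
    have h4 := hq.automorphism_eq_refl (Quotient.out q).2.1 (e.trans e'.symm) hpair hmark
    have : e = e' := by
      ext k
      have := congrArg (fun f => e' (f k)) h4
      simpa using congrArg Fin.val this
    rw [this]
  · intro G _
    obtain ⟨G, hG, hΩ⟩ := G
    let q : Quotient (labelledSetoid Ω n) := Quotient.mk _ ⟨G, hG.isMinimal hΩ⟩
    have hq : (Quotient.out q).1.Iso G := Quotient.mk_out (s := labelledSetoid Ω n)
      (⟨G, hG.isMinimal hΩ⟩ : LabelledMinimal Ω n)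
    have hc := hq.covered_iff.2 hG
    obtain ⟨e, h1, h2, h3, h4⟩ := hq
    exact ⟨(q, e), hc, Subtype.ext (eq_relabel e h1 h2 h3 h4)⟩

open Classical in
/-- The graphs in which the partner of the half-edge with the mark `ω` is marked come from marking a
graph. -/
theorem sum_markAt {H : Type} [Fintype H] [DecidableEq H] (Ω : Finset ℕ) {ω : ℕ} (hω : ω ∉ Ω) :
    ∑ G : CoveredGraph (insert ω Ω) H, (if ∃ h, G.1.mark h = some ω ∧ G.1.mark (G.1.pair h) ≠ none
        then F H G.1 else 0)
      = ∑ G : CoveredGraph Ω H, ∑ h, if G.1.mark h = none then F H (G.1.markAt ω h) else 0 := by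
  rw [← Fintype.sum_prod_type'
    (f := fun (G : CoveredGraph Ω H) h => if G.1.mark h = none then F H (G.1.markAt ω h) else 0)]
  symm
  have hne : ∀ (G : CoveredGraph Ω H) h, G.1.mark h ≠ some ω := fun G h hh =>
    hω (G.2.2.1 h ω hh)
  have hmark : ∀ (G : ResolventGraph H) h, (G.markAt ω h).mark h = some ω := fun G h => by
    simp [markAt]
  have hmark' : ∀ (G : ResolventGraph H) h h', h' ≠ h → (G.markAt ω h).mark h' = G.mark h' :=
    fun G h h' hh => by simp [markAt, hh]
  refine sum_ite_bij (fun p hp => ⟨p.1.1.markAt ω p.2, fun k => ?_, fun k ω' hk => ?_,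
    fun ω' hω' => ?_⟩) ?_ ?_ ?_ fun p hp => rfl
  · have := p.1.2.1 k
    simp only [markAt, Function.update_apply]
    split_ifs <;> simp_all
  · by_cases hkh : k = p.2
    · subst hkh
      rw [hmark] at hk
      simp_all
    · rw [hmark' _ _ _ hkh] at hk
      exact Finset.mem_insert_of_mem (p.1.2.2.1 k ω' hk)
  · rcases Finset.mem_insert.1 hω' with rfl | hΩ'
    · refine ⟨p.2, hmark _ _, fun k hk => ?_⟩
      by_contra hkh
      simp only [hmark' _ _ _ hkh] at hk
      exact hne _ _ hk
    · obtain ⟨k, hk, hu⟩ := p.1.2.2.2 ω' hΩ'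
      have hkp : k ≠ p.2 := by
        rintro rfl
        rw [hk] at hp
        exact absurd hp (by simp)
      refine ⟨k, by simpa only [hmark' _ _ _ hkp] using hk, fun k' hk' => ?_⟩
      by_cases hkh : k' = p.2
      · subst hkh
        simp only [hmark, Option.some.injEq] at hk'
        subst hk'
        exact absurd hΩ' hω
      · simp only [hmark' _ _ _ hkh] at hk'
        exact hu k' hk'
  · rintro ⟨G, h⟩ hp
    simp only at hp
    refine ⟨h, hmark _ _, ?_⟩
    change (G.1.markAt ω h).mark (G.1.pair h) ≠ none
    rw [hmark' _ _ _ (G.1.pair_ne h)]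
    have := G.2.1 h
    rw [hp] at this
    simpa [Option.isSome_iff_ne_none] using this
  · rintro ⟨G, h⟩ hp ⟨G', h'⟩ hp' he
    have he := congrArg Subtype.val he
    simp only at he hp hp'
    have hh : h = h' := by
      by_contra hh
      have h1 := hmark G.1 h
      rw [he, hmark' _ _ _ hh] at h1
      exact hne G' h h1
    subst hh
    have hGG : G.1 = G'.1 := by
      refine ext_of_eq (congrArg next he :) (congrArg pair he :) (congrArg side he :) ?_
      funext k
      by_cases hk : k = h
      · subst hk; rw [hp, hp']
      · rw [← hmark' G.1 h k hk, he, hmark' _ _ _ hk]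
    rw [Subtype.ext hGG]
  · rintro ⟨G, hG, hΩ⟩ ⟨h, hh, hh'⟩
    simp only at hh hh'
    have hk : ∀ k, k ≠ h → G.mark k ≠ some ω := fun k hk hk' =>
      hk ((hΩ.2 ω (Finset.mem_insert_self _ _)).unique hk' hh)
    -- Erasing the mark `ω` leaves a covered graph, as the partner of its half-edge is marked.
    let G₀ : ResolventGraph H := { G with mark := Function.update G.mark h none }
    have hm0 : ∀ k, k ≠ h → G₀.mark k = G.mark k := fun k hk => by simp [G₀, hk]
    have hm1 : G₀.mark h = none := by simp [G₀]
    have hc0 : G₀.Covered := by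
      intro k
      change (G₀.mark k).isSome ∨ (G₀.mark (G.pair k)).isSome
      by_cases hk1 : k = h
      · subst hk1
        rw [hm0 _ (G.pair_ne k)]
        exact Or.inr (Option.isSome_iff_ne_none.2 hh')
      · by_cases hk2 : G.pair k = h
        · have hk3 : k = G.pair h := by rw [← hk2, G.pair_pair]
          rw [hm0 _ hk1, hk3]
          exact Or.inl (Option.isSome_iff_ne_none.2 hh')
        · rw [hm0 _ hk1, hm0 _ hk2]
          exact hG k
    have hΩ0 : G₀.MarkedBy Ω := by
      refine ⟨fun k ω' hk' => ?_, fun ω' hω' => ?_⟩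
      · have hkh : k ≠ h := by
          rintro rfl
          rw [hm1] at hk'
          exact absurd hk' (by simp)
        rw [hm0 _ hkh] at hk'
        refine (Finset.mem_insert.1 (hΩ.1 k ω' hk')).resolve_left ?_
        rintro rfl
        exact hk k hkh hk'
      · obtain ⟨k, hk', hu⟩ := hΩ.2 ω' (Finset.mem_insert_of_mem hω')
        have hkh : k ≠ h := by
          rintro rfl
          rw [hh, Option.some.injEq] at hk'
          subst hk'
          exact hω hω'
        refine ⟨k, by simpa only [hm0 _ hkh] using hk', fun k' hk'' => ?_⟩
        by_cases hkh' : k' = h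
        · subst hkh'
          simp only [hm1] at hk''
          exact absurd hk'' (by simp)
        · simp only [hm0 _ hkh'] at hk''
          exact hu k' hk''
    refine ⟨(⟨G₀, hc0, hΩ0⟩, h), hm1, Subtype.ext (ext_of_eq rfl rfl rfl ?_)⟩
    funext k
    by_cases hkh : k = h
    · subst hkh
      simp only [hmark, hh]
    · change (G₀.markAt ω h).mark k = _
      rw [hmark' _ _ _ hkh, hm0 _ hkh]

end Sums

/-! ### Sums over insertions of a propagator -/

section Insertions

variable {H : Type} [DecidableEq H]

theorem insertPair_covered {G : ResolventGraph H} (hG : G.Covered) (ω : ℕ) (o₁ : Option H)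
    (o₂ : Option (Option H)) (s s' : Border) : (G.insertPair ω o₁ o₂ s s').Covered := by
  intro h
  rcases h with _ | _ | h
  · rw [insertPair_pair_none]; exact Or.inr rfl
  · exact Or.inl rfl
  · rw [insertPair_pair_some_some]; exact hG h

theorem insertPair_markedBy {G : ResolventGraph H} {Ω : Finset ℕ} (hG : G.MarkedBy Ω) {ω : ℕ}
    (hω : ω ∉ Ω) (o₁ : Option H) (o₂ : Option (Option H)) (s s' : Border) :
    (G.insertPair ω o₁ o₂ s s').MarkedBy (insert ω Ω) := by
  refine ⟨fun h ω' hh => ?_, fun ω' hω' => ?_⟩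
  · rcases h with _ | _ | h
    · exact absurd hh (by simp [insertPair])
    · obtain rfl : ω = ω' := Option.some.inj hh
      exact Finset.mem_insert_self _ _
    · exact Finset.mem_insert_of_mem (hG.1 h ω' hh)
  · rcases Finset.mem_insert.1 hω' with rfl | hΩ
    · refine ⟨some none, rfl, fun h hh => ?_⟩
      rcases h with _ | _ | h
      · exact absurd hh (by simp [insertPair])
      · rfl
      · exact absurd (hG.1 h ω' hh) hω
    · obtain ⟨k, hk, hu⟩ := hG.2 ω' hΩ
      refine ⟨some (some k), hk, fun h hh => ?_⟩
      rcases h with _ | _ | h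
      · exact absurd hh (by simp [insertPair])
      · obtain rfl : ω = ω' := Option.some.inj hh
        exact absurd hΩ hω
      · rw [hu h hh]

theorem insertPair_injective {G G' : ResolventGraph H} {ω : ℕ} {o₁ o₁' : Option H}
    {o₂ o₂' : Option (Option H)} {s s' t t' : Border}
    (h : G.insertPair ω o₁ o₂ s s' = G'.insertPair ω o₁' o₂' t t') :
    G = G' ∧ o₁ = o₁' ∧ o₂ = o₂' ∧ s = t ∧ s' = t' := by
  have h1 := congrArg next h
  have h2 := congrArg pair h
  have h3 := congrArg side h
  have h4 := congrArg mark h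
  simp only [insertPair, EmbeddingLike.apply_eq_iff_eq, Prod.mk.injEq, true_and] at h1 h2
  refine ⟨ext_of_eq h1.2.2 h2 ?_ ?_, h1.2.1, h1.1, congrFun h3 (some none), congrFun h3 none⟩
  · funext k; exact congrFun h3 (some (some k))
  · funext k; exact congrFun h4 (some (some k))

theorem exists_decomposeOption (σ : Equiv.Perm (Option H)) :
    ∃ o τ, σ = Equiv.Perm.decomposeOption.symm (o, τ) :=
  ⟨(Equiv.Perm.decomposeOption σ).1, (Equiv.Perm.decomposeOption σ).2, by simp⟩

/-- Every graph in which the half-edge `some none` is the one with the mark `ω`, and has the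
unmarked partner `none`, comes from an insertion. -/
theorem exists_insertPair (G : ResolventGraph (Option (Option H))) (ω : ℕ)
    (h1 : G.mark (some none) = some ω) (h2 : G.pair (some none) = none) (h3 : G.mark none = none) :
    ∃ (G₀ : ResolventGraph H) (o₁ : Option H) (o₂ : Option (Option H)) (s s' : Border),
      G₀.insertPair ω o₁ o₂ s s' = G := by
  obtain ⟨o₂, τ₁, hτ₁⟩ := exists_decomposeOption G.next
  obtain ⟨o₁, τ, hτ⟩ := exists_decomposeOption τ₁
  obtain ⟨q₂, π₁, hπ₁⟩ := exists_decomposeOption G.pair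
  obtain ⟨q₁, π, hπ⟩ := exists_decomposeOption π₁
  have h4 : G.pair none = some none := by rw [← h2, G.pair_pair]
  obtain rfl : q₂ = some none := by rw [← h4, hπ₁]; simp
  obtain rfl : q₁ = none := by
    have h5 : G.pair (some none) = none := h2
    rw [hπ₁, hπ] at h5
    cases q₁ with
    | none => rfl
    | some q => simp [Equiv.swap_apply_def] at h5
  have h6 : ∀ h, G.pair (some (some h)) = some (some (π h)) := fun h => by
    rw [hπ₁, hπ]
    simp [Equiv.swap_apply_of_ne_of_ne]
  let G₀ : ResolventGraph H :=
    { next := τ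
      pair := π
      pair_pair := fun h => by
        have := G.pair_pair (some (some h))
        simpa [h6] using this
      pair_ne := fun h hh => G.pair_ne (some (some h)) (by rw [h6, hh])
      side := fun h => G.side (some (some h))
      mark := fun h => G.mark (some (some h)) }
  refine ⟨G₀, o₁, o₂, G.side (some none), G.side none, ext_of_eq ?_ ?_ ?_ ?_⟩
  · rw [hτ₁, hτ]; rfl
  · rw [hπ₁, hπ]; rfl
  · funext h; rcases h with _ | _ | h <;> rfl
  · funext h
    rcases h with _ | _ | h
    · exact h3.symm
    · exact h1.symm
    · rfl

theorem covered_of_insertPair {G : ResolventGraph H} {ω : ℕ} {o₁ : Option H}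
    {o₂ : Option (Option H)} {s s' : Border} (h : (G.insertPair ω o₁ o₂ s s').Covered) :
    G.Covered := by
  intro k
  have := h (some (some k))
  rwa [insertPair_pair_some_some] at this

theorem markedBy_of_insertPair {G : ResolventGraph H} {Ω : Finset ℕ} {ω : ℕ} (hω : ω ∉ Ω)
    {o₁ : Option H} {o₂ : Option (Option H)} {s s' : Border}
    (h : (G.insertPair ω o₁ o₂ s s').MarkedBy (insert ω Ω)) : G.MarkedBy Ω := by
  refine ⟨fun k ω' hk => ?_, fun ω' hω' => ?_⟩
  · refine (Finset.mem_insert.1 (h.1 (some (some k)) ω' hk)).resolve_left ?_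
    rintro rfl
    have := (h.2 ω' (Finset.mem_insert_self _ _)).unique
      (y₁ := some (some k)) (y₂ := some none) hk rfl
    simp at this
  · obtain ⟨k, hk, hu⟩ := h.2 ω' (Finset.mem_insert_of_mem hω')
    rcases k with _ | _ | k
    · exact absurd hk (by simp [insertPair])
    · obtain rfl : ω = ω' := Option.some.inj hk
      exact absurd hω' hω
    · refine ⟨k, hk, fun k' hk' => ?_⟩
      simpa using hu (some (some k')) hk'

end Insertions

section InsertionSums

variable {F : (H : Type) → [Fintype H] → ResolventGraph H → ℂ}

open Classical in
/-- The sum over the graphs in which the half-edge with the mark `ω` is `a`, and has the unmarked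
partner `b`. -/
def pairSum (F : (H : Type) → [Fintype H] → ResolventGraph H → ℂ) (Ω : Finset ℕ) (ω : ℕ)
    (H : Type) [Fintype H] (a b : H) : ℂ :=
  ∑ G : CoveredGraph Ω H,
    if G.1.mark a = some ω ∧ G.1.pair a = b ∧ G.1.mark b = none then F H G.1 else 0

theorem pairSum_relabel (hF : IsoInvariant F) (Ω : Finset ℕ) (ω : ℕ) {H H' : Type} [Fintype H]
    [Fintype H'] (e : H ≃ H') (a b : H) : pairSum F Ω ω H a b = pairSum F Ω ω H' (e a) (e b) := by
  refine Fintype.sum_equiv (relabelEquiv Ω e) _ _ fun G => ?_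
  rw [hF _ _ _ _ (iso_relabel e G.1)]
  have h : (G.1.mark a = some ω ∧ G.1.pair a = b ∧ G.1.mark b = none) ↔
      ((relabelEquiv Ω e G).1.mark (e a) = some ω ∧ (relabelEquiv Ω e G).1.pair (e a) = e b ∧
        (relabelEquiv Ω e G).1.mark (e b) = none) := by
    change _ ↔ ((G.1.relabel e).mark (e a) = some ω ∧ (G.1.relabel e).pair (e a) = e b ∧
        (G.1.relabel e).mark (e b) = none)
    simp [relabel]
  by_cases hP : G.1.mark a = some ω ∧ G.1.pair a = b ∧ G.1.mark b = none
  · rw [if_pos hP, if_pos (h.1 hP)]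
    rfl
  · rw [if_neg hP, if_neg (mt h.2 hP)]

theorem pairSum_self (Ω : Finset ℕ) (ω : ℕ) {H : Type} [Fintype H] (a : H) :
    pairSum F Ω ω H a a = 0 :=
  Finset.sum_eq_zero fun G _ => if_neg fun h => G.1.pair_ne a h.2.1

/-- With the labels `some none` and `none` for the two ends of the propagator, the graphs are
exactly the results of the insertions. -/
theorem pairSum_insertPair {Ω : Finset ℕ} {ω : ℕ} (hω : ω ∉ Ω) (H : Type) [Fintype H]
    [DecidableEq H] :
    pairSum F (insert ω Ω) ω (Option (Option H)) (some none) none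
      = ∑ G : CoveredGraph Ω H, ∑ o₁ : Option H, ∑ o₂ : Option (Option H), ∑ s, ∑ s',
          F _ (G.1.insertPair ω o₁ o₂ s s') := by
  classical
  have h1 : ∑ G : CoveredGraph Ω H, ∑ o₁ : Option H, ∑ o₂ : Option (Option H), ∑ s, ∑ s',
          F _ (G.1.insertPair ω o₁ o₂ s s')
      = ∑ p : CoveredGraph Ω H × Option H × Option (Option H) × Border × Border,
        if True then F _ (p.1.1.insertPair ω p.2.1 p.2.2.1 p.2.2.2.1 p.2.2.2.2) else 0 := by
    simp only [Fintype.sum_prod_type, if_true]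
  rw [h1, pairSum]
  symm
  refine sum_ite_bij (fun p _ => ⟨p.1.1.insertPair ω p.2.1 p.2.2.1 p.2.2.2.1 p.2.2.2.2,
    insertPair_covered p.1.2.1 _ _ _ _ _, insertPair_markedBy p.1.2.2 hω _ _ _ _⟩) ?_ ?_ ?_
    fun _ _ => rfl
  · rintro p -
    exact ⟨rfl, insertPair_pair_some_none _ _ _ _ _ _, rfl⟩
  · rintro ⟨G, o₁, o₂, s, s'⟩ - ⟨G', o₁', o₂', t, t'⟩ - h
    obtain ⟨h1, h2, h3, h4, h5⟩ := insertPair_injective (congrArg Subtype.val h)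
    exact Prod.ext (Subtype.ext h1) (Prod.ext h2 (Prod.ext h3 (Prod.ext h4 h5)))
  · rintro ⟨G, hG, hΩ⟩ ⟨h1, h2, h3⟩
    obtain ⟨G₀, o₁, o₂, s, s', rfl⟩ := exists_insertPair G ω h1 h2 h3
    exact ⟨(⟨G₀, covered_of_insertPair hG, markedBy_of_insertPair hω hΩ⟩, o₁, o₂, s, s'), trivial,
      rfl⟩

theorem exists_equiv_option_option {H H' : Type} (e₀ : H' ≃ Option (Option H)) {a b : H'}
    (hab : a ≠ b) : ∃ e : H' ≃ Option (Option H), e a = some none ∧ e b = none := by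
  classical
  let e₁ : H' ≃ Option (Option H) := e₀.trans (Equiv.swap (e₀ a) (some none))
  have ha : e₁ a = some none := by simp [e₁]
  have hb : e₁ b ≠ some none := fun h => hab (e₁.injective (ha.trans h.symm))
  refine ⟨e₁.trans (Equiv.swap (e₁ b) none), ?_, by simp⟩
  rw [Equiv.trans_apply, ha]
  exact Equiv.swap_apply_of_ne_of_ne hb.symm (by simp)

open Classical in
/-- The graphs in which the partner of the half-edge with the mark `ω` is unmarked come from
inserting a propagator; there are `(2n + 2) (2n + 1)` choices for the labels of its two ends. -/
theorem sum_insertPair (hF : IsoInvariant F) {Ω : Finset ℕ} {ω : ℕ} (hω : ω ∉ Ω) (n : ℕ) :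
    ∑ G : CoveredGraph (insert ω Ω) (Fin (2 * (n + 1))),
        (if ∃ h, G.1.mark h = some ω ∧ G.1.mark (G.1.pair h) ≠ none then 0 else F _ G.1)
      = ((2 * n + 2 : ℕ) : ℂ) * ((2 * n + 1 : ℕ) : ℂ) *
        ∑ G : CoveredGraph Ω (Fin (2 * n)), ∑ o₁ : Option (Fin (2 * n)),
          ∑ o₂ : Option (Option (Fin (2 * n))), ∑ s, ∑ s', F _ (G.1.insertPair ω o₁ o₂ s s') := by
  have h1 : ∀ G : CoveredGraph (insert ω Ω) (Fin (2 * (n + 1))),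
      (if ∃ h, G.1.mark h = some ω ∧ G.1.mark (G.1.pair h) ≠ none then 0 else F _ G.1)
        = ∑ a, ∑ b, if G.1.mark a = some ω ∧ G.1.pair a = b ∧ G.1.mark b = none
          then F _ G.1 else 0 := by
    intro G
    obtain ⟨h, hh, hu⟩ := G.2.2.2 ω (Finset.mem_insert_self _ _)
    rw [Finset.sum_eq_single h, Finset.sum_eq_single (G.1.pair h)]
    · by_cases hm : G.1.mark (G.1.pair h) = none
      · rw [if_neg, if_pos ⟨hh, rfl, hm⟩]
        rintro ⟨k, hk, hk'⟩
        rw [hu k hk] at hk'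
        exact hk' hm
      · rw [if_pos ⟨h, hh, hm⟩, if_neg fun h => hm h.2.2]
    · exact fun b _ hb => if_neg fun h' => hb h'.2.1.symm
    · simp
    · exact fun a _ ha => Finset.sum_eq_zero fun b _ => if_neg fun h' => ha (hu a h'.1)
    · simp
  simp only [h1]
  rw [Finset.sum_comm]
  have h2 : ∀ a : Fin (2 * (n + 1)), ∑ G : CoveredGraph (insert ω Ω) (Fin (2 * (n + 1))), ∑ b,
      (if G.1.mark a = some ω ∧ G.1.pair a = b ∧ G.1.mark b = none then F _ G.1 else 0)
      = ∑ b, pairSum F (insert ω Ω) ω (Fin (2 * (n + 1))) a b := fun a => by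
    rw [Finset.sum_comm]
    refine Finset.sum_congr rfl fun b _ => Finset.sum_congr rfl fun G _ => ?_
    congr
  simp only [h2]
  have e₀ : Fin (2 * (n + 1)) ≃ Option (Option (Fin (2 * n))) :=
    Fintype.equivOfCardEq (by simp; ring)
  -- By invariance, all the labels `a ≠ b` of the two ends contribute equally.
  have h3 : ∀ a b : Fin (2 * (n + 1)), pairSum F (insert ω Ω) ω (Fin (2 * (n + 1))) a b
      = if b = a then 0 else
        pairSum F (insert ω Ω) ω (Option (Option (Fin (2 * n)))) (some none) none := by
    intro a b
    by_cases hab : b = a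
    · rw [if_pos hab, hab, pairSum_self]
    · obtain ⟨e, ha, hb⟩ := exists_equiv_option_option e₀ (Ne.symm hab)
      rw [if_neg hab, pairSum_relabel hF _ _ e, ha, hb]
  simp only [h3, pairSum_insertPair hω]
  generalize (∑ G : CoveredGraph Ω (Fin (2 * n)), ∑ o₁ : Option (Fin (2 * n)),
          ∑ o₂ : Option (Option (Fin (2 * n))), ∑ s, ∑ s', F _ (G.1.insertPair ω o₁ o₂ s s')) = S
  have h4 : ∀ a : Fin (2 * (n + 1)), ∑ b, (if b = a then 0 else S) = ((2 * n + 1 : ℕ) : ℂ) * S := by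
    intro a
    rw [← Finset.add_sum_erase _ _ (Finset.mem_univ a), if_pos rfl, zero_add,
      Finset.sum_congr rfl fun b hb => if_neg (Finset.ne_of_mem_erase hb), Finset.sum_const,
      Finset.card_erase_of_mem (Finset.mem_univ a), Finset.card_univ, Fintype.card_fin,
      nsmul_eq_mul]
    rfl
  simp only [h4, Finset.sum_const, Finset.card_univ, Fintype.card_fin, nsmul_eq_mul, mul_assoc]
  rfl

/-- The sum over the covered labelled graphs with `2n` half-edges, per labelling. -/
def labelledSum (F : (H : Type) → [Fintype H] → ResolventGraph H → ℂ) (Ω : Finset ℕ) (n : ℕ) : ℂ :=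
  ((2 * n).factorial : ℂ)⁻¹ * ∑ G : CoveredGraph Ω (Fin (2 * n)), F _ G.1

open Classical in
/-- The operations of marking and of insertion exhaust the covered graphs with one more mark. -/
theorem sum_labelledSum_insert (hF : IsoInvariant F) {Ω : Finset ℕ} {ω : ℕ} (hω : ω ∉ Ω) :
    ∑ n ∈ Finset.range ((insert ω Ω).card + 1), labelledSum F (insert ω Ω) n
      = ∑ n ∈ Finset.range (Ω.card + 1), ((2 * n).factorial : ℂ)⁻¹ *
        ∑ G : CoveredGraph Ω (Fin (2 * n)),
          ((∑ h, if G.1.mark h = none then F _ (G.1.markAt ω h) else 0)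
            + ∑ o₁ : Option (Fin (2 * n)), ∑ o₂ : Option (Option (Fin (2 * n))), ∑ s, ∑ s',
              F _ (G.1.insertPair ω o₁ o₂ s s')) := by
  have hsplit : ∀ n, ∑ G : CoveredGraph (insert ω Ω) (Fin (2 * n)), F _ G.1
      = (∑ G : CoveredGraph Ω (Fin (2 * n)),
          ∑ h, if G.1.mark h = none then F _ (G.1.markAt ω h) else 0)
        + ∑ G : CoveredGraph (insert ω Ω) (Fin (2 * n)),
        (if ∃ h, G.1.mark h = some ω ∧ G.1.mark (G.1.pair h) ≠ none then 0 else F _ G.1) := by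
    intro n
    rw [← sum_markAt Ω hω, ← Finset.sum_add_distrib]
    refine Finset.sum_congr rfl fun G _ => ?_
    split_ifs <;> simp
  simp only [labelledSum, hsplit, mul_add, Finset.sum_add_distrib]
  rw [Finset.card_insert_of_notMem hω]
  congr 1
  -- Marking does not change the order, which is at most `|Ω|`.
  · rw [Finset.sum_range_succ]
    have : IsEmpty (CoveredGraph Ω (Fin (2 * (Ω.card + 1)))) := ⟨fun G => by
      have := (G.2.1.isMinimal G.2.2).2.2
      simp only [order, Nat.card_eq_fintype_card, Fintype.card_fin] at this
      omega⟩
    simp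
  -- Insertion raises the order by one; the choices of labels are absorbed by the factorials.
  · rw [Finset.sum_range_succ']
    have h0 : ∑ G : CoveredGraph (insert ω Ω) (Fin (2 * 0)),
        (if ∃ h, G.1.mark h = some ω ∧ G.1.mark (G.1.pair h) ≠ none then 0 else F _ G.1) = 0 := by
      refine Finset.sum_eq_zero fun G _ => ?_
      obtain ⟨h, _⟩ := G.2.2.2 ω (Finset.mem_insert_self _ _)
      exact Fin.elim0 h
    rw [h0, mul_zero, add_zero]
    refine Finset.sum_congr rfl fun n _ => ?_
    rw [sum_insertPair hF hω, ← mul_assoc]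
    congr 1
    have : (2 * (n + 1)).factorial = (2 * n + 2) * ((2 * n + 1) * (2 * n).factorial) := by
      rw [show 2 * (n + 1) = 2 * n + 1 + 1 by ring, Nat.factorial_succ, Nat.factorial_succ]
    rw [this]
    have h1 : ((2 * n + 2 : ℕ) : ℂ) ≠ 0 := Nat.cast_ne_zero.2 (by omega)
    have h2 : ((2 * n + 1 : ℕ) : ℂ) ≠ 0 := Nat.cast_ne_zero.2 (by omega)
    have h3 : ((2 * n).factorial : ℂ) ≠ 0 := Nat.cast_ne_zero.2 (Nat.factorial_ne_zero _)
    rw [Nat.cast_mul, Nat.cast_mul]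
    field_simp

end InsertionSums

/-! ### The derivative of the sum over minimal graphs -/

section GraphSum

variable {Λ : ℕ} {lam : ℂ} {I : Finset ℕ} {t : ℕ → ℝ}

/-- The weighted integral of an amplitude. -/
def weightedIntegral (Λ : ℕ) (lam : ℂ) (I : Finset ℕ) (t : ℕ → ℝ) (H : Type) [Fintype H]
    (G : ResolventGraph H) : ℂ := (weight H G : ℂ) * graphIntegral Λ lam I t G

theorem isoInvariant_weightedIntegral (Λ : ℕ) (lam : ℂ) (I : Finset ℕ) (t : ℕ → ℝ) :
    IsoInvariant fun H _ G => weightedIntegral Λ lam I t H G := fun H H' _ _ G G' h => by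
  simp only [weightedIntegral, h.weight_eq, graphIntegral_congr h]

/-- Uncovered graphs have weight zero, and covered ones are minimal, so that the sum over minimal
graphs is a sum over covered labelled graphs. -/
theorem graphSum_eq_sum_labelledSum (Λ : ℕ) (lam : ℂ) (I Ω : Finset ℕ) (t : ℕ → ℝ) :
    graphSum (fun H G => weight H G) Λ lam I Ω t
      = ∑ n ∈ Finset.range (Ω.card + 1),
        labelledSum (fun H _ G => weightedIntegral Λ lam I t H G) Ω n := by
  classical
  rw [Finset.sum_range]
  have h1 : graphSum (fun H G => weight H G) Λ lam I Ω t
      = ∑ G : (Σ n : Fin (Ω.card + 1), Quotient (labelledSetoid Ω n)),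
        weightedIntegral Λ lam I t _ (Quotient.out G.2).1 := by
    unfold graphSum
    let e : MinimalGraphs Ω ≃ (Σ n : Fin (Ω.card + 1), Quotient (labelledSetoid Ω n)) :=
      Equiv.refl _
    exact Fintype.sum_equiv e _ _ fun G => rfl
  rw [h1, Fintype.sum_sigma' (fun (n : Fin (Ω.card + 1)) (q : Quotient (labelledSetoid Ω n)) =>
    weightedIntegral Λ lam I t _ (Quotient.out q).1)]
  refine Finset.sum_congr rfl fun n _ => ?_
  rw [labelledSum, sum_coveredGraph_eq (isoInvariant_weightedIntegral Λ lam I t), ← mul_assoc,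
    inv_mul_cancel₀ (Nat.cast_ne_zero.2 (Nat.factorial_ne_zero _)), one_mul]
  refine Finset.sum_congr rfl fun q _ => ?_
  split_ifs with hc
  · rfl
  · rw [weightedIntegral, weight, if_neg hc, Complex.ofReal_zero, zero_mul]

/-- The derivative with respect to `t^ω` of the sum over the graphs with marks `Ω` is the sum over
the graphs with marks `Ω ∪ {ω}`. -/
theorem hasDerivAt_graphSum (hlam : |lam.arg| < Real.pi) (ht : t ∈ paramCube) {Ω : Finset ℕ} {ω : ℕ}
    (hω : ω ∈ I) (hωΩ : ω ∉ Ω) (htω : t ω ∈ Set.Ioo (0 : ℝ) 1) :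
    HasDerivAt (fun s : ℝ => graphSum (fun H G => weight H G) Λ lam I Ω (Function.update t ω s))
      (graphSum (fun H G => weight H G) Λ lam I (insert ω Ω) t) (t ω) := by
  classical
  simp only [graphSum_eq_sum_labelledSum]
  rw [sum_labelledSum_insert (isoInvariant_weightedIntegral Λ lam I t) hωΩ]
  refine HasDerivAt.fun_sum fun n _ => HasDerivAt.const_mul _ (HasDerivAt.fun_sum fun G _ => ?_)
  refine ((hasDerivAt_graphIntegral hlam ht hω htω G.1).const_mul (weight _ G.1 : ℂ)).congr_deriv ?_
  rw [mul_add, Finset.mul_sum, Finset.mul_sum]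
  congr 1
  · refine Finset.sum_congr rfl fun h _ => ?_
    split_ifs
    · rw [weightedIntegral, markAt_weight (hG := G.2.1)]
    · rw [mul_zero]
  · refine Finset.sum_congr rfl fun o₁ _ => ?_
    rw [Finset.mul_sum]
    refine Finset.sum_congr rfl fun o₂ _ => ?_
    rw [Finset.mul_sum]
    refine Finset.sum_congr rfl fun s _ => ?_
    rw [Finset.mul_sum]
    refine Finset.sum_congr rfl fun s' _ => ?_
    rw [weightedIntegral, insertPair_weight (hG := G.2.1), insertWeight]
    push_cast
    split_ifs <;> push_cast <;> ring

end GraphSum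

open MeasureTheory

/-! ### The graph without half-edges -/

theorem cycleWeight_of_isEmpty {H : Type} [IsEmpty H] (τ : Equiv.Perm H) : cycleWeight τ = 1 := by
  simp [cycleWeight]

/-- The only graph without marks which contributes is the empty one, with weight and amplitude `1`.
-/
theorem partitionFn_eq_graphSum (Λ : ℕ) (lam : ℂ) (I : Finset ℕ) (t : ℕ → ℝ) :
    partitionFn Λ lam I t = graphSum (fun H G => weight H G) Λ lam I ∅ t := by
  rw [graphSum_eq_sum_labelledSum]
  simp only [Finset.card_empty, zero_add, Finset.sum_range_one, labelledSum]
  have : IsEmpty (Fin (2 * 0)) := inferInstanceAs (IsEmpty (Fin 0))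
  let G₀ : CoveredGraph ∅ (Fin (2 * 0)) :=
    ⟨⟨1, 1, fun h => h.elim0, fun h => h.elim0, fun h => h.elim0, fun h => h.elim0⟩,
      fun h => h.elim0, fun h => h.elim0, fun ω hω => absurd hω (Finset.notMem_empty ω)⟩
  have : Subsingleton (CoveredGraph ∅ (Fin (2 * 0))) := ⟨fun G G' => Subtype.ext
    (ext_of_eq (Subsingleton.elim _ _) (Subsingleton.elim _ _) (Subsingleton.elim _ _)
      (Subsingleton.elim _ _))⟩
  rw [Fintype.sum_subsingleton _ G₀]
  have hw : weight _ G₀.1 = 1 := by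
    rw [weight, if_pos G₀.2.1, cycleWeight_of_isEmpty, one_mul]
  have ha : ∀ x : Coord Λ, G₀.1.amplitude lam I t x = 1 := by
    intro x
    rw [amplitude_eq]
    have : Nonempty (Contraction Λ G₀.1.pair) := ⟨⟨fun h => h.elim0, fun h => h.elim0⟩⟩
    have : Subsingleton (Contraction Λ G₀.1.pair) :=
      ⟨fun k k' => Subtype.ext (Subsingleton.elim _ _)⟩
    rw [Fintype.sum_subsingleton _ (Classical.arbitrary _)]
    simp [order, loopTrace]
  simp [weightedIntegral, hw, graphIntegral, ha, partitionFn]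

/-! ### Taylor expansion with integral remainder, one parameter after the other -/

section Expansion

variable {Λ : ℕ} {lam : ℂ}

theorem Tame.continuousOn_integral {F : (ℕ → ℝ) → Coord Λ → ℂ} (hF : Tame F) :
    ContinuousOn (fun t => ∫ x, F t x ∂(nu Λ)) paramCube := by
  obtain ⟨A, hA, h⟩ := hF.2
  refine continuousOn_of_dominated (bound := fun x => A * Real.exp (A * fieldSize x))
    (fun t ht => (hF.integrable ht).aestronglyMeasurable)
    (fun t ht => Filter.Eventually.of_forall (h t ht)) ((integrable_exp_fieldSize A).const_mul A)
    (Filter.Eventually.of_forall fun x => ?_)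
  exact hF.1.comp (f := fun t => (t, x)) (by fun_prop) fun t ht => ⟨ht, trivial⟩

theorem tame_integrand (hlam : |lam.arg| < Real.pi) (I : Finset ℕ) {Ω : Finset ℕ}
    (G : MinimalGraphs Ω) : Tame fun t (x : Coord Λ) => integrand lam I G t x :=
  tame_exp_mul_amplitude hlam I G.graph

theorem continuousOn_graphSum (hlam : |lam.arg| < Real.pi) (c : (H : Type) → ResolventGraph H → ℝ)
    (I Ω : Finset ℕ) : ContinuousOn (graphSum c Λ lam I Ω) paramCube :=
  continuousOn_finsetSum _ fun G _ =>
    continuousOn_const.mul (tame_integrand hlam I G).continuousOn_integral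

/-- The fundamental theorem of calculus for the parameter `t^ω`. -/
theorem integral_graphSum_insert (hlam : |lam.arg| < Real.pi) {I Ω : Finset ℕ} {ω : ℕ} (hω : ω ∈ I)
    (hωΩ : ω ∉ Ω) {t : ℕ → ℝ} (ht : t ∈ paramCube) :
    graphSum (fun H G => weight H G) Λ lam I Ω (Function.update t ω 1)
      = graphSum (fun H G => weight H G) Λ lam I Ω (Function.update t ω 0)
        + ∫ s in Set.Icc (0 : ℝ) 1,
            graphSum (fun H G => weight H G) Λ lam I (insert ω Ω) (Function.update t ω s) := by
  have hc : ∀ Ω', ContinuousOn (fun s : ℝ =>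
      graphSum (fun H G => weight H G) Λ lam I Ω' (Function.update t ω s)) (Set.Icc 0 1) :=
    fun Ω' => (continuousOn_graphSum hlam _ I Ω').comp
      (show Continuous fun s : ℝ => Function.update t ω s from
        continuous_const.update ω continuous_id).continuousOn
      fun s hs => update_mem_paramCube ht ω hs
  have h := intervalIntegral.integral_eq_sub_of_hasDerivAt_of_le zero_le_one (hc Ω)
    (f' := fun s => graphSum (fun H G => weight H G) Λ lam I (insert ω Ω) (Function.update t ω s))
    (fun s hs => by
      have := hasDerivAt_graphSum hlam (update_mem_paramCube ht ω ⟨hs.1.le, hs.2.le⟩) hω hωΩ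
        (by simpa using hs) (Λ := Λ)
      simpa only [Function.update_idem, Function.update_self] using this)
    ((hc (insert ω Ω)).intervalIntegrable_of_Icc zero_le_one)
  rw [integral_Icc_eq_integral_Ioc, ← intervalIntegral.integral_of_le zero_le_one, h]
  ring

theorem cube_eq_restrict (Ω : Finset ℕ) :
    cube Ω = (volume : Measure (Ω → ℝ)).restrict (Set.univ.pi fun _ => Set.Icc (0 : ℝ) 1) := by
  rw [volume_pi, Measure.restrict_pi_pi]
  rfl

theorem ae_cube (Ω : Finset ℕ) : ∀ᵐ u ∂(cube Ω), ∀ ω, u ω ∈ Set.Icc (0 : ℝ) 1 := by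
  rw [cube_eq_restrict]
  filter_upwards [ae_restrict_mem (MeasurableSet.univ_pi fun _ => measurableSet_Icc)] with u hu ω
  exact hu ω trivial

instance (Ω : Finset ℕ) : IsFiniteMeasure (cube Ω) := by
  rw [cube_eq_restrict]
  exact ⟨by rw [Measure.restrict_apply_univ]; exact
    (isCompact_univ_pi fun _ => isCompact_Icc).measure_lt_top⟩

theorem integrable_cube {h : (ℕ → ℝ) → ℂ} (hh : ContinuousOn h paramCube) {Ω : Finset ℕ}
    {φ : (Ω → ℝ) → ℕ → ℝ} (hφ : Continuous φ)
    (hφ' : ∀ u, (∀ ω, u ω ∈ Set.Icc (0 : ℝ) 1) → φ u ∈ paramCube) :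
    Integrable (fun u => h (φ u)) (cube Ω) := by
  rw [cube_eq_restrict]
  exact ContinuousOn.integrableOn_compact (isCompact_univ_pi fun _ => isCompact_Icc)
    (hh.comp hφ.continuousOn fun u hu => hφ' u fun ω => hu ω trivial)

/-- The point of the cube with the coordinate `s` in the new direction. -/
def cubeInsert {Ω : Finset ℕ} (ω : ℕ) (p : (Ω → ℝ) × ℝ) (i : (insert ω Ω : Finset ℕ)) : ℝ :=
  if h : (i : ℕ) ∈ Ω then p.1 ⟨i, h⟩ else p.2

theorem measurePreserving_cubeInsert {Ω : Finset ℕ} {ω : ℕ} (hω : ω ∉ Ω) :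
    MeasurePreserving (cubeInsert (Ω := Ω) ω)
      ((cube Ω).prod (volume.restrict (Set.Icc (0 : ℝ) 1))) (cube (insert ω Ω)) := by
  have hm : Measurable (cubeInsert (Ω := Ω) ω) := by
    refine measurable_pi_lambda _ fun i => ?_
    unfold cubeInsert
    split_ifs
    · exact (measurable_pi_apply _).comp measurable_fst
    · exact measurable_snd
  refine ⟨hm, ?_⟩
  symm
  refine Measure.pi_eq fun s hs => ?_
  rw [Measure.map_apply hm (MeasurableSet.univ_pi hs)]
  have e : cubeInsert (Ω := Ω) ω ⁻¹' Set.univ.pi s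
      = (Set.univ.pi fun i : Ω => s ⟨i, Finset.mem_insert_of_mem i.2⟩) ×ˢ
        s ⟨ω, Finset.mem_insert_self ω Ω⟩ := by
    ext ⟨u, y⟩
    simp only [Set.mem_preimage, Set.mem_pi, Set.mem_univ, true_imp_iff, Set.mem_prod]
    constructor
    · intro h
      refine ⟨fun i => ?_, ?_⟩
      · have := h ⟨i, Finset.mem_insert_of_mem i.2⟩
        simpa [cubeInsert] using this
      · have := h ⟨ω, Finset.mem_insert_self ω Ω⟩
        simpa [cubeInsert, hω] using this
    · rintro ⟨h1, h2⟩ ⟨i, hi⟩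
      by_cases hiΩ : i ∈ Ω
      · simpa [cubeInsert, hiΩ] using h1 ⟨i, hiΩ⟩
      · obtain rfl := (Finset.mem_insert.1 hi).resolve_right hiΩ
        simpa [cubeInsert, hiΩ] using h2
  rw [e, Measure.prod_prod, cube, Measure.pi_pi, mul_comm]
  set g : ℕ → ENNReal := fun i => if h : i ∈ insert ω Ω then
    volume.restrict (Set.Icc (0 : ℝ) 1) (s ⟨i, h⟩) else 1
  have h : ∏ i : (insert ω Ω : Finset ℕ), g i = g ω * ∏ i : Ω, g i := by
    rw [Finset.prod_coe_sort (insert ω Ω) g, Finset.prod_insert hω, Finset.prod_coe_sort Ω g]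
  refine Eq.trans ?_ (h.symm.trans ?_)
  · refine congrArg₂ (· * ·) ?_ (Finset.prod_congr rfl fun i _ => ?_)
    · symm; exact dif_pos (Finset.mem_insert_self ω Ω)
    · symm; exact dif_pos (Finset.mem_insert_of_mem i.2)
  · refine Finset.prod_congr rfl fun i _ => ?_
    exact dif_pos i.2

/-- The parameters `u` on `Ω`, and `0` on the rest of `S`; the others are those of `t`. -/
def paste (S : Finset ℕ) {Ω : Finset ℕ} (t : ℕ → ℝ) (u : Ω → ℝ) (i : ℕ) : ℝ :=
  if h : i ∈ Ω then u ⟨i, h⟩ else if i ∈ S then 0 else t i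

theorem continuous_paste (S : Finset ℕ) {Ω : Finset ℕ} (t : ℕ → ℝ) :
    Continuous (paste S (Ω := Ω) t) := by
  refine continuous_pi fun i => ?_
  unfold paste
  split_ifs <;> fun_prop

theorem paste_mem_paramCube (S : Finset ℕ) {Ω : Finset ℕ} {t : ℕ → ℝ} (ht : t ∈ paramCube)
    {u : Ω → ℝ} (hu : ∀ ω, u ω ∈ Set.Icc (0 : ℝ) 1) : paste S t u ∈ paramCube := by
  intro i
  unfold paste
  split_ifs
  · exact hu _
  · simp
  · exact ht i

theorem paste_update {S Ω : Finset ℕ} (hΩ : Ω ⊆ S) {ω : ℕ} (hω : ω ∉ S) (t : ℕ → ℝ) (u : Ω → ℝ)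
    (s : ℝ) : paste S (Function.update t ω s) u = Function.update (paste S t u) ω s := by
  funext i
  by_cases hi : i = ω
  · subst hi
    have : i ∉ Ω := fun h => hω (hΩ h)
    simp [paste, this, hω]
  · simp [paste, hi]

theorem paste_insert {S Ω : Finset ℕ} (hΩ : Ω ⊆ S) {ω : ℕ} (hω : ω ∉ S) (t : ℕ → ℝ) (u : Ω → ℝ) :
    paste (insert ω S) t u = Function.update (paste S t u) ω 0 := by
  funext i
  by_cases hi : i = ω
  · subst hi
    have : i ∉ Ω := fun h => hω (hΩ h)
    simp [paste, this]
  · simp [paste, hi]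

theorem paste_cubeInsert {S Ω : Finset ℕ} (hΩ : Ω ⊆ S) {ω : ℕ} (hω : ω ∉ S) (t : ℕ → ℝ)
    (p : (Ω → ℝ) × ℝ) : paste (insert ω S) t (cubeInsert ω p)
      = Function.update (paste S t p.1) ω p.2 := by
  funext i
  by_cases hi : i = ω
  · subst hi
    have : i ∉ Ω := fun h => hω (hΩ h)
    simp [paste, cubeInsert, this]
  · simp only [paste, cubeInsert, Finset.mem_insert, hi, false_or, Function.update_of_ne,
      ne_eq, not_false_eq_true]
    split_ifs <;> rfl

/-- The expansion with respect to the parameters in `S`, by induction on `S`: each new parameter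
either is set to `0`, or is integrated and gives a mark. -/
theorem graphSum_expansion (hlam : |lam.arg| < Real.pi) {I : Finset ℕ} (S : Finset ℕ) (hS : S ⊆ I)
    {t : ℕ → ℝ} (ht : t ∈ paramCube) :
    graphSum (fun H G => weight H G) Λ lam I ∅ (fun i => if i ∈ S then 1 else t i)
      = ∑ Ω ∈ S.powerset, ∫ u : Ω → ℝ,
          graphSum (fun H G => weight H G) Λ lam I Ω (paste S t u) ∂(cube Ω) := by
  classical
  induction S using Finset.induction_on generalizing t with
  | empty =>
    have hp : ∀ u : (∅ : Finset ℕ) → ℝ, paste ∅ t u = t := fun u => by funext i; simp [paste]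
    have hcube : (cube ∅).real Set.univ = 1 := by
      rw [measureReal_def, cube, Measure.pi_univ]
      simp
    simp [hp, hcube]
  | insert ω S hω ih =>
    have hωI : ω ∈ I := hS (Finset.mem_insert_self ω S)
    have h1 : (fun i => if i ∈ insert ω S then 1 else t i)
        = fun i => if i ∈ S then 1 else Function.update t ω 1 i := by
      funext i
      by_cases hi : i = ω
      · subst hi; simp
      · simp [hi]
    rw [h1, ih ((Finset.subset_insert ω S).trans hS) (update_mem_paramCube ht ω (by simp)),
      Finset.sum_powerset_insert hω, ← Finset.sum_add_distrib]
    refine Finset.sum_congr rfl fun Ω hΩ => ?_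
    have hΩS := Finset.mem_powerset.1 hΩ
    have hωΩ : ω ∉ Ω := fun h => hω (hΩS h)
    have hmp := measurePreserving_cubeInsert hωΩ
    have hi1 := integrable_cube (continuousOn_graphSum (Λ := Λ) hlam (fun H G => weight H G) I Ω)
      (continuous_paste (insert ω S) (Ω := Ω) t) fun u hu => paste_mem_paramCube (insert ω S) ht hu
    have hi2 := integrable_cube
      (continuousOn_graphSum (Λ := Λ) hlam (fun H G => weight H G) I (insert ω Ω))
      (continuous_paste (insert ω S) (Ω := insert ω Ω) t)
      fun u hu => paste_mem_paramCube (insert ω S) ht hu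
    have hi3 : Integrable (fun p : (Ω → ℝ) × ℝ => graphSum (fun H G => weight H G) Λ lam I
        (insert ω Ω) (paste (insert ω S) t (cubeInsert ω p)))
        ((cube Ω).prod (volume.restrict (Set.Icc (0 : ℝ) 1))) :=
      (hmp.integrable_comp hi2.aestronglyMeasurable).2 hi2
    have h2 : ∫ u, graphSum (fun H G => weight H G) Λ lam I (insert ω Ω) (paste (insert ω S) t u)
          ∂(cube (insert ω Ω))
        = ∫ u : Ω → ℝ, (∫ s in Set.Icc (0 : ℝ) 1, graphSum (fun H G => weight H G) Λ lam I
          (insert ω Ω) (Function.update (paste S t u) ω s)) ∂(cube Ω) := by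
      conv_lhs => rw [← hmp.map_eq]
      rw [integral_map hmp.measurable.aemeasurable
        (by rw [hmp.map_eq]; exact hi2.aestronglyMeasurable), integral_prod _ hi3]
      simp only [paste_cubeInsert hΩS hω]
    have hi4 : Integrable (fun u : Ω → ℝ => ∫ s in Set.Icc (0 : ℝ) 1,
        graphSum (fun H G => weight H G) Λ lam I
          (insert ω Ω) (Function.update (paste S t u) ω s)) (cube Ω) := by
      have := hi3.integral_prod_left
      simpa only [Function.comp_apply, paste_cubeInsert hΩS hω] using this
    rw [h2, ← integral_add hi1 hi4]
    refine integral_congr_ae ?_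
    filter_upwards [ae_cube Ω] with u hu
    rw [paste_update hΩS hω, paste_insert hΩS hω]
    exact integral_graphSum_insert hlam hωI hωΩ (paste_mem_paramCube S ht hu)

theorem partitionFn_congr (Λ : ℕ) (lam : ℂ) {I : Finset ℕ} {t t' : ℕ → ℝ}
    (h : ∀ ω ∈ I, t ω = t' ω) : partitionFn Λ lam I t = partitionFn Λ lam I t' := by
  have h1 : prop Λ I t = prop Λ I t' := Finset.sum_congr rfl fun ω hω => by rw [h ω hω]
  have h2 : ∀ m : Fin (Λ + 1), tadpole I t m = tadpole I t' m := fun m =>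
    Finset.sum_congr rfl fun ω hω => by rw [h ω hω]
  simp only [partitionFn, interaction, vertexOp, h1, h2]

theorem continuous_extendZero (Ω : Finset ℕ) : Continuous (extendZero (Ω := Ω)) := by
  refine continuous_pi fun i => ?_
  unfold extendZero
  split_ifs <;> fun_prop

theorem extendZero_mem_paramCube {Ω : Finset ℕ} {u : Ω → ℝ}
    (hu : ∀ ω, u ω ∈ Set.Icc (0 : ℝ) 1) : extendZero u ∈ paramCube := by
  intro i
  unfold extendZero
  split_ifs
  · exact hu _
  · simp

theorem integrable_integrand_prod (hlam : |lam.arg| < Real.pi) (I : Finset ℕ) {Ω : Finset ℕ}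
    (G : MinimalGraphs Ω) :
    Integrable (fun p : Coord Λ × (Ω → ℝ) => integrand lam I G (extendZero p.2) p.1)
      ((nu Λ).prod (cube Ω)) :=
  (tame_integrand hlam I G).integrable_prod (continuous_extendZero Ω)
    fun _ hu => extendZero_mem_paramCube hu

theorem partitionFn_expansion (hlam : |lam.arg| < Real.pi) (I : Finset ℕ) :
    partitionFn Λ lam I (fun _ => 1) = ∑ Ω ∈ I.powerset, ∑ G : MinimalGraphs Ω,
      (weight _ G.graph : ℂ) *
        ∫ x, (∫ t, integrand lam I G (extendZero t) x ∂(cube Ω)) ∂(nu Λ) := by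
  rw [partitionFn_congr Λ lam (t' := fun i => if i ∈ I then 1 else 0) fun ω hω => by simp [hω],
    partitionFn_eq_graphSum,
    graphSum_expansion hlam I subset_rfl (t := fun _ => 0) fun ω => by simp]
  refine Finset.sum_congr rfl fun Ω hΩ => ?_
  have hp : ∀ u : Ω → ℝ, paste I (fun _ => 0) u = extendZero u := fun u => by
    funext i; simp [paste, extendZero]
  simp only [hp, graphSum]
  rw [integral_finsetSum]
  · refine Finset.sum_congr rfl fun G _ => ?_
    rw [integral_const_mul]
    congr 1
    exact (integral_integral_swap (integrable_integrand_prod hlam I G)).symm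
  · intro G _
    exact (integrable_cube (tame_integrand hlam I G).continuousOn_integral
      (continuous_extendZero Ω) fun u hu => extendZero_mem_paramCube hu).const_mul _

end Expansion

/-! ### Slices -/

theorem slice_eq_of_mem {M : ℕ} (hM : 1 ≤ M) {j j' x : ℕ} (hj : x ∈ slice M j)
    (hj' : x ∈ slice M j') : j = j' := by
  have key : ∀ {a b : ℕ}, x ∈ slice M a → x ∈ slice M b → a ≤ b := by
    intro a b ha hb
    by_contra h
    have h1 := Nat.pow_le_pow_right hM (show b + 1 ≤ a by omega)
    have h2 := (Finset.mem_Ico.1 ha).1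
    have h3 := (Finset.mem_Ico.1 hb).2
    omega
  exact le_antisymm (key hj hj') (key hj' hj)

/-- A set of indices is a union of nonempty subsets of the slices which it meets. -/
theorem sum_refinedSets {M : ℕ} (hM : 1 ≤ M) (jmax : ℕ) (f : Finset ℕ → ℂ) :
    ∑ J ∈ (Finset.range (jmax + 1)).powerset, ∑ Ω ∈ refinedSets M J, f Ω
      = ∑ Ω ∈ (allIndices M jmax).powerset, f Ω := by
  rw [← Finset.sum_fiberwise_of_maps_to (s := (allIndices M jmax).powerset) (f := f)
    (t := (Finset.range (jmax + 1)).powerset)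
    (g := fun Ω => (Finset.range (jmax + 1)).filter fun j => (Ω ∩ slice M j).Nonempty)
    fun Ω _ => Finset.mem_powerset.2 (Finset.filter_subset _ _)]
  refine Finset.sum_congr rfl fun J hJ => Finset.sum_congr ?_ fun _ _ => rfl
  have hJ' := Finset.mem_powerset.1 hJ
  ext Ω
  simp only [refinedSets, Finset.mem_filter, Finset.mem_powerset]
  constructor
  · rintro ⟨h1, h2⟩
    refine ⟨h1.trans (Finset.biUnion_subset_biUnion_of_subset_left _ hJ'), ?_⟩
    ext j
    simp only [Finset.mem_filter]
    refine ⟨?_, fun hj => ⟨hJ' hj, h2 j hj⟩⟩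
    rintro ⟨-, x, hx⟩
    obtain ⟨hx1, hx2⟩ := Finset.mem_inter.1 hx
    obtain ⟨j', hj', hx3⟩ := Finset.mem_biUnion.1 (h1 hx1)
    rwa [slice_eq_of_mem hM hx2 hx3]
  · rintro ⟨h1, rfl⟩
    refine ⟨fun x hx => ?_, fun j hj => (Finset.mem_filter.1 hj).2⟩
    obtain ⟨j, hj, hxj⟩ := Finset.mem_biUnion.1 (h1 hx)
    exact Finset.mem_biUnion.2
      ⟨j, Finset.mem_filter.2 ⟨hj, x, Finset.mem_inter.2 ⟨hx, hxj⟩⟩, hxj⟩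

end GW2

end

theorem mainTheorem2 :
    ∃ c : (H : Type) → GW2.ResolventGraph H → ℝ,
      (∀ (H : Type) [Finite H] (G : GW2.ResolventGraph H), 0 ≤ c H G ∧ c H G ≤ 1) ∧
      (∀ (H H' : Type) [Finite H] [Finite H'] (G : GW2.ResolventGraph H)
        (G' : GW2.ResolventGraph H'), G.Iso G' → c H G = c H' G') ∧
      (∀ (H : Type) [Finite H] (G : GW2.ResolventGraph H),
        c H G = ∏ K : G.Component, c _ (G.restrict K)) ∧
      ∀ (M Λ jmax : ℕ) (lam : ℂ), 2 ≤ M → |lam.arg| < Real.pi →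
        -- everything is well defined
        (∀ (t : ℕ → ℝ) (x : GW2.Coord Λ), (∀ ω, t ω ∈ Set.Icc (0 : ℝ) 1) →
          IsUnit (1 + GW2.vertexOp lam (GW2.allIndices M jmax) t x)) ∧
        (∀ t : ℕ → ℝ, (∀ ω, t ω ∈ Set.Icc (0 : ℝ) 1) →
          MeasureTheory.Integrable
            (fun x : GW2.Coord Λ =>
              Complex.exp (GW2.interaction lam (GW2.allIndices M jmax) t x)) (GW2.nu Λ)) ∧
        (∀ Ω ⊆ GW2.allIndices M jmax, ∀ G : GW2.MinimalGraphs Ω,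
          (∀ t : ℕ → ℝ, (∀ ω, t ω ∈ Set.Icc (0 : ℝ) 1) →
            MeasureTheory.Integrable
              (fun x : GW2.Coord Λ => GW2.integrand lam (GW2.allIndices M jmax) G t x)
              (GW2.nu Λ)) ∧
          MeasureTheory.Integrable
            (fun p : GW2.Coord Λ × (Ω → ℝ) =>
              GW2.integrand lam (GW2.allIndices M jmax) G (GW2.extendZero p.2) p.1)
            ((GW2.nu Λ).prod (GW2.cube Ω))) ∧
        -- the slice-testing expansion of the partition function
        (GW2.partitionFn Λ lam (GW2.allIndices M jmax) (fun _ => 1) =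
          ∑ J ∈ (Finset.range (jmax + 1)).powerset, ∑ Ω ∈ GW2.refinedSets M J,
            ∑ G : GW2.MinimalGraphs Ω, (c _ G.graph : ℂ) *
              ∫ x, (∫ t, GW2.integrand lam (GW2.allIndices M jmax) G (GW2.extendZero t) x
                ∂(GW2.cube Ω)) ∂(GW2.nu Λ)) ∧
        -- exact cancellation of the tadpoles, one derivation at a time
        (∀ t : ℕ → ℝ, (∀ ω, t ω ∈ Set.Icc (0 : ℝ) 1) →
          GW2.partitionFn Λ lam (GW2.allIndices M jmax) t =
            GW2.graphSum c Λ lam (GW2.allIndices M jmax) ∅ t) ∧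
        ∀ Ω ⊆ GW2.allIndices M jmax, ∀ ω ∈ GW2.allIndices M jmax, ω ∉ Ω →
          ∀ t : ℕ → ℝ, (∀ ω', t ω' ∈ Set.Icc (0 : ℝ) 1) → t ω ∈ Set.Ioo (0 : ℝ) 1 →
            HasDerivAt
              (fun s : ℝ =>
                GW2.graphSum c Λ lam (GW2.allIndices M jmax) Ω (Function.update t ω s))
              (GW2.graphSum c Λ lam (GW2.allIndices M jmax) (insert ω Ω) t) (t ω) := by
  refine ⟨fun H G => GW2.ResolventGraph.weight H G, fun H _ G =>
    ⟨GW2.ResolventGraph.weight_nonneg G, GW2.ResolventGraph.weight_le_one G⟩,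
    fun H H' _ _ G G' h => h.weight_eq, fun H _ G => GW2.ResolventGraph.weight_eq_prod G, ?_⟩
  intro M Λ jmax lam hM hlam
  refine ⟨fun t x ht => GW2.isUnit_one_add_vertexOp hlam ht x,
    fun t ht => (GW2.tame_exp_interaction hlam _).integrable ht,
    fun Ω _ G => ⟨fun t ht => (GW2.tame_integrand hlam _ G).integrable ht,
      GW2.integrable_integrand_prod hlam _ G⟩, ?_, fun t _ =>
    GW2.partitionFn_eq_graphSum Λ lam _ t,
    fun Ω _ ω hω hωΩ t ht htω => GW2.hasDerivAt_graphSum hlam ht hω hωΩ htω⟩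
  rw [GW2.sum_refinedSets (by omega) jmax]
  exact GW2.partitionFn_expansion hlam _
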